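/- **Theorem (Error bound of FedSGD).** *Setting.* Let $d,m\ge 1$. Client $i\in\{1,\dots,m\}$ holds observations $X^{(i)}_1,\dots,X^{(i)}_{n_i}$, $n_i\ge 1$; all observations are i.i.d. with law $F$ on a sample space $\mathcal X$. Put $N=\sum_i n_i$, $n_{\min}=\min_i n_i$, $a\vee b=\max(a,b)$. Let $\rho:\mathcal X\times\mathbb R^d\to\mathbb R$ be a loss that is twice continuously differentiable in $\theta$, with $\rho(X,\theta)$ integrable for every $\theta$ (gradients $\nabla$ and Hessians $\nabla^2$ are in $\theta$). Let $\tau_1,\tau_2,C_1,C_2,W>0$ and suppose: 1. $\Theta\subset\mathbb R^d$ is compact and convex, and $\theta_0\in\Theta$ is the unique global minimizer of $L_0(\theta)=\mathbb E\,\rho(X,\theta)$, $X\sim F$; 2. $\mathbb E\,\nabla^2\rho(X,\theta)\succeq\tau_1 I_d$ for all $\theta\in\mathbb R^d$; 3. for all $\theta\in\mathbb R^d$, all unit vectors $v$ and all $t\ge 0$, $\mathbb P\big(v^\top(\nabla\rho(X,\theta)-\mathbb E\nabla\rho(X,\theta))\ge t\big)\le e^{-t^2/C_1^2}$ and $\mathbb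 P\big(v^\top(\nabla^2\rho(X,\theta)-\mathbb E\nabla^2\rho(X,\theta))v\ge t\big)\le e^{-t^2/C_2^2}$; 4. $\|\nabla^2\rho(x,\theta)-\nabla^2\rho(x,\theta')\|\le W\|\theta-\theta'\|$ and $\|\nabla^2\rho(x,\theta)\|\le\tau_2$ for all $x\in\mathcal X$, $\theta,\theta'\in\mathbb R^d$. Let $L_i(\theta)=\frac1{n_i}\sum_j\rho(X^{(i)}_j,\theta)$ and $\dot L_i=\nabla L_i$. *Algorithm.* Given $K\in\mathbb N$, a step size $\eta$, a privacy parameter $\mu>0$, a norm bound $B$, weights $w_i\ge 0$ with $\sum_i w_i=1$, and an initial point $\theta^{(0)}$, for $k=0,\dots,K-1$ set $$\theta^{(k+1)}=\theta^{(k)}-\eta\sum_{i=1}^m w_i\Big(\dot L_i(\theta^{(k)})+\frac{2B\sqrt K}{\mu n_i}Z_{ik}\Big),\qquad Z_{ik}\sim\mathcal N(0,I_d)\ \text{i.i.d.},$$ where the data, the noise and $\theta^{(0)}$ are independent. Let $C_B>0$ and $B=C_B\sqrt{d\vee\log N}$, let $\frac1{2\tau_2}\le\eta\le\frac9{10\tau_2}$,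 and let $0<\mu\le\bar\mu$. **(i)** There is a constant $C>0$, depending only on $\tau_1,\tau_2,C_1,C_2,W,C_B,\bar\mu$, such that, with $\gamma_1=1+C\sqrt{(d\vee\log N)/n_{\min}}-\eta\tau_1$, whenever $\gamma_1<1$ and $\mathbb E\|\theta^{(0)}\|^2<\infty$, for all $K$ and all weights $w$, $\mathbb E\|\theta^{(K)}-\theta_0\|^2$ is finite and $$\mathbb E\|\theta^{(K)}-\theta_0\|^2\le 3\Big(1-\frac{\tau_1}{3\tau_2}\Big)^{2K}\mathbb E\|\theta^{(0)}-\theta_0\|^2+\frac4{(1-\gamma_1)^2}\Big(\eta^2\,\mathbb E\Big\|\sum_{i=1}^m w_i\dot L_i(\theta_0)\Big\|^2+\frac{\eta^2C_B^2Kd(d\vee\log N)}{\mu^2}\sum_{i=1}^m\frac{w_i^2}{n_i^2}\Big).$$ **(ii)** Let $R,R_0>0$. There is a constant $C>0$, depending only on $\tau_1,\tau_2,C_1,C_2,W,C_B,\bar\mu,R,R_0$, such that the following holds whenever $\Theta\subset\{\|\theta\|\le R\sqrt d\}$, $\|\theta^{(0)}\|\le R_0\sqrt d$ almost surely and $n_{\min}\ge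 Cd$. Let $\Sigma=\operatorname{Var}(\nabla\rho(X,\theta_0))$, $K=\big\lceil 2\log(dN)/\log\frac{3\tau_2}{3\tau_2-\tau_1}\big\rceil$, $V_i=\frac{\operatorname{trace}(\Sigma)}{n_i}+\frac{C_B^2d(d\vee\log N)K}{\mu^2n_i^2}$ and $\hat w_i=V_i^{-1}/\sum_jV_j^{-1}$. Then $\hat w$ minimizes $\sum_iw_i^2V_i$ over all weights $w$, and the algorithm run with $K$ iterations and weights $\hat w$ satisfies that $\mathbb E\|\theta^{(K)}-\theta_0\|^2$ is finite and $$\mathbb E\|\theta^{(K)}-\theta_0\|^2\le\frac{17}{\tau_1^2}\left(\sum_{i=1}^m\left(\frac{\operatorname{trace}(\Sigma)}{n_i}+\frac{2C_B^2d(d\vee\log N)\log(dN)}{\mu^2n_i^2\log\frac{3\tau_2}{3\tau_2-\tau_1}}\right)^{-1}\right)^{-1}.$$ -/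

import Mathlib

open MeasureTheory ProbabilityTheory

noncomputable section

namespace FedSGD

/-- The parameter space `ℝ^d` with its Euclidean norm. -/
abbrev Param (d : ℕ) := EuclideanSpace ℝ (Fin d)

/-- The Hessian `∇²ρ(x, θ)` in the parameter, as a linear operator; operators on `ℝ^d` carry the
spectral norm. -/
def hess {𝒳 : Type*} {d : ℕ} (ρ : 𝒳 → Param d → ℝ) (x : 𝒳) (θ : Param d) :
    Param d →L[ℝ] Param d :=
  fderiv ℝ (gradient (ρ x)) θ

/-- The expected loss `L₀(θ) = 𝔼 ρ(X, θ)`, where `X ∼ F`. -/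
def risk {𝒳 : Type*} [MeasurableSpace 𝒳] {d : ℕ} (F : Measure 𝒳) (ρ : 𝒳 → Param d → ℝ)
    (θ : Param d) : ℝ :=
  ∫ x, ρ x θ ∂F

/-- The trace of `Σ = Var(∇ρ(X, θ₀))`, the covariance matrix of the gradient at `θ₀`. -/
def gradCovTrace {𝒳 : Type*} [MeasurableSpace 𝒳] {d : ℕ} (F : Measure 𝒳)
    (ρ : 𝒳 → Param d → ℝ) (θ₀ : Param d) : ℝ :=
  Matrix.trace (Matrix.of fun a b : Fin d =>
    covariance (fun x => gradient (ρ x) θ₀ a) (fun x => gradient (ρ x) θ₀ b) F)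

/-- The standing assumptions on the distribution `F` of one observation, the loss `ρ`, the compact
convex parameter set `Θ` and the target `θ₀`. The iterates of the algorithm are not projected and
carry Gaussian noise, so they leave every bounded set; the conditions on `ρ` are therefore imposed
at all points of `ℝ^d`. -/
structure LossAssumptions {𝒳 : Type*} [MeasurableSpace 𝒳] {d : ℕ} (F : Measure 𝒳)
    (ρ : 𝒳 → Param d → ℝ) (Θ : Set (Param d)) (θ₀ : Param d) (τ₁ τ₂ C₁ C₂ W : ℝ) : Prop where
  measurable : ∀ θ, Measurable fun x => ρ x θ
  integrable : ∀ θ, Integrable (fun x => ρ x θ) F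
  contDiff : ∀ x, ContDiff ℝ 2 (ρ x)
  isCompact : IsCompact Θ
  convex : Convex ℝ Θ
  mem : θ₀ ∈ Θ
  /-- `θ₀` is the unique global minimizer of the expected loss. -/
  unique_min : ∀ θ, θ ≠ θ₀ → risk F ρ θ₀ < risk F ρ θ
  /-- `𝔼 ∇²ρ(X, θ) ⪰ τ₁ I`. -/
  strong_convex : ∀ θ v, τ₁ * ‖v‖ ^ 2 ≤ inner ℝ v ((∫ x, hess ρ x θ ∂F) v)
  subGaussian_grad : ∀ θ v, ‖v‖ = 1 → ∀ t : ℝ, 0 ≤ t →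
    F.real {x | t ≤ inner ℝ v (gradient (ρ x) θ - ∫ y, gradient (ρ y) θ ∂F)}
      ≤ Real.exp (-t ^ 2 / C₁ ^ 2)
  subGaussian_hess : ∀ θ v, ‖v‖ = 1 → ∀ t : ℝ, 0 ≤ t →
    F.real {x | t ≤ inner ℝ v ((hess ρ x θ - ∫ y, hess ρ y θ ∂F) v)}
      ≤ Real.exp (-t ^ 2 / C₂ ^ 2)
  lipschitz_hess : ∀ x θ θ', ‖hess ρ x θ - hess ρ x θ'‖ ≤ W * ‖θ - θ'‖
  bounded_hess : ∀ x θ, ‖hess ρ x θ‖ ≤ τ₂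

/-- The randomness: client `i` holds the observations `X i j`, `j < n i`, all observations are
i.i.d. with law `F`; the noise vectors `Z k i` are i.i.d. standard Gaussian; data, noise and the
initial point `θinit` are mutually independent. -/
structure Sampling {Ω 𝒳 : Type*} [MeasurableSpace Ω] [MeasurableSpace 𝒳] {d m : ℕ}
    (P : Measure Ω) (F : Measure 𝒳) (n : Fin m → ℕ) (X : (i : Fin m) → Fin (n i) → Ω → 𝒳)
    (Z : ℕ → Fin m → Ω → Param d) (θinit : Ω → Param d) : Prop where
  measurable_data : ∀ i j, Measurable (X i j)
  measurable_noise : ∀ k i, Measurable (Z k i)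
  measurable_init : Measurable θinit
  law_data : ∀ i j, P.map (X i j) = F
  law_noise : ∀ k i, P.map (Z k i) = stdGaussian (Param d)
  indep_data : iIndepFun (fun p : (Σ i : Fin m, Fin (n i)) => X p.1 p.2) P
  indep_noise : iIndepFun (fun p : ℕ × Fin m => Z p.1 p.2) P
  indep_data_noise : IndepFun (fun ω i j => X i j ω) (fun ω k i => Z k i ω) P
  indep_init : IndepFun θinit
    (fun ω => ((fun i j => X i j ω : (i : Fin m) → Fin (n i) → 𝒳),
      (fun k i => Z k i ω : ℕ → Fin m → Param d))) P

/-- The total sample size `N`. -/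
def totalSize {m : ℕ} (n : Fin m → ℕ) : ℕ := ∑ i, n i

/-- The smallest local sample size (used for `m ≥ 1`). -/
def minSize {m : ℕ} (n : Fin m → ℕ) : ℕ := ⨅ i, n i

/-- `d ∨ log N`. -/
def dimLog (d N : ℕ) : ℝ := max (d : ℝ) (Real.log N)

/-- The gradient of the local empirical loss,
`∇L_i(θ) = (1 / n_i) ∑_j ∇ρ(X_j^{(i)}, θ)`. -/
def localGrad {Ω 𝒳 : Type*} {d m : ℕ} (ρ : 𝒳 → Param d → ℝ) (n : Fin m → ℕ)
    (X : (i : Fin m) → Fin (n i) → Ω → 𝒳) (i : Fin m) (θ : Param d) (ω : Ω) : Param d :=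
  (1 / (n i : ℝ)) • ∑ j, gradient (ρ (X i j ω)) θ

/-- The noise level `σ_i = 2 B √K / (μ n_i)` of a client with `ni` observations. -/
def noiseLevel (B μ : ℝ) (K ni : ℕ) : ℝ := 2 * B * √(K : ℝ) / (μ * ni)

/-- The iterates `θ^{(k)}` of the algorithm run with total number of iterations `K` (which fixes
the noise level), step size `η`, weights `w`, privacy parameter `μ` and norm bound `B`. -/
def iterate {Ω 𝒳 : Type*} {d m : ℕ} (ρ : 𝒳 → Param d → ℝ) (n : Fin m → ℕ)
    (X : (i : Fin m) → Fin (n i) → Ω → 𝒳) (Z : ℕ → Fin m → Ω → Param d)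
    (θinit : Ω → Param d) (w : Fin m → ℝ) (η μ B : ℝ) (K : ℕ) : ℕ → Ω → Param d
  | 0, ω => θinit ω
  | k + 1, ω =>
      iterate ρ n X Z θinit w η μ B K k ω -
        η • ∑ i, w i • (localGrad ρ n X i (iterate ρ n X Z θinit w η μ B K k ω) ω +
          noiseLevel B μ K (n i) • Z k i ω)

/-- The output `θ^{(K)}`. -/
def output {Ω 𝒳 : Type*} {d m : ℕ} (ρ : 𝒳 → Param d → ℝ) (n : Fin m → ℕ)
    (X : (i : Fin m) → Fin (n i) → Ω → 𝒳) (Z : ℕ → Fin m → Ω → Param d)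
    (θinit : Ω → Param d) (w : Fin m → ℝ) (η μ B : ℝ) (K : ℕ) (ω : Ω) : Param d :=
  iterate ρ n X Z θinit w η μ B K K ω

/-- `γ₁ = 1 + C √((d ∨ log N) / n_min) - η τ₁`. -/
def gammaOne {m : ℕ} (C η τ₁ : ℝ) (d : ℕ) (n : Fin m → ℕ) : ℝ :=
  1 + C * √(dimLog d (totalSize n) / minSize n) - η * τ₁

/-- `2 log(dN) / log(3τ₂ / (3τ₂ - τ₁))`, the prescribed number of iterations before rounding. -/
def iterBound (τ₁ τ₂ : ℝ) (d N : ℕ) : ℝ :=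
  2 * Real.log ((d : ℝ) * N) / Real.log (3 * τ₂ / (3 * τ₂ - τ₁))

/-- The variance proxy
`trace(Σ) / n_i + C_B² d (d ∨ log N) κ / (μ² n_i²)` of client `i`, where `trVar` stands for `trace(Σ)`. -/
def clientVar {m : ℕ} (trVar CB μ κ : ℝ) (d : ℕ) (n : Fin m → ℕ) (i : Fin m) : ℝ :=
  trVar / n i + CB ^ 2 * d * dimLog d (totalSize n) * κ / (μ ^ 2 * (n i : ℝ) ^ 2)

/-- The weights proportional to `V_i⁻¹`, normalized to sum to one. -/
def invWeights {m : ℕ} (V : Fin m → ℝ) (i : Fin m) : ℝ := (V i)⁻¹ / ∑ j, (V j)⁻¹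

end FedSGD

end

/-! The iterates are unprojected, carry Gaussian noise and reuse the same data in every round, so
the empirical gradient must be controlled simultaneously at all points of `ℝ^d`. Let `g` be the
weighted empirical gradient, `G` its mean, `D = d ∨ log N` and `v = ∑ wᵢ²/nᵢ`. The new error is `(θ
- θ₀) - η(g θ - g θ₀)`, minus `η g θ₀`, minus the noise of the round.

The mean step contracts by `1 - ητ₁`, because `I - η∇G` is symmetric with spectrum in `[0, 1 - ητ₁]`
(`LossAssumptions.contraction`). It remains to bound `(g - G)(θ) - (g - G)(θ₀)` by a small multiple
of `‖θ - θ₀‖`. On one ball of radius `r`, chaining gives the bound `r √(D v)` up to a constant,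
outside an event of probability `e^{-18D} ≤ N^{-18}` (`IsSubGaussianField.measure_devEvent_le`).
This probability does not decrease with `r`, so it cannot be summed over all dyadic radii. On huge
balls the permitted deviation grows with `r` while the sub-Gaussian tails of single gradients do not
depend on the point, so a crude union bound wins
(`IsSubGaussianField.measure_devEvent_le_of_radius`). Together the `j`-th dyadic ball fails with
probability at most `8^{-j}`, and since `∑ 4^j 8^{-j}` converges, the linear bound holds outside a
random ball whose squared radius `S` has mean `O(N^{-2})` (`IsSubGaussianField.exists_envelope`).
Inside that ball the step is at most `2‖θ - θ₀‖`, which costs `4S`.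

The noise of a round is independent of the past and centred, so its variance simply adds. The term
`g θ₀` is correlated with the iterates and is split off by Young's inequality with a free parameter.
The privacy noise is itself at least of order `N^{-2}`, because `∑ wᵢ²/nᵢ² ≥ N^{-2}` and `μ ≤ μbar`;
it absorbs the mean of `S`. Solving the resulting affine recursion gives the bound for arbitrary
weights (`LossAssumptions.integral_norm_iterate_le`), provided `D v` is small.

For the optimal weights, Cauchy–Schwarz identifies the minimum of `∑ wᵢ² Vᵢ` as `(∑ Vᵢ⁻¹)⁻¹`. That
`n_min ≥ C d` suffices, with no `log N`, rests on `v² ≤ 1/(N n_min)` for these weights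
(`sum_invWeights_sq_div_sq_le`) combined with `D² ≤ d² + 4N`. The prescribed number of rounds
shrinks the squared initial error by `(dN)^{-4}`, far below the noise floor. -/

open MeasureTheory ProbabilityTheory

noncomputable section

set_option linter.unusedSectionVars false

namespace FedSGD

/-! ### Nets of the unit ball and dyadic refinement trees -/

section Net

variable {E : Type*} [NormedAddCommGroup E] [InnerProductSpace ℝ E]

/-- A finite `1/2`-net of the unit ball, contained in the unit ball. -/
structure IsHalfNet (U : Finset E) : Prop where
  norm_le : ∀ u ∈ U, ‖u‖ ≤ 1
  exists_near : ∀ x : E, ‖x‖ ≤ 1 → ∃ u ∈ U, ‖x - u‖ ≤ 1 / 2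

/-- A `1/2`-separated subset of the ball of maximal cardinality is a net: a point farther than `1/2`
from all its elements could be added. -/
theorem exists_isHalfNet [FiniteDimensional ℝ E] :
    ∃ U : Finset E, IsHalfNet U ∧ U.card ≤ 5 ^ Module.finrank ℝ E := by
  classical
  let good : Finset E → Prop := fun s =>
    (∀ c ∈ s, ‖c‖ ≤ 1) ∧ ∀ c ∈ s, ∀ e ∈ s, c ≠ e → 1 / 2 ≤ ‖c - e‖
  have hcard : ∀ s, good s → s.card ≤ 5 ^ Module.finrank ℝ E := by
    intro s hs
    -- Doubling gives a `1`-separated set in the ball of radius `2`, the normalization of the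
    -- packing bound `5^d`.
    have hinj : Function.Injective fun x : E => (2 : ℝ) • x :=
      smul_right_injective E two_ne_zero
    rw [← Finset.card_image_of_injective s hinj]
    apply Besicovitch.card_le_of_separated
    · simp only [Finset.mem_image, forall_exists_index, and_imp, forall_apply_eq_imp_iff₂]
      intro c hc
      rw [norm_smul, Real.norm_two]
      linarith [hs.1 c hc]
    · simp only [Finset.mem_image, forall_exists_index, and_imp, forall_apply_eq_imp_iff₂]
      intro c hc e he hne
      rw [← smul_sub, norm_smul, Real.norm_two]
      have := hs.2 c hc e he fun h => hne (by rw [h])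
      linarith
  obtain ⟨k, ⟨U, hU, hk⟩, hmax⟩ :
      ∃ k, (∃ s, good s ∧ s.card = k) ∧ ∀ j, (∃ s, good s ∧ s.card = j) → j ≤ k := by
    let Q : ℕ → Prop := fun k => ∃ s, good s ∧ s.card = k
    have h0 : Q 0 := ⟨∅, by simp [good], rfl⟩
    refine ⟨Nat.findGreatest Q (5 ^ Module.finrank ℝ E), ?_, ?_⟩
    · exact Nat.findGreatest_spec (P := Q) (Nat.zero_le _) h0
    · rintro j ⟨s, hs, rfl⟩
      exact Nat.le_findGreatest (hcard s hs) ⟨s, hs, rfl⟩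
  refine ⟨U, ⟨hU.1, fun x hx => ?_⟩, hcard U hU⟩
  by_contra! hfar
  have hxU : x ∉ U := fun h => by
    have := hfar x h
    rw [sub_self, norm_zero] at this
    linarith
  have hgood : good (insert x U) := by
    constructor
    · intro c hc
      rcases Finset.mem_insert.1 hc with rfl | hc
      exacts [hx, hU.1 c hc]
    · intro c hc e he hne
      rw [Finset.mem_insert] at hc he
      rcases hc with rfl | hc <;> rcases he with rfl | he
      · exact absurd rfl hne
      · exact (hfar e he).le
      · rw [norm_sub_rev]; exact (hfar c hc).le
      · exact hU.2 c hc e he hne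
  have := hmax _ ⟨_, hgood, rfl⟩
  rw [Finset.card_insert_of_notMem hxU, hk] at this
  omega

/-- The net point near `x/‖x‖` loses at most half of `⟪x/‖x‖, x⟫ = ‖x‖`. Norm bounds thus reduce to
finitely many scalar tail events. -/
theorem IsHalfNet.norm_le_of_inner_le {U : Finset E} (hU : IsHalfNet U) {x : E} {t : ℝ}
    (h : ∀ u ∈ U, inner ℝ u x ≤ t) : ‖x‖ ≤ 2 * t := by
  rcases eq_or_ne x 0 with rfl | hx
  · obtain ⟨u, hu, -⟩ := hU.exists_near 0 (by simp)
    have := h u hu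
    rw [inner_zero_right] at this
    simpa using this
  have hpos : 0 < ‖x‖ := norm_pos_iff.2 hx
  obtain ⟨u, hu, hxu⟩ := hU.exists_near (‖x‖⁻¹ • x) (by
    rw [norm_smul, norm_inv, norm_norm, inv_mul_cancel₀ hpos.ne'])
  have h1 : inner ℝ (‖x‖⁻¹ • x) x = ‖x‖ := by
    rw [real_inner_smul_left, real_inner_self_eq_norm_sq]; field_simp
  have h2 : inner ℝ (‖x‖⁻¹ • x - u) x ≤ 1 / 2 * ‖x‖ :=
    (real_inner_le_norm _ _).trans (by gcongr)
  rw [inner_sub_left, h1] at h2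
  linarith [h u hu]

open scoped Classical in
/-- The nodes at level `l` of the dyadic tree that refines a ball of radius `r` around `θ₀`. -/
def treeLevel (U : Finset E) (r : ℝ) (θ₀ : E) : ℕ → Finset E
  | 0 => {θ₀}
  | l + 1 => Finset.image₂ (fun p u => p + (r / 2 ^ l) • u) (treeLevel U r θ₀ l) U

theorem card_treeLevel_le (U : Finset E) (r : ℝ) (θ₀ : E) (l : ℕ) :
    (treeLevel U r θ₀ l).card ≤ U.card ^ l := by
  classical
  induction l with
  | zero => simp [treeLevel]
  | succ l ih =>
    rw [treeLevel, pow_succ]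
    exact Finset.card_image₂_le _ _ _ |>.trans (Nat.mul_le_mul_right _ ih)

/-- Rescaling the residual `θ - p l` to the unit ball and choosing the nearest net direction halves
the residual at each level. -/
theorem IsHalfNet.exists_path {U : Finset E} (hU : IsHalfNet U) {r : ℝ} (hr : 0 < r) {θ₀ θ : E}
    (hθ : ‖θ - θ₀‖ ≤ r) : ∃ p u : ℕ → E, p 0 = θ₀ ∧ ∀ l, p l ∈ treeLevel U r θ₀ l ∧ u l ∈ U ∧
      p (l + 1) = p l + (r / 2 ^ l) • u l ∧ ‖θ - p l‖ ≤ r / 2 ^ l := by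
  classical
  choose! s hsU hs using hU.exists_near
  let q : ℕ → E → E := fun l p => s ((2 ^ l / r) • (θ - p))
  let p : ℕ → E := fun l => Nat.rec θ₀ (fun l p => p + (r / 2 ^ l) • q l p) l
  have hp : ∀ l, p (l + 1) = p l + (r / 2 ^ l) • q l (p l) := fun l => rfl
  have hscale : ∀ l, ‖θ - p l‖ ≤ r / 2 ^ l → ‖(2 ^ l / r : ℝ) • (θ - p l)‖ ≤ 1 := by
    intro l hl
    rw [norm_smul, Real.norm_of_nonneg (by positivity)]
    calc 2 ^ l / r * ‖θ - p l‖ ≤ 2 ^ l / r * (r / 2 ^ l) := by gcongr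
      _ = 1 := by field_simp
  have hnear : ∀ l, ‖θ - p l‖ ≤ r / 2 ^ l := by
    intro l
    induction l with
    | zero => simpa [p] using hθ
    | succ l ih =>
      have h1 := hs _ (hscale l ih)
      have h2 : θ - p (l + 1) = (r / 2 ^ l) • ((2 ^ l / r : ℝ) • (θ - p l) - q l (p l)) := by
        rw [hp, smul_sub, smul_smul,
          show r / 2 ^ l * (2 ^ l / r) = 1 by field_simp, one_smul]
        abel
      rw [h2, norm_smul, Real.norm_of_nonneg (by positivity), pow_succ]
      calc r / 2 ^ l * _ ≤ r / 2 ^ l * (1 / 2) := by gcongr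
        _ = _ := by field_simp
  refine ⟨p, fun l => q l (p l), rfl, fun l => ⟨?_, hsU _ (hscale l (hnear l)), hp l, hnear l⟩⟩
  induction l with
  | zero => simp [p, treeLevel]
  | succ l ih =>
    rw [hp, treeLevel]
    exact Finset.mem_image₂_of_mem ih (hsU _ (hscale l (hnear l)))

end Net

/-! ### Concentration of increments of the empirical deviation -/

section EmpiricalDeviation

variable {Ω 𝒳 ι E : Type*} [MeasurableSpace Ω] [MeasurableSpace 𝒳] [Fintype ι]
  [NormedAddCommGroup E] [InnerProductSpace ℝ E] [FiniteDimensional ℝ E] [MeasurableSpace E]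
  [BorelSpace E]

/-- A random vector field that is Lipschitz in its argument and whose value at each point has
sub-Gaussian deviations from its mean. -/
structure IsSubGaussianField (F : Measure 𝒳) (h : 𝒳 → E → E) (L C : ℝ) : Prop where
  measurable : ∀ θ, Measurable fun x => h x θ
  integrable : ∀ θ, Integrable (fun x => h x θ) F
  lipschitz : ∀ x θ θ', ‖h x θ - h x θ'‖ ≤ L * ‖θ - θ'‖
  tail : ∀ θ v, ‖v‖ = 1 → ∀ t : ℝ, 0 ≤ t →
    F.real {x | t ≤ inner ℝ v (h x θ - ∫ y, h y θ ∂F)} ≤ Real.exp (-t ^ 2 / C ^ 2)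

/-- A finite family of independent observations with law `F`. -/
structure IsSample (P : Measure Ω) (F : Measure 𝒳) (Y : ι → Ω → 𝒳) : Prop where
  measurable : ∀ p, Measurable (Y p)
  law : ∀ p, P.map (Y p) = F
  indep : iIndepFun Y P

/-- The weighted sum of the centred field over the observations. -/
def empDev (F : Measure 𝒳) (h : 𝒳 → E → E) (a : ι → ℝ) (Y : ι → Ω → 𝒳) (θ : E) (ω : Ω) : E :=
  ∑ p, a p • (h (Y p ω) θ - ∫ x, h x θ ∂F)

variable {P : Measure Ω} [IsProbabilityMeasure P] {F : Measure 𝒳} [IsProbabilityMeasure F]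
  {h : 𝒳 → E → E} {L C : ℝ} {a : ι → ℝ} {Y : ι → Ω → 𝒳}

theorem IsSubGaussianField.norm_mean_sub_le (hh : IsSubGaussianField F h L C) (θ θ' : E) :
    ‖∫ x, h x θ ∂F - ∫ x, h x θ' ∂F‖ ≤ L * ‖θ - θ'‖ := by
  rw [← integral_sub (hh.integrable θ) (hh.integrable θ')]
  simpa using norm_integral_le_of_norm_le_const (μ := F)
    (Filter.Eventually.of_forall fun x => hh.lipschitz x θ θ')

theorem IsSubGaussianField.norm_empDev_sub_le (hh : IsSubGaussianField F h L C)
    (ha : ∀ p, 0 ≤ a p) (ha1 : ∑ p, a p = 1) (θ θ' : E) (ω : Ω) :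
    ‖empDev F h a Y θ ω - empDev F h a Y θ' ω‖ ≤ 2 * L * ‖θ - θ'‖ := by
  unfold empDev
  rw [← Finset.sum_sub_distrib]
  calc _ ≤ ∑ p, a p * (2 * L * ‖θ - θ'‖) := by
        refine norm_sum_le_of_le _ fun p _ => ?_
        rw [← smul_sub, norm_smul, Real.norm_of_nonneg (ha p)]
        refine mul_le_mul_of_nonneg_left ?_ (ha p)
        rw [sub_sub_sub_comm]
        refine (norm_sub_le _ _).trans ?_
        linarith [hh.lipschitz (Y p ω) θ θ', hh.norm_mean_sub_le θ θ']
    _ = _ := by rw [← Finset.sum_mul, ha1, one_mul]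

/-- Hoeffding's inequality for the increments of the weighted deviation. -/
theorem IsSubGaussianField.measure_le_inner_empDev_sub_le (hh : IsSubGaussianField F h L C)
    (hY : IsSample P F Y) (hL : 0 ≤ L) {v θ θ' : E} (hv : ‖v‖ ≤ 1) {δ t : ℝ}
    (hδ : ‖θ - θ'‖ ≤ δ) (ht : 0 ≤ t) :
    P.real {ω | t ≤ inner ℝ v (empDev F h a Y θ ω - empDev F h a Y θ' ω)} ≤
      Real.exp (-t ^ 2 / (2 * ((∑ p, a p ^ 2) * (L * δ) ^ 2))) := by
  have hδ0 : 0 ≤ δ := (norm_nonneg _).trans hδ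
  let f : 𝒳 → ℝ := fun x => inner ℝ v (h x θ - h x θ')
  have hf : Measurable f := ((hh.measurable θ).sub (hh.measurable θ')).const_inner
  -- The field may be unbounded, but its increments are bounded by the Lipschitz condition, so
  -- Hoeffding's lemma applies with a variance proxy proportional to `δ²`.
  have hfb : ∀ x, f x ∈ Set.Icc (-(L * δ)) (L * δ) := by
    intro x
    rw [Set.mem_Icc, ← abs_le]
    calc |f x| ≤ ‖v‖ * ‖h x θ - h x θ'‖ := abs_real_inner_le_norm _ _
      _ ≤ 1 * (L * δ) := by
        gcongr
        exact (hh.lipschitz x θ θ').trans (by gcongr)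
      _ = _ := one_mul _
  have hmean : ∀ p, ∫ ω, f (Y p ω) ∂P = inner ℝ v (∫ x, h x θ ∂F - ∫ x, h x θ' ∂F) := by
    intro p
    rw [← integral_map (hY.measurable p).aemeasurable hf.aestronglyMeasurable, hY.law p,
      ← integral_sub (hh.integrable θ) (hh.integrable θ')]
    exact integral_inner ((hh.integrable θ).sub (hh.integrable θ')) v
  have hsub : ∀ p ∈ Finset.univ, HasSubgaussianMGF
      (fun ω => a p * (f (Y p ω) - ∫ ω, f (Y p ω) ∂P))
      (⟨a p ^ 2, sq_nonneg _⟩ * (‖L * δ - -(L * δ)‖₊ / 2) ^ 2) P := fun p _ =>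
    (hasSubgaussianMGF_of_mem_Icc (hf.comp (hY.measurable p)).aemeasurable
      (Filter.Eventually.of_forall fun ω => hfb (Y p ω))).const_mul (a p)
  have hindep : iIndepFun (fun p ω => a p * (f (Y p ω) - ∫ ω, f (Y p ω) ∂P)) P :=
    hY.indep.comp (fun p x => a p * (f x - ∫ ω, f (Y p ω) ∂P))
      fun p => (hf.sub_const _).const_mul _
  have key := HasSubgaussianMGF.measure_sum_ge_le_of_iIndepFun hindep hsub ht
  have hset : ∀ ω, ∑ p, a p * (f (Y p ω) - ∫ ω, f (Y p ω) ∂P) =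
      inner ℝ v (empDev F h a Y θ ω - empDev F h a Y θ' ω) := by
    intro ω
    unfold empDev
    rw [← Finset.sum_sub_distrib, inner_sum]
    refine Finset.sum_congr rfl fun p _ => ?_
    rw [hmean, ← smul_sub, real_inner_smul_right, sub_sub_sub_comm, inner_sub_right v (_ - _)]
  simp only [hset] at key
  convert key using 4
  push_cast
  rw [Finset.sum_mul]
  refine Finset.sum_congr rfl fun p _ => ?_
  change _ = a p ^ 2 * (‖L * δ - -(L * δ)‖ / 2) ^ 2
  rw [sub_neg_eq_add, Real.norm_of_nonneg (by positivity)]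
  ring

end EmpiricalDeviation

/-! ### Chaining on one ball -/

section Chaining

variable {Ω 𝒳 ι E : Type*} [MeasurableSpace Ω] [MeasurableSpace 𝒳] [Fintype ι]
  [NormedAddCommGroup E] [InnerProductSpace ℝ E] [FiniteDimensional ℝ E] [MeasurableSpace E]
  [BorelSpace E]
  {P : Measure Ω} [IsProbabilityMeasure P] {F : Measure 𝒳} [IsProbabilityMeasure F]
  {h : 𝒳 → E → E} {L C : ℝ} {a : ι → ℝ} {Y : ι → Ω → 𝒳}

/-- The event that the increment of the weighted deviation from the centre exceeds `s` somewhere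
on the ball of radius `r`. -/
def devEvent (F : Measure 𝒳) (h : 𝒳 → E → E) (a : ι → ℝ) (Y : ι → Ω → 𝒳) (θ₀ : E) (r s : ℝ) :
    Set Ω :=
  {ω | ∃ θ, ‖θ - θ₀‖ ≤ r ∧ s < ‖empDev F h a Y θ ω - empDev F h a Y θ₀ ω‖}

theorem pow_five_le_exp {k : ℕ} {D : ℝ} (hk : (k : ℝ) ≤ D) (j : ℕ) :
    ((5 : ℝ) ^ k) ^ j ≤ Real.exp (2 * D * j) := by
  have h5 : (5 : ℝ) ≤ Real.exp 2 := by
    have h1 := Real.exp_one_gt_d9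
    rw [show (2 : ℝ) = 1 + 1 by norm_num, Real.exp_add]
    nlinarith
  calc ((5 : ℝ) ^ k) ^ j ≤ (Real.exp 2 ^ k) ^ j := by gcongr
    _ = Real.exp (2 * k * j) := by
      rw [← Real.exp_nat_mul, ← Real.exp_nat_mul]; ring_nf
    _ ≤ _ := by gcongr

theorem measure_biUnion_finset_le_card_mul {α : Type*} (s : Finset α) (B : α → Set Ω) {b c : ℝ}
    (hb : 0 ≤ b) (hB : ∀ i ∈ s, P.real (B i) ≤ b) (hc : (s.card : ℝ) ≤ c) :
    P (⋃ i ∈ s, B i) ≤ ENNReal.ofReal (c * b) := by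
  refine (measure_biUnion_finset_le s B).trans ?_
  calc ∑ i ∈ s, P (B i) ≤ ∑ i ∈ s, ENNReal.ofReal b :=
        Finset.sum_le_sum fun i hi =>
          (ENNReal.le_ofReal_iff_toReal_le (measure_ne_top _ _) hb).2 (hB i hi)
    _ = ENNReal.ofReal (s.card * b) := by
        rw [Finset.sum_const, nsmul_eq_mul, ENNReal.ofReal_mul (by positivity),
          ENNReal.ofReal_natCast]
    _ ≤ _ := ENNReal.ofReal_le_ofReal (by gcongr)

theorem measure_iUnion_le_exp {B : ℕ → Set Ω} {D : ℝ} (hD : 1 ≤ D)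
    (hB : ∀ l, P (B l) ≤ ENNReal.ofReal (Real.exp (-(20 * D * (l + 1))))) :
    P (⋃ l, B l) ≤ ENNReal.ofReal (Real.exp (-(18 * D))) := by
  have hgeom : ∀ l : ℕ, Real.exp (-(20 * D * (l + 1))) ≤
      Real.exp (-(18 * D)) * ((1 : ℝ) / 2 / 2 ^ l) := by
    intro l
    have h1 : Real.exp (-1) ≤ 1 / 2 := by
      rw [Real.exp_neg, one_div]
      exact inv_anti₀ (by norm_num) (by linarith [Real.exp_one_gt_d9])
    calc Real.exp (-(20 * D * (l + 1))) ≤ Real.exp (-(18 * D) + ((l + 1 : ℕ) : ℝ) * (-1)) := by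
          rw [Real.exp_le_exp]
          push_cast
          nlinarith [(Nat.cast_nonneg l : (0 : ℝ) ≤ l), mul_nonneg (by linarith : (0:ℝ) ≤ D - 1)
            (Nat.cast_nonneg l : (0 : ℝ) ≤ l)]
      _ = Real.exp (-(18 * D)) * Real.exp (-1) ^ (l + 1) := by
          rw [Real.exp_add, Real.exp_nat_mul]
      _ ≤ Real.exp (-(18 * D)) * (1 / 2) ^ (l + 1) := by gcongr
      _ = _ := by rw [pow_succ, one_div_pow]; ring
  calc P (⋃ l, B l) ≤ ∑' l, P (B l) := measure_iUnion_le _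
    _ ≤ ∑' l : ℕ, ENNReal.ofReal (Real.exp (-(18 * D)) * ((1 : ℝ) / 2 / 2 ^ l)) :=
        ENNReal.tsum_le_tsum fun l => (hB l).trans (ENNReal.ofReal_le_ofReal (hgeom l))
    _ = ENNReal.ofReal (∑' l : ℕ, Real.exp (-(18 * D)) * ((1 : ℝ) / 2 / 2 ^ l)) :=
        (ENNReal.ofReal_tsum_of_nonneg (fun l => by positivity)
          ((summable_geometric_two' 1).mul_left _)).symm
    _ = _ := by rw [tsum_mul_left, tsum_geometric_two', mul_one]

/-- Chaining over the dyadic tree: the increments of the weighted deviation on a ball of radius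
`r` are of order `r √(D V)`. -/
theorem IsSubGaussianField.measure_devEvent_le (hh : IsSubGaussianField F h L C)
    (hY : IsSample P F Y) (hL : 0 < L) (ha : ∀ p, 0 ≤ a p) (ha1 : ∑ p, a p = 1)
    {D : ℝ} (hD : 1 ≤ D) (hd : (Module.finrank ℝ E : ℝ) ≤ D) (θ₀ : E) {r : ℝ} (hr : 0 < r)
    (hV : 0 < ∑ p, a p ^ 2) :
    P (devEvent F h a Y θ₀ r (56 * L * r * √(D * ∑ p, a p ^ 2))) ≤
      ENNReal.ofReal (Real.exp (-(18 * D))) := by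
  classical
  obtain ⟨U, hU, hUcard⟩ := exists_isHalfNet (E := E)
  set V := ∑ p, a p ^ 2
  -- The threshold `s (3/4)^l` is summable in `l` yet decays more slowly than the step length
  -- `r/2^l`. Hoeffding's exponent becomes `(49/2) D (9/4)^l ≥ 24 D (l + 1)`, which beats the
  -- entropy `4 D (l + 1)`. The net loses a factor `2` and `∑ (3/4)^l = 4`, so the total is `8s = 56
  -- L r √(D V)`.
  set s : ℝ := 7 * L * r * √(D * V) with hs
  have hDV : 0 < D * V := by positivity
  have hs0 : 0 < s := by positivity
  let B : ℕ → Set Ω := fun l => ⋃ i ∈ treeLevel U r θ₀ l ×ˢ (U ×ˢ U),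
    {ω | s * (3 / 4) ^ l ≤ inner ℝ i.2.2
      (empDev F h a Y (i.1 + (r / 2 ^ l) • i.2.1) ω - empDev F h a Y i.1 ω)}
  have hB : ∀ l, P (B l) ≤ ENNReal.ofReal (Real.exp (-(20 * D * (l + 1)))) := by
    intro l
    have hcard : ((treeLevel U r θ₀ l ×ˢ (U ×ˢ U)).card : ℝ) ≤ Real.exp (4 * D * (l + 1)) := by
      -- Of the `l + 2` factors, `l` choose the node, one the next step and one the test direction.
      have h1 : (treeLevel U r θ₀ l ×ˢ (U ×ˢ U)).card ≤ (5 ^ Module.finrank ℝ E) ^ (l + 2) := by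
        rw [Finset.card_product, Finset.card_product, pow_add, pow_two]
        exact Nat.mul_le_mul ((card_treeLevel_le U r θ₀ l).trans (Nat.pow_le_pow_left hUcard l))
          (Nat.mul_le_mul hUcard hUcard)
      calc ((treeLevel U r θ₀ l ×ˢ (U ×ˢ U)).card : ℝ)
          ≤ (((5 ^ Module.finrank ℝ E) ^ (l + 2) : ℕ) : ℝ) := by exact_mod_cast h1
        _ = ((5 : ℝ) ^ Module.finrank ℝ E) ^ (l + 2) := by push_cast; rfl
        _ ≤ Real.exp (2 * D * (l + 2 : ℕ)) := pow_five_le_exp hd _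
        _ ≤ _ := by
          rw [Real.exp_le_exp]; push_cast
          nlinarith [mul_nonneg (by linarith : (0:ℝ) ≤ D) (Nat.cast_nonneg l : (0 : ℝ) ≤ l)]
    refine (measure_biUnion_finset_le_card_mul (b := Real.exp (-(24 * D * (l + 1)))) _ _
      (Real.exp_pos _).le ?_ hcard).trans ?_
    · rintro ⟨p, u, v⟩ hi
      simp only [Finset.mem_product] at hi
      refine (hh.measure_le_inner_empDev_sub_le hY hL.le (hU.norm_le v hi.2.2)
        (δ := r / 2 ^ l) ?_ (by positivity)).trans ?_
      · rw [add_sub_cancel_left, norm_smul, Real.norm_of_nonneg (by positivity)]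
        exact mul_le_of_le_one_right (by positivity) (hU.norm_le u hi.2.1)
      · rw [Real.exp_le_exp]
        have hbern : 1 + (l : ℝ) ≤ (9 / 4 : ℝ) ^ l := by
          have := one_add_mul_le_pow (a := (5 / 4 : ℝ)) (by norm_num) l
          norm_num at this
          linarith [(Nat.cast_nonneg l : (0 : ℝ) ≤ l)]
        have hexp : -(s * (3 / 4) ^ l) ^ 2 / (2 * (V * (L * (r / 2 ^ l)) ^ 2)) =
            -(49 / 2 * D * (9 / 4 : ℝ) ^ l) := by
          rw [hs, mul_pow, mul_pow, Real.sq_sqrt hDV.le, mul_pow L, div_pow r, ← pow_mul, ← pow_mul,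
            mul_comm l 2, pow_mul, pow_mul, show (9 / 4 : ℝ) = (3 / 4) ^ 2 * 2 ^ 2 by norm_num,
            mul_pow]
          field_simp
          norm_num
          rw [mul_assoc, ← mul_pow]
          norm_num
        rw [hexp]
        nlinarith [mul_le_mul_of_nonneg_left hbern (by linarith : (0:ℝ) ≤ D)]
    · rw [← Real.exp_add]
      refine ENNReal.ofReal_le_ofReal (Real.exp_le_exp.2 ?_)
      linarith
  refine (measure_mono ?_).trans (measure_iUnion_le_exp hD hB)
  intro ω hω
  by_contra hnot
  simp only [B, Set.mem_iUnion, not_exists, Finset.mem_product, Set.mem_ofPred_eq, not_le,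
    Prod.forall, and_imp] at hnot
  obtain ⟨θ, hθ, hlt⟩ := hω
  obtain ⟨p, u, hp0, hpath⟩ := hU.exists_path hr hθ
  have hstep : ∀ l, ‖empDev F h a Y (p (l + 1)) ω - empDev F h a Y (p l) ω‖ ≤
      2 * (s * (3 / 4) ^ l) := by
    intro l
    obtain ⟨hpl, hul, hpl1, -⟩ := hpath l
    rw [hpl1]
    exact hU.norm_le_of_inner_le fun v hv => (hnot l _ _ _ hpl hul hv).le
  have hsum : ∀ l, ‖empDev F h a Y (p l) ω - empDev F h a Y θ₀ ω‖ ≤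
      8 * s * (1 - (3 / 4) ^ l) := by
    intro l
    induction l with
    | zero => simp [hp0]
    | succ l ih =>
      have := norm_sub_le_norm_sub_add_norm_sub (empDev F h a Y (p (l + 1)) ω)
        (empDev F h a Y (p l) ω) (empDev F h a Y θ₀ ω)
      have h2 := hstep l
      rw [pow_succ]
      linarith
  -- The part of the path below level `l` is controlled deterministically by the Lipschitz constant
  -- and vanishes as `l → ∞`.
  have hbound : ∀ l : ℕ, ‖empDev F h a Y θ ω - empDev F h a Y θ₀ ω‖ ≤
      2 * L * r * (1 / 2) ^ l + 8 * s := by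
    intro l
    have h1 := norm_sub_le_norm_sub_add_norm_sub (empDev F h a Y θ ω)
      (empDev F h a Y (p l) ω) (empDev F h a Y θ₀ ω)
    have h2 := hh.norm_empDev_sub_le (Y := Y) ha ha1 θ (p l) ω
    have h3 : 2 * L * ‖θ - p l‖ ≤ 2 * L * (r / 2 ^ l) := by
      gcongr; exact (hpath l).2.2.2
    have h4 : 2 * L * (r / 2 ^ l) = 2 * L * r * (1 / 2) ^ l := by
      rw [one_div_pow]; ring
    have h5 : 0 ≤ s * (3 / 4 : ℝ) ^ l := by positivity
    linarith [hsum l]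
  have hlim : Filter.Tendsto (fun l : ℕ => 2 * L * r * (1 / 2 : ℝ) ^ l + 8 * s) Filter.atTop
      (nhds (2 * L * r * 0 + 8 * s)) :=
    ((tendsto_pow_atTop_nhds_zero_of_lt_one (by norm_num) (by norm_num)).const_mul _).add_const _
  have := ge_of_tendsto' hlim hbound
  rw [hs] at this
  linarith

end Chaining

/-! ### From single balls to all of space -/

section Envelope

variable {Ω 𝒳 ι E : Type*} [MeasurableSpace Ω] [MeasurableSpace 𝒳] [Fintype ι]
  [NormedAddCommGroup E] [InnerProductSpace ℝ E] [FiniteDimensional ℝ E] [MeasurableSpace E]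
  [BorelSpace E]
  {P : Measure Ω} [IsProbabilityMeasure P] {F : Measure 𝒳} [IsProbabilityMeasure F]
  {h : 𝒳 → E → E} {L C : ℝ} {a : ι → ℝ} {Y : ι → Ω → 𝒳}

/-- Net points lie in the ball rather than on the sphere; shrinking `v` only makes a positive
threshold harder to reach. At `v = 0` strict positivity of `t` is needed. -/
theorem IsSubGaussianField.tail_of_norm_le_one (hh : IsSubGaussianField F h L C) (θ : E) {v : E}
    (hv : ‖v‖ ≤ 1) {t : ℝ} (ht : 0 < t) :
    F.real {x | t ≤ inner ℝ v (h x θ - ∫ y, h y θ ∂F)} ≤ Real.exp (-t ^ 2 / C ^ 2) := by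
  rcases eq_or_ne v 0 with rfl | hv0
  · simp only [inner_zero_left, not_le.2 ht, Set.ofPred_false, measureReal_empty]
    positivity
  have hpos : 0 < ‖v‖ := norm_pos_iff.2 hv0
  refine (measureReal_mono ?_).trans
    (hh.tail θ (‖v‖⁻¹ • v) (by rw [norm_smul, norm_inv, norm_norm, inv_mul_cancel₀ hpos.ne']) t
      ht.le)
  intro x hx
  simp only [Set.mem_ofPred_eq, real_inner_smul_left] at hx ⊢
  refine hx.trans (le_mul_of_one_le_left (ht.le.trans hx) ?_)
  exact (one_le_inv₀ hpos).2 hv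

theorem IsSubGaussianField.tail_observation (hh : IsSubGaussianField F h L C)
    (hY : IsSample P F Y) (q : ι) (θ : E) {v : E} (hv : ‖v‖ ≤ 1) {t : ℝ} (ht : 0 < t) :
    P.real {ω | t ≤ inner ℝ v (h (Y q ω) θ - ∫ y, h y θ ∂F)} ≤ Real.exp (-t ^ 2 / C ^ 2) := by
  refine le_of_eq_of_le ?_ (hh.tail_of_norm_le_one θ hv ht)
  have hm : MeasurableSet {x | t ≤ inner ℝ v (h x θ - ∫ y, h y θ ∂F)} :=
    measurableSet_le measurable_const ((hh.measurable θ).sub_const _).const_inner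
  rw [← hY.law q, map_measureReal_apply (hY.measurable q) (by rwa [hY.law q])]
  rfl

theorem two_mul_le_exp {x : ℝ} (hx : 0 ≤ x) : 2 * x ≤ Real.exp x := by
  have h1 := Real.add_one_le_exp (x - 1)
  have h2 : Real.exp x = Real.exp 1 * Real.exp (x - 1) := by rw [← Real.exp_add]; ring_nf
  rw [h2]
  have h3 := Real.exp_one_gt_d9
  nlinarith

/-- On large balls a union bound over a fine net and over single observations suffices. -/
theorem IsSubGaussianField.measure_devEvent_le_of_radius (hh : IsSubGaussianField F h L C)
    (hY : IsSample P F Y) (hL : 0 < L) (ha : ∀ p, 0 ≤ a p) (ha1 : ∑ p, a p = 1)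
    {N : ℕ} (hN : Fintype.card ι = N) (hN1 : 1 ≤ N) (hd : Module.finrank ℝ E ≤ N)
    (θ₀ : E) {r s : ℝ} (hr : 0 < r) (hs : 6 * (L * r / √(N : ℝ)) ≤ s) :
    P (devEvent F h a Y θ₀ r s) ≤
      ENNReal.ofReal (Real.exp (5 * (N : ℝ) ^ 2 - L ^ 2 / C ^ 2 * r ^ 2 / N)) := by
  classical
  obtain ⟨U, hU, hUcard⟩ := exists_isHalfNet (E := E)
  have hNpos : (0 : ℝ) < N := by exact_mod_cast hN1
  have hN1' : (1 : ℝ) ≤ N := by exact_mod_cast hN1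
  have hsq : 0 < √(N : ℝ) := Real.sqrt_pos.2 hNpos
  set b := L * r / √(N : ℝ) with hb
  have hb0 : 0 < b := by positivity
  -- Depth `N` suffices since `2^N ≥ √N` makes the mesh at most `r/√N`. The centre is added because
  -- level `N` of the tree need not contain it.
  let T := insert θ₀ (treeLevel U r θ₀ N)
  let B : E × E × ι → Set Ω := fun i =>
    {ω | b ≤ inner ℝ i.2.1 (h (Y i.2.2 ω) i.1 - ∫ y, h y i.1 ∂F)}
  -- The events are indexed by node, test direction and single observation; with `m = finrank E ≤
  -- N`, their number is at most `2N · 5^{m(N+1)} ≤ e^{N + 2N(N+1)} ≤ e^{5N²}`.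
  have hcard : ((T ×ˢ (U ×ˢ (Finset.univ : Finset ι))).card : ℝ) ≤ Real.exp (5 * (N : ℝ) ^ 2) := by
    set m := Module.finrank ℝ E
    have hT : T.card ≤ 2 * (5 ^ m) ^ N := by
      refine (Finset.card_insert_le _ _).trans ?_
      have h1 := (card_treeLevel_le U r θ₀ N).trans (Nat.pow_le_pow_left hUcard N)
      have h2 : 1 ≤ (5 ^ m) ^ N := Nat.one_le_pow _ _ (by positivity)
      omega
    have h1 : (T ×ˢ (U ×ˢ (Finset.univ : Finset ι))).card ≤ (2 * N) * (5 ^ m) ^ (N + 1) := by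
      rw [Finset.card_product, Finset.card_product, Finset.card_univ, hN]
      calc _ ≤ (2 * (5 ^ m) ^ N) * (5 ^ m * N) :=
            Nat.mul_le_mul hT (Nat.mul_le_mul_right _ hUcard)
        _ = _ := by ring
    calc ((T ×ˢ (U ×ˢ (Finset.univ : Finset ι))).card : ℝ)
        ≤ ((2 * N * (5 ^ m) ^ (N + 1) : ℕ) : ℝ) := by exact_mod_cast h1
      _ = 2 * N * ((5 : ℝ) ^ m) ^ (N + 1) := by push_cast; rfl
      _ ≤ Real.exp N * Real.exp (2 * N * (N + 1 : ℕ)) := by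
          gcongr
          · exact two_mul_le_exp hNpos.le
          · exact pow_five_le_exp (by exact_mod_cast hd) _
      _ ≤ _ := by
          rw [← Real.exp_add, Real.exp_le_exp]; push_cast; nlinarith
  have hmeas : P (⋃ i ∈ T ×ˢ (U ×ˢ (Finset.univ : Finset ι)), B i) ≤
      ENNReal.ofReal (Real.exp (5 * (N : ℝ) ^ 2 - L ^ 2 / C ^ 2 * r ^ 2 / N)) := by
    refine (measure_biUnion_finset_le_card_mul (b := Real.exp (-b ^ 2 / C ^ 2)) _ _
      (Real.exp_pos _).le ?_ hcard).trans (le_of_eq ?_)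
    · rintro ⟨p, v, q⟩ hi
      simp only [Finset.mem_product] at hi
      exact hh.tail_observation hY q p (hU.norm_le v hi.2.1) hb0
    · rw [← Real.exp_add, hb, div_pow, mul_pow, Real.sq_sqrt hNpos.le]
      congr 2
      ring
  refine (measure_mono ?_).trans hmeas
  intro ω hω
  by_contra hnot
  simp only [B, Set.mem_iUnion, not_exists, Finset.mem_product, Set.mem_ofPred_eq, not_le,
    Prod.forall, and_imp, Finset.mem_univ, true_implies] at hnot
  have hdev : ∀ p ∈ T, ‖empDev F h a Y p ω‖ ≤ 2 * b := by
    intro p hp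
    refine hU.norm_le_of_inner_le fun v hv => ?_
    unfold empDev
    rw [inner_sum]
    calc _ ≤ ∑ q, a q * b := Finset.sum_le_sum fun q _ => by
          rw [real_inner_smul_right]
          exact mul_le_mul_of_nonneg_left (hnot p v q hp hv).le (ha q)
      _ = b := by rw [← Finset.sum_mul, ha1, one_mul]
  obtain ⟨θ, hθ, hlt⟩ := hω
  obtain ⟨p, u, hp0, hpath⟩ := hU.exists_path hr hθ
  have h1 := norm_sub_le_norm_sub_add_norm_sub (empDev F h a Y θ ω)
    (empDev F h a Y (p N) ω) (empDev F h a Y θ₀ ω)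
  have h2 := hh.norm_empDev_sub_le (Y := Y) ha ha1 θ (p N) ω
  have h3 := norm_sub_le (empDev F h a Y (p N) ω) (empDev F h a Y θ₀ ω)
  have h4 := hdev (p N) (Finset.mem_insert_of_mem (hpath N).1)
  have h5 := hdev θ₀ (Finset.mem_insert_self _ _)
  have h6 : L * ‖θ - p N‖ ≤ b := by
    have h7 : √(N : ℝ) ≤ 2 ^ N := by
      have : (N : ℝ) ≤ 2 ^ N := by exact_mod_cast Nat.lt_two_pow_self.le
      refine le_trans ?_ this
      rw [Real.sqrt_le_left hNpos.le]
      nlinarith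
    calc L * ‖θ - p N‖ ≤ L * (r / 2 ^ N) := by gcongr; exact (hpath N).2.2.2
      _ ≤ L * (r / √(N : ℝ)) := by gcongr
      _ = b := by rw [hb]; ring
  -- The `6b` is made up of three terms of size `2b`: the deviations at `p N` and at `θ₀`, and the
  -- Lipschitz remainder.
  linarith

theorem one_le_card_mul_sum_sq (ha1 : ∑ p, a p = 1) :
    1 ≤ (Fintype.card ι : ℝ) * ∑ p, a p ^ 2 := by
  have := sq_sum_le_card_mul_sum_sq (s := Finset.univ) (f := a)
  rwa [ha1, one_pow, Finset.card_univ] at this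

/-- The rate `8^{-j}` is chosen so that the squared radii `4^j` remain summable against it. Chaining
covers `8^j ≤ N^18`; the crude union bound covers the larger radii, where `2^j > N^6`. -/
theorem IsSubGaussianField.measure_devEvent_le_dyadic (hh : IsSubGaussianField F h L C)
    (hY : IsSample P F Y) (hL : 0 < L) (ha : ∀ p, 0 ≤ a p) (ha1 : ∑ p, a p = 1)
    {N : ℕ} (hN : Fintype.card ι = N) (hN1 : 1 ≤ N) (hdN : Module.finrank ℝ E ≤ N)
    {D : ℝ} (hD : 1 ≤ D) (hd : (Module.finrank ℝ E : ℝ) ≤ D) (hlog : Real.log N ≤ D)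
    {b : ℝ} (hb : 0 < b) (hNb : 9 ≤ L ^ 2 / C ^ 2 * b ^ 2 * N) (θ₀ : E) (j : ℕ) :
    P (devEvent F h a Y θ₀ (b / N * 2 ^ j) (56 * L * (b / N * 2 ^ j) * √(D * ∑ p, a p ^ 2))) ≤
      ENNReal.ofReal (((8 : ℝ) ^ j)⁻¹) := by
  have hNpos : (0 : ℝ) < N := by exact_mod_cast hN1
  have hN1' : (1 : ℝ) ≤ N := by exact_mod_cast hN1
  have hV1 : 1 ≤ (N : ℝ) * ∑ p, a p ^ 2 := hN ▸ one_le_card_mul_sum_sq ha1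
  have hV : 0 < ∑ p, a p ^ 2 := by
    by_contra! hneg
    nlinarith
  set V := ∑ p, a p ^ 2
  have hr : 0 < b / N * 2 ^ j := by positivity
  rcases le_or_gt ((8 : ℝ) ^ j) ((N : ℝ) ^ 18) with hj | hj
  · refine (hh.measure_devEvent_le hY hL ha ha1 hD hd θ₀ hr hV).trans
      (ENNReal.ofReal_le_ofReal ?_)
    calc Real.exp (-(18 * D)) ≤ Real.exp (-(18 * Real.log N)) := by gcongr
      _ = ((N : ℝ) ^ 18)⁻¹ := by
        rw [Real.exp_neg, show 18 * Real.log N = ((18 : ℕ) : ℝ) * Real.log N by norm_num,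
          Real.exp_nat_mul, Real.exp_log hNpos]
      _ ≤ _ := by gcongr
  · have hy : (N : ℝ) ^ 6 < 2 ^ j := by
      refine lt_of_pow_lt_pow_left₀ 3 (by positivity) ?_
      calc ((N : ℝ) ^ 6) ^ 3 = (N : ℝ) ^ 18 := by ring
        _ < 8 ^ j := hj
        _ = (2 ^ j) ^ 3 := by rw [← pow_mul, mul_comm, pow_mul]; norm_num
    have h8 : (8 : ℝ) ^ j = (2 ^ j) ^ 3 := by rw [← pow_mul, mul_comm, pow_mul]; norm_num
    rw [h8]
    have hsqrt : 1 / √(N : ℝ) ≤ √(D * V) := by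
      rw [← Real.sqrt_one, ← Real.sqrt_div zero_le_one]
      refine Real.sqrt_le_sqrt ?_
      rw [div_le_iff₀ hNpos]
      nlinarith
    refine (hh.measure_devEvent_le_of_radius hY hL ha ha1 hN hN1 hdN θ₀ hr ?_).trans
      (ENNReal.ofReal_le_ofReal ?_)
    · calc 6 * (L * (b / N * 2 ^ j) / √(N : ℝ)) = 6 * L * (b / N * 2 ^ j) * (1 / √(N : ℝ)) := by
            ring
        _ ≤ 56 * L * (b / N * 2 ^ j) * √(D * V) := by gcongr; norm_num
    · set y : ℝ := 2 ^ j
      have hy0 : 0 < y := by positivity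
      have hNN : (1 : ℝ) ≤ (N : ℝ) ^ 2 := one_le_pow₀ hN1'
      have hy1 : 1 ≤ y := (one_le_pow₀ hN1').trans hy.le
      -- Since `y > N^6`, the tail exponent is at least `9 y N²`, which dominates the entropy `5
      -- N²`. Then `e^{-3y} ≤ y^{-3} = 8^{-j}`.
      have hexp : 5 * (N : ℝ) ^ 2 - L ^ 2 / C ^ 2 * (b / N * y) ^ 2 / N ≤ -(3 * y) := by
        have h1 : L ^ 2 / C ^ 2 * (b / N * y) ^ 2 / N =
            (L ^ 2 / C ^ 2 * b ^ 2 * N) * (y * (y / N ^ 4)) := by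
          field_simp
        have h2 : (N : ℝ) ^ 2 ≤ y / N ^ 4 := by
          rw [le_div_iff₀ (by positivity), ← pow_add]; exact hy.le
        have h3 : 9 * (y * N ^ 2) ≤ (L ^ 2 / C ^ 2 * b ^ 2 * N) * (y * (y / N ^ 4)) := by
          gcongr
        rw [h1]
        nlinarith
      calc Real.exp (5 * (N : ℝ) ^ 2 - L ^ 2 / C ^ 2 * (b / N * y) ^ 2 / N)
          ≤ Real.exp (-(3 * y)) := Real.exp_le_exp.2 hexp
        _ = (Real.exp y ^ 3)⁻¹ := by
            rw [Real.exp_neg, ← Real.exp_nat_mul]; norm_num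
        _ ≤ (y ^ 3)⁻¹ := by
            gcongr
            linarith [Real.add_one_le_exp y]

/-- Outside a random ball of small expected squared radius the weighted deviation is Lipschitz
relative to the centre, with a small constant. -/
theorem IsSubGaussianField.exists_envelope (hh : IsSubGaussianField F h L C)
    (hY : IsSample P F Y) (hL : 0 < L) (ha : ∀ p, 0 ≤ a p) (ha1 : ∑ p, a p = 1)
    {N : ℕ} (hN : Fintype.card ι = N) (hN1 : 1 ≤ N) (hdN : Module.finrank ℝ E ≤ N)
    {D : ℝ} (hD : 1 ≤ D) (hd : (Module.finrank ℝ E : ℝ) ≤ D) (hlog : Real.log N ≤ D)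
    {b : ℝ} (hb : 0 < b) (hNb : 9 ≤ L ^ 2 / C ^ 2 * b ^ 2 * N) (θ₀ : E) :
    ∃ S : Ω → ℝ, Integrable S P ∧ (∀ ω, 0 ≤ S ω) ∧ ∫ ω, S ω ∂P ≤ 2 * b ^ 2 / N ^ 2 ∧
      ∀ᵐ ω ∂P, ∀ θ, S ω < ‖θ - θ₀‖ ^ 2 →
        ‖empDev F h a Y θ ω - empDev F h a Y θ₀ ω‖ ≤
          112 * L * √(D * ∑ p, a p ^ 2) * ‖θ - θ₀‖ := by
  have hNpos : (0 : ℝ) < N := by exact_mod_cast hN1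
  set V := ∑ p, a p ^ 2
  set r₀ := b / N with hr₀
  have hr₀pos : 0 < r₀ := by positivity
  -- The deviation event is an uncountable union over `θ`; a measurable hull of the same measure
  -- avoids proving it measurable.
  let M : ℕ → Set Ω := fun j => toMeasurable P
    (devEvent F h a Y θ₀ (r₀ * 2 ^ j) (56 * L * (r₀ * 2 ^ j) * √(D * V)))
  let g : ℕ → Ω → ENNReal := fun j =>
    (M (j + 1)).indicator fun _ => ENNReal.ofReal ((r₀ * 2 ^ (j + 1)) ^ 2)
  let S : Ω → ENNReal := fun ω => ENNReal.ofReal (r₀ ^ 2) + ∑' j, g j ω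
  have hMm : ∀ j, MeasurableSet (M j) := fun j => measurableSet_toMeasurable _ _
  have hgm : ∀ j, Measurable (g j) := fun j => measurable_const.indicator (hMm _)
  have hSm : Measurable S := measurable_const.add (Measurable.tsum hgm)
  -- Here `4^{j+1} 8^{-(j+1)} = 2^{-(j+1)}`. The sum over `j` is `1`, so together with the base term
  -- the mean of `S` is at most `2 r₀²`.
  have hgint : ∀ j, ∫⁻ ω, g j ω ∂P ≤ ENNReal.ofReal (r₀ ^ 2 * ((1 : ℝ) / 2 / 2 ^ j)) := by
    intro j
    rw [lintegral_indicator_const (hMm _), measure_toMeasurable]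
    refine (mul_le_mul_right (hh.measure_devEvent_le_dyadic hY hL ha ha1 hN hN1 hdN hD hd hlog hb
      hNb θ₀ (j + 1)) _).trans (le_of_eq ?_)
    rw [← ENNReal.ofReal_mul (by positivity), show (8 : ℝ) = 2 ^ 2 * 2 by norm_num, mul_pow,
      mul_pow, ← pow_mul, ← pow_mul, mul_comm 2 (j + 1), pow_succ (2 : ℝ) j]
    congr 1
    field_simp
  have hSint : ∫⁻ ω, S ω ∂P ≤ ENNReal.ofReal (2 * b ^ 2 / N ^ 2) := by
    calc ∫⁻ ω, S ω ∂P = ENNReal.ofReal (r₀ ^ 2) + ∑' j, ∫⁻ ω, g j ω ∂P := by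
          rw [lintegral_add_left measurable_const, lintegral_const, measure_univ, mul_one,
            lintegral_tsum fun j => (hgm j).aemeasurable]
      _ ≤ ENNReal.ofReal (r₀ ^ 2) + ∑' j : ℕ, ENNReal.ofReal (r₀ ^ 2 * ((1 : ℝ) / 2 / 2 ^ j)) := by
          gcongr; exact hgint _
      _ = ENNReal.ofReal (r₀ ^ 2) + ENNReal.ofReal (r₀ ^ 2 * 1) := by
          rw [← ENNReal.ofReal_tsum_of_nonneg (fun l => by positivity)
            ((summable_geometric_two' 1).mul_left _), tsum_mul_left, tsum_geometric_two']
      _ = _ := by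
          rw [← ENNReal.ofReal_add (by positivity) (by positivity), hr₀]
          congr 1; ring
  have hSfin : ∫⁻ ω, S ω ∂P ≠ ⊤ := ne_top_of_le_ne_top ENNReal.ofReal_ne_top hSint
  refine ⟨fun ω => (S ω).toReal, integrable_toReal_of_lintegral_ne_top hSm.aemeasurable hSfin,
    fun ω => ENNReal.toReal_nonneg, ?_, ?_⟩
  · rw [integral_toReal hSm.aemeasurable (ae_lt_top hSm hSfin)]
    exact ENNReal.toReal_le_of_le_ofReal (by positivity) hSint
  · filter_upwards [ae_lt_top hSm hSfin] with ω hω θ hθ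
    have hle : ∀ x : ℝ, ENNReal.ofReal x ≤ S ω → x ≤ (S ω).toReal := fun x hx =>
      (ENNReal.ofReal_le_iff_le_toReal hω.ne).1 hx
    have h1 : r₀ ≤ ‖θ - θ₀‖ := by
      have := (hle (r₀ ^ 2) le_self_add).trans hθ.le
      exact le_of_sq_le_sq this (norm_nonneg _)
    -- The smallest dyadic ball containing `θ` has radius at most `2‖θ - θ₀‖`, which turns `56` into
    -- `112`. Its bad event cannot occur, since it would force `S` above `‖θ - θ₀‖²`.
    obtain ⟨j, hj1, hj2⟩ := exists_nat_pow_near (x := ‖θ - θ₀‖ / r₀) (y := 2)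
      ((one_le_div hr₀pos).2 h1) one_lt_two
    rw [le_div_iff₀' hr₀pos] at hj1
    rw [div_lt_iff₀' hr₀pos] at hj2
    have hnotM : ω ∉ M (j + 1) := by
      intro hmem
      have h2 : (r₀ * 2 ^ (j + 1)) ^ 2 ≤ (S ω).toReal := by
        refine hle _ (le_trans ?_ (le_add_self.trans_eq rfl))
        refine le_trans (le_of_eq ?_) (ENNReal.le_tsum j)
        simp only [g, Set.indicator_of_mem hmem]
      have h3 : ‖θ - θ₀‖ ^ 2 < (r₀ * 2 ^ (j + 1)) ^ 2 := by gcongr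
      linarith
    have hnot : ω ∉ devEvent F h a Y θ₀ (r₀ * 2 ^ (j + 1))
        (56 * L * (r₀ * 2 ^ (j + 1)) * √(D * V)) := fun hmem =>
      hnotM (subset_toMeasurable _ _ hmem)
    simp only [devEvent, Set.mem_ofPred_eq, not_exists, not_and, not_lt] at hnot
    refine (hnot θ hj2.le).trans ?_
    have h4 : 0 ≤ L * √(D * V) := by positivity
    have h5 : r₀ * 2 ^ (j + 1) ≤ 2 * ‖θ - θ₀‖ := by rw [pow_succ]; linarith
    nlinarith [mul_le_mul_of_nonneg_left h5 h4]

end Envelope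

/-! ### Measurability, symmetric operators and moments from tails -/

section Calculus

variable {𝒳 E : Type*} [MeasurableSpace 𝒳] [NormedAddCommGroup E] [InnerProductSpace ℝ E]
  [FiniteDimensional ℝ E] [MeasurableSpace E] [BorelSpace E]

theorem measurable_of_measurable_inner {g : 𝒳 → E} (hg : ∀ v, Measurable fun x => inner ℝ v (g x)) :
    Measurable g := by
  have h : g = fun x => ∑ i, inner ℝ (stdOrthonormalBasis ℝ E i) (g x) • stdOrthonormalBasis ℝ E i :=
    funext fun x => ((stdOrthonormalBasis ℝ E).sum_repr' (g x)).symm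
  rw [h]
  exact Finset.measurable_fun_sum _ fun i _ => (hg _).smul_const _

/-- A directional derivative is a pointwise limit of difference quotients. Applied twice, this
transfers measurability from the loss to its gradient and Hessian. -/
theorem measurable_directional_deriv {G : Type*} [NormedAddCommGroup G] [NormedSpace ℝ G]
    [MeasurableSpace G] [BorelSpace G] [SecondCountableTopology G]
    {f : 𝒳 → E → G} {f' : 𝒳 → E →L[ℝ] G} {θ : E} (hf : ∀ θ, Measurable fun x => f x θ)
    (hf' : ∀ x, HasFDerivAt (f x) (f' x) θ) (v : E) : Measurable fun x => f' x v := by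
  refine measurable_of_tendsto_metrizable
    (f := fun (n : ℕ) x => (n : ℝ) • (f x (θ + (n : ℝ)⁻¹ • v) - f x θ)) (fun n => ?_) ?_
  · exact ((hf _).sub (hf θ)).const_smul _
  · rw [tendsto_pi_nhds]
    exact fun x => ((hf' x).lim_real v).comp tendsto_natCast_atTop_atTop

theorem aestronglyMeasurable_clm {F : Measure 𝒳} {M : 𝒳 → E →L[ℝ] E}
    (hM : ∀ v, Measurable fun x => M x v) : AEStronglyMeasurable M F := by
  let b := stdOrthonormalBasis ℝ E
  have h : M = fun x => ∑ i, ContinuousLinearMap.smulRightL ℝ E E (innerSL ℝ (b i)) (M x (b i)) := by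
    funext x
    ext v
    simp only [sum_apply, ContinuousLinearMap.smulRightL_apply_apply,
      ContinuousLinearMap.smulRight_apply, innerSL_apply_apply]
    conv_lhs => rw [← b.sum_repr' v, map_sum]
    simp only [map_smul]
  rw [h]
  exact Finset.aestronglyMeasurable_fun_sum _ fun i _ =>
    (ContinuousLinearMap.continuous _).comp_aestronglyMeasurable
      (hM (b i)).aestronglyMeasurable

/-- Nonnegativity of the form at `v - q⁻¹ A v`, together with the upper bound at `A v`, gives `‖A
v‖² ≤ q ⟪v, A v⟫`. -/
theorem norm_apply_le_of_symmetric {A : E →L[ℝ] E} (hsymm : ∀ v w, inner ℝ (A v) w = inner ℝ v (A w))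
    {q : ℝ} (hq : 0 < q) (h0 : ∀ v, 0 ≤ inner ℝ v (A v)) (h1 : ∀ v, inner ℝ v (A v) ≤ q * ‖v‖ ^ 2)
    (v : E) : ‖A v‖ ≤ q * ‖v‖ := by
  have key : ‖A v‖ ^ 2 ≤ q * inner ℝ v (A v) := by
    have h2 := h0 (v - q⁻¹ • A v)
    rw [map_sub, map_smul, inner_sub_left, inner_sub_right, inner_sub_right,
      real_inner_smul_left, real_inner_smul_left, real_inner_smul_right, real_inner_smul_right,
      ← hsymm v (A v), real_inner_self_eq_norm_sq] at h2
    have h3 : q⁻¹ * (q⁻¹ * inner ℝ (A v) (A (A v))) ≤ q⁻¹ * (q⁻¹ * (q * ‖A v‖ ^ 2)) := by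
      gcongr; exact h1 _
    have h4 : q⁻¹ * (q⁻¹ * (q * ‖A v‖ ^ 2)) = q⁻¹ * ‖A v‖ ^ 2 := by field_simp
    have h5 : q⁻¹ * ‖A v‖ ^ 2 ≤ inner ℝ v (A v) := by linarith
    rwa [inv_mul_le_iff₀ hq] at h5
  refine le_of_sq_le_sq ?_ (by positivity)
  calc ‖A v‖ ^ 2 ≤ q * inner ℝ v (A v) := key
    _ ≤ q * (q * ‖v‖ ^ 2) := by gcongr; exact h1 v
    _ = _ := by ring

theorem hasFDerivAt_gradient {f : E → ℝ} (hf : ContDiff ℝ 2 f) (θ : E) :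
    HasFDerivAt (gradient f) (fderiv ℝ (gradient f) θ) θ := by
  refine DifferentiableAt.hasFDerivAt ?_
  let b := stdOrthonormalBasis ℝ E
  have h : gradient f = fun y => ∑ i, (fderiv ℝ f y (b i)) • b i := by
    funext y
    rw [← b.sum_repr' (gradient f y)]
    refine Finset.sum_congr rfl fun i _ => ?_
    rw [real_inner_comm, inner_gradient_left]
  have hd : Differentiable ℝ (fderiv ℝ f) :=
    (hf.fderiv_right (m := 1) (by norm_num)).differentiable (by norm_num)
  rw [h]
  fun_prop

theorem inner_fderiv_gradient_comm {f : E → ℝ} (hf : ContDiff ℝ 2 f) (θ v w : E) :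
    inner ℝ (fderiv ℝ (gradient f) θ v) w = inner ℝ v (fderiv ℝ (gradient f) θ w) := by
  have hd : Differentiable ℝ (fderiv ℝ f) :=
    (hf.fderiv_right (m := 1) (by norm_num)).differentiable (by norm_num)
  have key : ∀ v w, inner ℝ (fderiv ℝ (gradient f) θ v) w = fderiv ℝ (fderiv ℝ f) θ v w := by
    intro v w
    have h1 : HasFDerivAt (fun y => inner ℝ w (gradient f y))
        ((innerSL ℝ w).comp (fderiv ℝ (gradient f) θ)) θ :=
      (innerSL ℝ w).hasFDerivAt.comp θ (hasFDerivAt_gradient hf θ)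
    have h2 : HasFDerivAt (fun y => fderiv ℝ f y w)
        ((ContinuousLinearMap.apply ℝ ℝ w).comp (fderiv ℝ (fderiv ℝ f) θ)) θ :=
      (ContinuousLinearMap.apply ℝ ℝ w).hasFDerivAt.comp θ (hd θ).hasFDerivAt
    have h3 : (fun y => inner ℝ w (gradient f y)) = fun y => fderiv ℝ f y w := by
      funext y
      rw [real_inner_comm, inner_gradient_left]
    rw [h3] at h1
    have h4 := DFunLike.congr_fun (h1.unique h2) v
    rw [real_inner_comm]
    simpa using h4
  have hsymm := hf.contDiffAt.isSymmSndFDerivAt (x := θ) (by simp)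
  rw [key, hsymm.eq, ← key, real_inner_comm]

/-- Layer-cake formula: the event `Y² ≥ t` has probability at most `2 e^{-t/C²}`, which is
integrable in `t`. -/
theorem memLp_two_of_tail {F : Measure 𝒳} [IsProbabilityMeasure F] {Y : 𝒳 → ℝ} (hY : Measurable Y)
    {C : ℝ} (hC : 0 < C) (h1 : ∀ t : ℝ, 0 ≤ t → F.real {x | t ≤ Y x} ≤ Real.exp (-t ^ 2 / C ^ 2))
    (h2 : ∀ t : ℝ, 0 ≤ t → F.real {x | t ≤ -Y x} ≤ Real.exp (-t ^ 2 / C ^ 2)) : MemLp Y 2 F := by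
  rw [memLp_two_iff_integrable_sq hY.aestronglyMeasurable]
  refine ⟨(hY.pow_const 2).aestronglyMeasurable, ?_⟩
  rw [hasFiniteIntegral_iff_ofReal (Filter.Eventually.of_forall fun x => sq_nonneg (Y x)),
    lintegral_eq_lintegral_meas_le F (Filter.Eventually.of_forall fun x => sq_nonneg (Y x))
      (hY.pow_const 2).aemeasurable]
  have hint : IntegrableOn (fun t : ℝ => 2 * Real.exp (-(C ^ 2)⁻¹ * t)) (Set.Ioi 0) :=
    (exp_neg_integrableOn_Ioi 0 (by positivity)).const_mul 2
  refine lt_of_le_of_lt (setLIntegral_mono' measurableSet_Ioi (fun t ht => ?_))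
    ((hasFiniteIntegral_iff_ofReal (Filter.Eventually.of_forall fun t => by positivity)).1 hint.2)
  have ht' : (0 : ℝ) ≤ t := le_of_lt ht
  have hsub : {x | t ≤ Y x ^ 2} ⊆ {x | √t ≤ Y x} ∪ {x | √t ≤ -Y x} := by
    intro x hx
    have : √t ≤ |Y x| := Real.sqrt_le_iff.2 ⟨abs_nonneg _, by rwa [sq_abs]⟩
    exact le_abs.1 this
  rw [ENNReal.le_ofReal_iff_toReal_le (measure_ne_top _ _) (by positivity)]
  refine (measureReal_mono hsub).trans ((measureReal_union_le _ _).trans ?_)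
  have h3 := h1 (√t) (Real.sqrt_nonneg t)
  have h4 := h2 (√t) (Real.sqrt_nonneg t)
  rw [Real.sq_sqrt ht', show -t / C ^ 2 = -(C ^ 2)⁻¹ * t by ring] at h3 h4
  linarith

theorem memLp_two_of_inner {F : Measure 𝒳} {g : 𝒳 → E}
    (hg : ∀ v : E, ‖v‖ = 1 → MemLp (fun x => inner ℝ v (g x)) 2 F) : MemLp g 2 F := by
  let b := stdOrthonormalBasis ℝ E
  have h : g = fun x => ∑ i, inner ℝ (b i) (g x) • b i := funext fun x => (b.sum_repr' (g x)).symm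
  rw [h]
  refine memLp_finsetSum _ fun i _ => ?_
  exact ((ContinuousLinearMap.toSpanSingleton ℝ (b i)).comp_memLp' (hg (b i) (b.norm_eq_one i)))

end Calculus

/-! ### The population loss and contraction of its gradient step -/

section Loss

variable {𝒳 : Type*} [MeasurableSpace 𝒳] {d : ℕ} {F : Measure 𝒳} [IsProbabilityMeasure F]
  {ρ : 𝒳 → Param d → ℝ} {Θ : Set (Param d)} {θ₀ : Param d} {τ₁ τ₂ C₁ C₂ W : ℝ}

theorem LossAssumptions.measurable_gradient (hA : LossAssumptions F ρ Θ θ₀ τ₁ τ₂ C₁ C₂ W)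
    (θ : Param d) : Measurable fun x => gradient (ρ x) θ := by
  refine measurable_of_measurable_inner fun v => ?_
  simp only [real_inner_comm _ v, inner_gradient_left]
  exact measurable_directional_deriv hA.measurable
    (fun x => ((hA.contDiff x).differentiable (by norm_num) θ).hasFDerivAt) v

theorem LossAssumptions.hasFDerivAt_gradient (hA : LossAssumptions F ρ Θ θ₀ τ₁ τ₂ C₁ C₂ W) (x : 𝒳)
    (θ : Param d) : HasFDerivAt (gradient (ρ x)) (hess ρ x θ) θ :=
  FedSGD.hasFDerivAt_gradient (hA.contDiff x) θ

theorem LossAssumptions.aestronglyMeasurable_hess (hA : LossAssumptions F ρ Θ θ₀ τ₁ τ₂ C₁ C₂ W)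
    (θ : Param d) : AEStronglyMeasurable (fun x => hess ρ x θ) F :=
  aestronglyMeasurable_clm fun v =>
    measurable_directional_deriv (f := fun x => gradient (ρ x)) hA.measurable_gradient
      (fun x => hA.hasFDerivAt_gradient x θ) v

theorem LossAssumptions.integrable_hess (hA : LossAssumptions F ρ Θ θ₀ τ₁ τ₂ C₁ C₂ W)
    (θ : Param d) : Integrable (fun x => hess ρ x θ) F :=
  Integrable.of_bound (hA.aestronglyMeasurable_hess θ) τ₂
    (Filter.Eventually.of_forall fun x => hA.bounded_hess x θ)

theorem LossAssumptions.memLp_gradient (hA : LossAssumptions F ρ Θ θ₀ τ₁ τ₂ C₁ C₂ W) (hC₁ : 0 < C₁)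
    (θ : Param d) : MemLp (fun x => gradient (ρ x) θ) 2 F := by
  set m := ∫ y, gradient (ρ y) θ ∂F with hm
  have h : MemLp (fun x => gradient (ρ x) θ - m) 2 F := by
    refine memLp_two_of_inner fun v hv => memLp_two_of_tail
      ((hA.measurable_gradient θ).sub_const _).const_inner hC₁
      (hA.subGaussian_grad θ v hv) fun t ht => ?_
    have := hA.subGaussian_grad θ (-v) (by rwa [norm_neg]) t ht
    simpa only [inner_neg_left] using this
  refine (h.add (memLp_const m)).congr_norm (hA.measurable_gradient θ).aestronglyMeasurable
    (Filter.Eventually.of_forall fun x => ?_)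
  simp

theorem LossAssumptions.isSubGaussianField (hA : LossAssumptions F ρ Θ θ₀ τ₁ τ₂ C₁ C₂ W)
    (hC₁ : 0 < C₁) : IsSubGaussianField F (fun x θ => gradient (ρ x) θ) τ₂ C₁ where
  measurable := hA.measurable_gradient
  integrable θ := (hA.memLp_gradient hC₁ θ).integrable one_le_two
  lipschitz x θ θ' := Convex.norm_image_sub_le_of_norm_hasFDerivWithin_le
    (fun y _ => (hA.hasFDerivAt_gradient x y).hasFDerivWithinAt) (fun y _ => hA.bounded_hess x y)
    convex_univ (Set.mem_univ θ') (Set.mem_univ θ)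
  tail := hA.subGaussian_grad

/-- Fermat's rule at the global minimizer. Bounded Hessians dominate the gradients on the unit ball
around `θ₀`, which permits differentiation under the integral. -/
theorem LossAssumptions.integral_gradient_eq_zero
    (hA : LossAssumptions F ρ Θ θ₀ τ₁ τ₂ C₁ C₂ W) (hC₁ : 0 < C₁) :
    ∫ x, gradient (ρ x) θ₀ ∂F = 0 := by
  have hfield := hA.isSubGaussianField hC₁
  have hτ : ∀ θ x, ‖gradient (ρ x) θ‖ ≤ ‖gradient (ρ x) θ₀‖ + τ₂ * ‖θ - θ₀‖ := by
    intro θ x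
    have h1 := norm_sub_norm_le (gradient (ρ x) θ) (gradient (ρ x) θ₀)
    linarith [hfield.lipschitz x θ θ₀]
  have hdual : ∀ x θ, ‖fderiv ℝ (ρ x) θ‖ = ‖gradient (ρ x) θ‖ := fun x θ => by
    rw [gradient, LinearIsometryEquiv.norm_map]
  have hfm : AEStronglyMeasurable (fun x => fderiv ℝ (ρ x) θ₀) F := by
    have : (fun x => fderiv ℝ (ρ x) θ₀) =
        fun x => InnerProductSpace.toDual ℝ (Param d) (gradient (ρ x) θ₀) := by
      funext x
      rw [gradient, LinearIsometryEquiv.apply_symm_apply]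
    rw [this]
    exact (LinearIsometryEquiv.continuous _).comp_aestronglyMeasurable
      (hA.measurable_gradient θ₀).aestronglyMeasurable
  have hint : Integrable (fun x => fderiv ℝ (ρ x) θ₀) F :=
    ((hfield.integrable θ₀).norm).mono' hfm (Filter.Eventually.of_forall fun x => (hdual x θ₀).le)
  have hderiv : HasFDerivAt (risk F ρ) (∫ x, fderiv ℝ (ρ x) θ₀ ∂F) θ₀ := by
    refine hasFDerivAt_integral_of_dominated_of_fderiv_le (F := fun θ x => ρ x θ)
      (F' := fun θ x => fderiv ℝ (ρ x) θ) (s := Metric.ball θ₀ 1)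
      (bound := fun x => ‖gradient (ρ x) θ₀‖ + |τ₂|) (Metric.ball_mem_nhds _ one_pos)
      (Filter.Eventually.of_forall fun θ => (hA.measurable θ).aestronglyMeasurable)
      (hA.integrable θ₀) hfm (Filter.Eventually.of_forall fun x θ hθ => ?_)
      ((hfield.integrable θ₀).norm.add (integrable_const _))
      (Filter.Eventually.of_forall fun x θ _ =>
        ((hA.contDiff x).differentiable (by norm_num) θ).hasFDerivAt)
    rw [hdual]
    refine (hτ θ x).trans (add_le_add_right ?_ _)
    rw [Metric.mem_ball, dist_eq_norm] at hθ
    calc τ₂ * ‖θ - θ₀‖ ≤ |τ₂| * ‖θ - θ₀‖ := by gcongr; exact le_abs_self _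
      _ ≤ |τ₂| := mul_le_of_le_one_right (abs_nonneg _) hθ.le
  have hmin : IsLocalMin (risk F ρ) θ₀ := Filter.Eventually.of_forall fun θ => by
    rcases eq_or_ne θ θ₀ with rfl | hne
    exacts [le_rfl, (hA.unique_min θ hne).le]
  have hzero := hmin.hasFDerivAt_eq_zero hderiv
  refine ext_inner_right ℝ fun v => ?_
  have h1 := congrArg (fun f => f v) hzero
  rw [ContinuousLinearMap.integral_apply hint] at h1
  rw [real_inner_comm, ← integral_inner (hfield.integrable θ₀) v, inner_zero_left]
  simp only [real_inner_comm _ v, inner_gradient_left]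
  exact h1

theorem LossAssumptions.hasFDerivAt_mean_gradient
    (hA : LossAssumptions F ρ Θ θ₀ τ₁ τ₂ C₁ C₂ W) (hC₁ : 0 < C₁) (θ : Param d) :
    HasFDerivAt (fun θ => ∫ x, gradient (ρ x) θ ∂F) (∫ x, hess ρ x θ ∂F) θ :=
  hasFDerivAt_integral_of_dominated_of_fderiv_le (F := fun θ x => gradient (ρ x) θ)
    (F' := fun θ x => hess ρ x θ) (s := Set.univ) (bound := fun _ => τ₂) Filter.univ_mem
    (Filter.Eventually.of_forall fun θ => (hA.measurable_gradient θ).aestronglyMeasurable)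
    ((hA.isSubGaussianField hC₁).integrable θ) (hA.aestronglyMeasurable_hess θ)
    (Filter.Eventually.of_forall fun x θ _ => hA.bounded_hess x θ) (integrable_const _)
    (Filter.Eventually.of_forall fun x θ _ => hA.hasFDerivAt_gradient x θ)

theorem LossAssumptions.norm_mean_hess_le (hA : LossAssumptions F ρ Θ θ₀ τ₁ τ₂ C₁ C₂ W)
    (θ : Param d) : ‖∫ x, hess ρ x θ ∂F‖ ≤ τ₂ := by
  simpa using norm_integral_le_of_norm_le_const (μ := F)
    (Filter.Eventually.of_forall fun x => hA.bounded_hess x θ)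

theorem LossAssumptions.inner_mean_hess_le (hA : LossAssumptions F ρ Θ θ₀ τ₁ τ₂ C₁ C₂ W)
    (θ v : Param d) : inner ℝ v ((∫ x, hess ρ x θ ∂F) v) ≤ τ₂ * ‖v‖ ^ 2 := by
  calc _ ≤ ‖v‖ * (‖∫ x, hess ρ x θ ∂F‖ * ‖v‖) :=
        (real_inner_le_norm _ _).trans (by gcongr; exact ContinuousLinearMap.le_opNorm _ _)
    _ ≤ ‖v‖ * (τ₂ * ‖v‖) := by gcongr; exact hA.norm_mean_hess_le θ
    _ = _ := by ring

theorem LossAssumptions.tau_le (hA : LossAssumptions F ρ Θ θ₀ τ₁ τ₂ C₁ C₂ W) (hd : 1 ≤ d) :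
    τ₁ ≤ τ₂ := by
  have : Nontrivial (Param d) := by
    have : Nonempty (Fin d) := ⟨⟨0, hd⟩⟩
    infer_instance
  obtain ⟨v, hv⟩ := exists_norm_eq (Param d) zero_le_one
  have h1 := (hA.strong_convex 0 v).trans (hA.inner_mean_hess_le 0 v)
  rw [hv] at h1
  linarith

/-- The derivative `I - η 𝔼∇²ρ` of the step map is symmetric with spectrum in `[0, 1 - ητ₁]`: the
lower end uses `ητ₂ ≤ 1`, the upper end strong convexity. The mean value inequality then applies on
the whole space. -/
theorem LossAssumptions.contraction (hA : LossAssumptions F ρ Θ θ₀ τ₁ τ₂ C₁ C₂ W) (hC₁ : 0 < C₁)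
    {η : ℝ} (hη : 0 ≤ η) (hη₁ : η * τ₁ < 1) (hη₂ : η * τ₂ ≤ 1) (θ θ' : Param d) :
    ‖(θ - θ') - η • (∫ x, gradient (ρ x) θ ∂F - ∫ x, gradient (ρ x) θ' ∂F)‖ ≤
      (1 - η * τ₁) * ‖θ - θ'‖ := by
  let G : Param d → Param d := fun θ => ∫ x, gradient (ρ x) θ ∂F
  let A : Param d → Param d →L[ℝ] Param d := fun θ =>
    ContinuousLinearMap.id ℝ _ - η • ∫ x, hess ρ x θ ∂F
  have hderiv : ∀ θ, HasFDerivAt (fun θ => θ - η • G θ) (A θ) θ := fun θ =>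
    (hasFDerivAt_id θ).sub ((hA.hasFDerivAt_mean_gradient hC₁ θ).const_smul η)
  have hinner : ∀ θ v w, inner ℝ v ((∫ x, hess ρ x θ ∂F) w) = ∫ x, inner ℝ v (hess ρ x θ w) ∂F := by
    intro θ v w
    rw [ContinuousLinearMap.integral_apply (hA.integrable_hess θ), ← integral_inner]
    exact (hA.integrable_hess θ).apply_continuousLinearMap w
  have hbound : ∀ θ, ‖A θ‖ ≤ 1 - η * τ₁ := by
    intro θ
    refine ContinuousLinearMap.opNorm_le_bound _ (by linarith) fun v => ?_
    have hAv : ∀ v, inner ℝ v (A θ v) = ‖v‖ ^ 2 - η * inner ℝ v ((∫ x, hess ρ x θ ∂F) v) := by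
      intro v
      simp only [A, sub_apply, ContinuousLinearMap.id_apply,
        smul_apply, inner_sub_right, real_inner_smul_right,
        real_inner_self_eq_norm_sq]
    refine norm_apply_le_of_symmetric ?_ (by linarith) (fun v => ?_) (fun v => ?_) v
    · intro v w
      simp only [A, sub_apply, ContinuousLinearMap.id_apply,
        smul_apply, inner_sub_right, inner_sub_left, real_inner_smul_right,
        real_inner_smul_left]
      rw [real_inner_comm w ((∫ x, hess ρ x θ ∂F) v), hinner, hinner]
      congr 2
      refine integral_congr_ae (Filter.Eventually.of_forall fun x => ?_)
      simp only
      rw [real_inner_comm]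
      exact inner_fderiv_gradient_comm (hA.contDiff x) θ v w
    · rw [hAv]
      have := mul_le_mul_of_nonneg_left (hA.inner_mean_hess_le θ v) hη
      nlinarith [sq_nonneg ‖v‖]
    · rw [hAv]
      have := mul_le_mul_of_nonneg_left (hA.strong_convex θ v) hη
      linarith
  have := Convex.norm_image_sub_le_of_norm_hasFDerivWithin_le
    (fun y _ => (hderiv y).hasFDerivWithinAt) (fun y _ => hbound y)
    convex_univ (Set.mem_univ θ') (Set.mem_univ θ)
  rwa [sub_sub_sub_comm, ← smul_sub] at this

end Loss

/-! ### All clients as one weighted sample, and one gradient step -/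

section Pooling

variable {Ω 𝒳 : Type*} [MeasurableSpace Ω] [MeasurableSpace 𝒳] {d m : ℕ}
  {P : Measure Ω} [IsProbabilityMeasure P] {F : Measure 𝒳} [IsProbabilityMeasure F]
  {n : Fin m → ℕ} {ρ : 𝒳 → Param d → ℝ} {Θ : Set (Param d)} {θ₀ : Param d}
  {X : (i : Fin m) → Fin (n i) → Ω → 𝒳} {Z : ℕ → Fin m → Ω → Param d} {θinit : Ω → Param d}
  {w : Fin m → ℝ} {τ₁ τ₂ C₁ C₂ W : ℝ}

/-- The gradient of the weighted empirical loss. -/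
def weightedGrad (ρ : 𝒳 → Param d → ℝ) (n : Fin m → ℕ) (X : (i : Fin m) → Fin (n i) → Ω → 𝒳)
    (w : Fin m → ℝ) (θ : Param d) (ω : Ω) : Param d :=
  ∑ i, w i • localGrad ρ n X i θ ω

/-- The weight of a single observation in the pooled sample. -/
def obsWeight (n : Fin m → ℕ) (w : Fin m → ℝ) (p : Σ i : Fin m, Fin (n i)) : ℝ := w p.1 / n p.1

/-- The pooled sample. -/
def pooled (X : (i : Fin m) → Fin (n i) → Ω → 𝒳) (p : Σ i : Fin m, Fin (n i)) : Ω → 𝒳 :=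
  X p.1 p.2

theorem sum_obsWeight (hn : ∀ i, 1 ≤ n i) (hw : w ∈ stdSimplex ℝ (Fin m)) :
    ∑ p, obsWeight n w p = 1 := by
  rw [Fintype.sum_sigma, ← hw.2]
  refine Finset.sum_congr rfl fun i _ => ?_
  have : (n i : ℝ) ≠ 0 := by have := hn i; positivity
  simp only [obsWeight, Finset.sum_const, Finset.card_univ, Fintype.card_fin, nsmul_eq_mul]
  field_simp

theorem obsWeight_nonneg (hw : w ∈ stdSimplex ℝ (Fin m)) (p : Σ i : Fin m, Fin (n i)) :
    0 ≤ obsWeight n w p := div_nonneg (hw.1 _) (Nat.cast_nonneg _)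

theorem sum_obsWeight_sq : ∑ p, obsWeight n w p ^ 2 = ∑ i, w i ^ 2 / n i := by
  rw [Fintype.sum_sigma]
  refine Finset.sum_congr rfl fun i _ => ?_
  simp only [obsWeight, Finset.sum_const, Finset.card_univ, Fintype.card_fin, nsmul_eq_mul]
  rcases eq_or_ne (n i : ℝ) 0 with h | h
  · simp [h]
  · field_simp

theorem card_pooled (n : Fin m → ℕ) : Fintype.card (Σ i : Fin m, Fin (n i)) = totalSize n := by
  simp [totalSize]

theorem Sampling.isSample (hS : Sampling P F n X Z θinit) : IsSample P F (pooled X) where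
  measurable p := hS.measurable_data p.1 p.2
  law p := hS.law_data p.1 p.2
  indep := hS.indep_data

theorem weightedGrad_eq_sum (θ : Param d) (ω : Ω) :
    weightedGrad ρ n X w θ ω = ∑ p, obsWeight n w p • gradient (ρ (pooled X p ω)) θ := by
  rw [Fintype.sum_sigma, weightedGrad]
  refine Finset.sum_congr rfl fun i _ => ?_
  rw [localGrad, smul_smul, Finset.smul_sum]
  simp only [obsWeight, pooled, mul_one_div]

theorem weightedGrad_eq_empDev (hn : ∀ i, 1 ≤ n i) (hw : w ∈ stdSimplex ℝ (Fin m)) (θ : Param d)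
    (ω : Ω) : weightedGrad ρ n X w θ ω =
      empDev F (fun x θ => gradient (ρ x) θ) (obsWeight n w) (pooled X) θ ω +
        ∫ x, gradient (ρ x) θ ∂F := by
  rw [weightedGrad_eq_sum, empDev]
  simp only [smul_sub, Finset.sum_sub_distrib, ← Finset.sum_smul, sum_obsWeight hn hw, one_smul,
    sub_add_cancel]

theorem LossAssumptions.norm_weightedGrad_sub_le (hA : LossAssumptions F ρ Θ θ₀ τ₁ τ₂ C₁ C₂ W)
    (hC₁ : 0 < C₁) (hn : ∀ i, 1 ≤ n i) (hw : w ∈ stdSimplex ℝ (Fin m)) (θ θ' : Param d) (ω : Ω) :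
    ‖weightedGrad ρ n X w θ ω - weightedGrad ρ n X w θ' ω‖ ≤ τ₂ * ‖θ - θ'‖ := by
  rw [weightedGrad_eq_sum, weightedGrad_eq_sum, ← Finset.sum_sub_distrib]
  calc _ ≤ ∑ p, obsWeight n w p * (τ₂ * ‖θ - θ'‖) := by
        refine norm_sum_le_of_le _ fun p _ => ?_
        rw [← smul_sub, norm_smul, Real.norm_of_nonneg (obsWeight_nonneg hw p)]
        exact mul_le_mul_of_nonneg_left ((hA.isSubGaussianField hC₁).lipschitz _ _ _)
          (obsWeight_nonneg hw p)
    _ = _ := by rw [← Finset.sum_mul, sum_obsWeight hn hw, one_mul]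

/-- One gradient step contracts towards the target, up to a random additive error that is small
in mean. -/
theorem LossAssumptions.exists_gradient_step_bound (hA : LossAssumptions F ρ Θ θ₀ τ₁ τ₂ C₁ C₂ W)
    (hS : Sampling P F n X Z θinit) (hτ₂ : 0 < τ₂) (hC₁ : 0 < C₁) (hn : ∀ i, 1 ≤ n i)
    (hw : w ∈ stdSimplex ℝ (Fin m)) (hd1 : 1 ≤ d) (hdN : d ≤ totalSize n)
    {b : ℝ} (hb : 0 < b) (hNb : 9 ≤ τ₂ ^ 2 / C₁ ^ 2 * b ^ 2 * totalSize n) {η γ : ℝ} (hη : 0 ≤ η)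
    (hη₁ : η * τ₁ < 1) (hη₂ : η * τ₂ ≤ 1)
    (hγ : 1 - η * τ₁ +
      η * (112 * τ₂ * √(dimLog d (totalSize n) * ∑ i, w i ^ 2 / (n i : ℝ))) ≤ γ) :
    ∃ S : Ω → ℝ, Integrable S P ∧ (∀ ω, 0 ≤ S ω) ∧
      ∫ ω, S ω ∂P ≤ 2 * b ^ 2 / (totalSize n : ℝ) ^ 2 ∧
      ∀ᵐ ω ∂P, ∀ θ, ‖(θ - θ₀) - η • (weightedGrad ρ n X w θ ω - weightedGrad ρ n X w θ₀ ω)‖ ^ 2 ≤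
        γ ^ 2 * ‖θ - θ₀‖ ^ 2 + 4 * S ω := by
  have hfield := hA.isSubGaussianField hC₁
  have hdD : (d : ℝ) ≤ dimLog d (totalSize n) := le_max_left _ _
  have hd1' : (1 : ℝ) ≤ d := by exact_mod_cast hd1
  obtain ⟨S, hSint, hS0, hSle, hSae⟩ := hfield.exists_envelope (a := obsWeight n w) hS.isSample hτ₂
    (obsWeight_nonneg hw) (sum_obsWeight hn hw) (card_pooled n) (hd1.trans hdN)
    (by rwa [finrank_euclideanSpace_fin]) (hd1'.trans hdD)
    (by rwa [finrank_euclideanSpace_fin]) (le_max_right _ _) hb hNb θ₀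
  rw [sum_obsWeight_sq] at hSae
  refine ⟨S, hSint, hS0, hSle, ?_⟩
  filter_upwards [hSae] with ω hω θ
  -- Outside the random ball the deviation is a small perturbation of the mean contraction. Inside
  -- it, Lipschitz continuity and `ητ₂ ≤ 1` allow at most a doubling, paid for by `4S`.
  rcases lt_or_ge (S ω) (‖θ - θ₀‖ ^ 2) with hlt | hge
  · have h1 := hω θ hlt
    have h2 := hA.contraction hC₁ hη hη₁ hη₂ θ θ₀
    set ε := √(dimLog d (totalSize n) * ∑ i, w i ^ 2 / (n i : ℝ))
    have h3 : ‖(θ - θ₀) - η • (weightedGrad ρ n X w θ ω - weightedGrad ρ n X w θ₀ ω)‖ ≤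
        γ * ‖θ - θ₀‖ := by
      rw [weightedGrad_eq_empDev (F := F) hn hw, weightedGrad_eq_empDev (F := F) hn hw,
        add_sub_add_comm, smul_add, add_comm (η • _), ← sub_sub]
      refine (norm_sub_le _ _).trans ?_
      rw [norm_smul, Real.norm_of_nonneg hη]
      have h4 := mul_le_mul_of_nonneg_left h1 hη
      have h5 := mul_le_mul_of_nonneg_right hγ (norm_nonneg (θ - θ₀))
      linarith
    calc _ ≤ (γ * ‖θ - θ₀‖) ^ 2 := by gcongr
      _ = γ ^ 2 * ‖θ - θ₀‖ ^ 2 := by ring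
      _ ≤ _ := by linarith [hS0 ω]
  · have h1 : ‖(θ - θ₀) - η • (weightedGrad ρ n X w θ ω - weightedGrad ρ n X w θ₀ ω)‖ ≤
        2 * ‖θ - θ₀‖ := by
      refine (norm_sub_le _ _).trans ?_
      rw [norm_smul, Real.norm_of_nonneg hη]
      have h2 := mul_le_mul_of_nonneg_left
        (hA.norm_weightedGrad_sub_le (X := X) hC₁ hn hw θ θ₀ ω) hη
      have h3 := mul_le_mul_of_nonneg_right hη₂ (norm_nonneg (θ - θ₀))
      linarith
    calc _ ≤ (2 * ‖θ - θ₀‖) ^ 2 := by gcongr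
      _ = 4 * ‖θ - θ₀‖ ^ 2 := by ring
      _ ≤ 4 * S ω := by linarith
      _ ≤ _ := by nlinarith [sq_nonneg (γ * ‖θ - θ₀‖)]

end Pooling

/-! ### Independence of each round's noise from the past -/

section Independence

/-- Both hypotheses factor the joint law into a threefold product; only the bracketing changes. -/
theorem IndepFun.prodMk_left_of_prodMk_right {Ω α β γ : Type*} [MeasurableSpace Ω]
    [MeasurableSpace α] [MeasurableSpace β] [MeasurableSpace γ] {P : Measure Ω}
    [IsProbabilityMeasure P] {A : Ω → α} {B : Ω → β} {C : Ω → γ} (hA : Measurable A)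
    (hB : Measurable B) (hC : Measurable C) (h1 : IndepFun A (fun ω => (B ω, C ω)) P)
    (h2 : IndepFun B C P) : IndepFun (fun ω => (A ω, B ω)) C P := by
  have h3 : IndepFun A B P := h1.comp measurable_id measurable_fst
  rw [indepFun_iff_map_prod_eq_prod_map_map (by fun_prop) (by fun_prop)] at h1 h2 h3 ⊢
  have := Measure.isProbabilityMeasure_map (μ := P) hA.aemeasurable
  have := Measure.isProbabilityMeasure_map (μ := P) hB.aemeasurable
  have := Measure.isProbabilityMeasure_map (μ := P) hC.aemeasurable
  apply (MeasurableEquiv.prodAssoc (α := α) (β := β) (γ := γ)).map_measurableEquiv_injective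
  rw [h3, Measure.prodAssoc_prod, ← h2, ← h1,
    Measure.map_map (MeasurableEquiv.measurable _) (by fun_prop)]
  rfl

variable {Ω 𝒳 : Type*} [MeasurableSpace Ω] [MeasurableSpace 𝒳] {d m : ℕ}
  {P : Measure Ω} [IsProbabilityMeasure P] {F : Measure 𝒳}
  {n : Fin m → ℕ} {ρ : 𝒳 → Param d → ℝ}
  {X : (i : Fin m) → Fin (n i) → Ω → 𝒳} {Z : ℕ → Fin m → Ω → Param d} {θinit : Ω → Param d}
  {w : Fin m → ℝ} {η μ B : ℝ} {K : ℕ}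

/-- The initial point, the data and the noise of the first `k` rounds (padded by zero). -/
def past (X : (i : Fin m) → Fin (n i) → Ω → 𝒳) (Z : ℕ → Fin m → Ω → Param d) (θinit : Ω → Param d)
    (k : ℕ) (ω : Ω) : Param d × ((i : Fin m) → Fin (n i) → 𝒳) × (ℕ → Fin m → Param d) :=
  (θinit ω, (fun i j => X i j ω, fun l i => if l < k then Z l i ω else 0))

theorem Sampling.indepFun_past (hS : Sampling P F n X Z θinit) (k : ℕ) :
    IndepFun (past X Z θinit k) (fun ω i => Z k i ω) P := by
  have := hS.measurable_data
  have := hS.measurable_noise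
  have hinit := hS.measurable_init
  have hX : Measurable fun ω i j => X i j ω := by fun_prop
  have hZk : Measurable fun ω i => Z k i ω := by fun_prop
  let tr : (ℕ → Fin m → Param d) → (ℕ → Fin m → Param d) := fun z l i => if l < k then z l i else 0
  have htr : Measurable tr := by
    refine measurable_pi_lambda _ fun l => measurable_pi_lambda _ fun i => ?_
    by_cases hl : l < k
    · simp only [tr, if_pos hl]; fun_prop
    · simp only [tr, if_neg hl]; fun_prop
  let T : Ω → ℕ → Fin m → Param d := fun ω => tr fun l i => Z l i ω
  have hT : Measurable T := htr.comp (by fun_prop)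
  have h1 : IndepFun T (fun ω i => Z k i ω) P := by
    have hfin := hS.indep_noise.indepFun_finset (Finset.range k ×ˢ Finset.univ)
      ({k} ×ˢ Finset.univ)
      (by
        rw [Finset.disjoint_left]
        rintro ⟨l, i⟩ h1 h2
        simp only [Finset.mem_product, Finset.mem_range, Finset.mem_singleton] at h1 h2
        omega)
      (fun p => hS.measurable_noise p.1 p.2)
    let φ : (↥(Finset.range k ×ˢ (Finset.univ : Finset (Fin m))) → Param d) →
        ℕ → Fin m → Param d := fun s l i =>
      if hl : l < k then s ⟨(l, i), by simp [hl]⟩ else 0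
    have hφ : Measurable φ := by
      refine measurable_pi_lambda _ fun l => measurable_pi_lambda _ fun i => ?_
      by_cases hl : l < k
      · simp only [φ, dif_pos hl]; fun_prop
      · simp only [φ, dif_neg hl]; fun_prop
    let ψ : (↥(({k} : Finset ℕ) ×ˢ (Finset.univ : Finset (Fin m))) → Param d) →
        Fin m → Param d := fun s i => s ⟨(k, i), by simp⟩
    have hψ : Measurable ψ := by
      refine measurable_pi_lambda _ fun i => ?_
      simp only [ψ]; fun_prop
    have hcomp := hfin.comp hφ hψ
    convert hcomp using 1
    · funext ω l i
      simp [T, tr, φ]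
    · rfl
  have h2 : IndepFun (fun ω i j => X i j ω) (fun ω => (T ω, fun i => Z k i ω)) P :=
    hS.indep_data_noise.comp measurable_id (htr.prodMk (measurable_pi_apply k))
  have h3 := IndepFun.prodMk_left_of_prodMk_right hX hT hZk h2 h1
  have h4 : IndepFun θinit
      (fun ω => (((fun i j => X i j ω : (i : Fin m) → Fin (n i) → 𝒳), T ω), fun i => Z k i ω)) P :=
    hS.indep_init.comp measurable_id
      ((measurable_fst.prodMk (htr.comp measurable_snd)).prodMk
        ((measurable_pi_apply k).comp measurable_snd))
  exact IndepFun.prodMk_left_of_prodMk_right hinit (hX.prodMk hT) hZk h4 h3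

/-- The iterates depend on the randomness only through the initial point, the data and the noise
of the previous rounds. -/
theorem iterate_eq_of_noise_eq (k : ℕ) (ω : Ω) (z : ℕ → Fin m → Param d)
    (hz : ∀ l < k, ∀ i, z l i = Z l i ω) :
    iterate ρ n X Z θinit w η μ B K k ω =
      iterate ρ n (fun i j (s : Param d × ((i : Fin m) → Fin (n i) → 𝒳) × (ℕ → Fin m → Param d)) =>
        s.2.1 i j) (fun l i s => s.2.2 l i) (fun s => s.1) w η μ B K k
        (θinit ω, (fun i j => X i j ω, z)) := by
  induction k with
  | zero => rfl
  | succ k ih =>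
    simp only [iterate]
    rw [← ih fun l hl => hz l (hl.trans (Nat.lt_succ_self k))]
    simp only [localGrad, hz k (Nat.lt_succ_self k)]

theorem measurable_weightedGrad {g : Ω → Param d} (hg : Measurable g)
    (hρ : ∀ θ, Measurable fun x => gradient (ρ x) θ) (hρc : ∀ x, Continuous (gradient (ρ x)))
    (hX : ∀ i j, Measurable (X i j)) : Measurable fun ω => weightedGrad ρ n X w (g ω) ω := by
  have huncurry : Measurable (Function.uncurry fun θ x => gradient (ρ x) θ) :=
    measurable_uncurry_of_continuous_of_measurable hρc hρ
  unfold weightedGrad localGrad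
  refine Finset.measurable_fun_sum _ fun i _ => Measurable.fun_const_smul ?_ _
  refine Measurable.fun_const_smul (Finset.measurable_fun_sum _ fun j _ => ?_) _
  exact huncurry.comp (hg.prodMk (hX i j))

/-- The noise added in round `k` before multiplication by the step size. -/
def noiseSum (n : Fin m → ℕ) (Z : ℕ → Fin m → Ω → Param d) (w : Fin m → ℝ) (μ B : ℝ) (K k : ℕ)
    (ω : Ω) : Param d :=
  ∑ i, (w i * noiseLevel B μ K (n i)) • Z k i ω

theorem iterate_succ (k : ℕ) (ω : Ω) :
    iterate ρ n X Z θinit w η μ B K (k + 1) ω = iterate ρ n X Z θinit w η μ B K k ω -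
      η • (weightedGrad ρ n X w (iterate ρ n X Z θinit w η μ B K k ω) ω +
        noiseSum n Z w μ B K k ω) := by
  simp only [iterate, weightedGrad, noiseSum, smul_add, Finset.sum_add_distrib, smul_smul]

theorem measurable_iterate (hρ : ∀ θ, Measurable fun x => gradient (ρ x) θ)
    (hρc : ∀ x, Continuous (gradient (ρ x))) (hX : ∀ i j, Measurable (X i j))
    (hZ : ∀ k i, Measurable (Z k i)) (hinit : Measurable θinit) (k : ℕ) :
    Measurable (iterate ρ n X Z θinit w η μ B K k) := by
  induction k with
  | zero => exact hinit
  | succ k ih =>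
    have h : iterate ρ n X Z θinit w η μ B K (k + 1) = fun ω => iterate ρ n X Z θinit w η μ B K k ω -
      η • (weightedGrad ρ n X w (iterate ρ n X Z θinit w η μ B K k ω) ω +
        noiseSum n Z w μ B K k ω) := funext fun ω => iterate_succ k ω
    rw [h]
    refine ih.sub (((measurable_weightedGrad ih hρ hρc hX).add ?_).const_smul η)
    exact Finset.measurable_fun_sum _ fun i _ => (hZ k i).fun_const_smul _

/-- A noiseless gradient step is independent of the noise of the current round. -/
theorem Sampling.indepFun_gradient_step (hS : Sampling P F n X Z θinit)
    (hρ : ∀ θ, Measurable fun x => gradient (ρ x) θ) (hρc : ∀ x, Continuous (gradient (ρ x)))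
    (k : ℕ) (θ₀ : Param d) :
    IndepFun (fun ω => iterate ρ n X Z θinit w η μ B K k ω - θ₀ -
      η • weightedGrad ρ n X w (iterate ρ n X Z θinit w η μ B K k ω) ω)
      (noiseSum n Z w μ B K k) P := by
  -- Running the algorithm on the space of histories exhibits the gradient step as a measurable
  -- function of `past`, so independence of `past` from the current noise carries over.
  let S := Param d × ((i : Fin m) → Fin (n i) → 𝒳) × (ℕ → Fin m → Param d)
  let X' : (i : Fin m) → Fin (n i) → S → 𝒳 := fun i j s => s.2.1 i j
  let θ' : S → Param d := iterate ρ n X' (fun l i s => s.2.2 l i) (fun s => s.1) w η μ B K k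
  have hX' : ∀ i j, Measurable (X' i j) := fun i j => by simp only [X', S]; fun_prop
  have hθ' : Measurable θ' := measurable_iterate hρ hρc hX'
    (fun l i => by simp only [S]; fun_prop) measurable_fst k
  let φ : S → Param d := fun s => θ' s - θ₀ - η • weightedGrad ρ n X' w (θ' s) s
  have hφ : Measurable φ :=
    (hθ'.sub_const _).sub ((measurable_weightedGrad hθ' hρ hρc hX').const_smul η)
  let ψ : (Fin m → Param d) → Param d := fun z => ∑ i, (w i * noiseLevel B μ K (n i)) • z i
  have hψ : Measurable ψ :=
    Finset.measurable_fun_sum _ fun i _ => (measurable_pi_apply i).fun_const_smul _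
  have key := (hS.indepFun_past k).comp hφ hψ
  convert key using 1
  · funext ω
    have := iterate_eq_of_noise_eq (ρ := ρ) (X := X) (Z := Z) (θinit := θinit) (w := w) (η := η)
      (μ := μ) (B := B) (K := K) k ω (fun l i => if l < k then Z l i ω else 0)
      fun l hl i => if_pos hl
    simp only [this]
    rfl
  · rfl

end Independence

/-! ### Second moments of independent vectors -/

section SecondMoments

variable {Ω E : Type*} [MeasurableSpace Ω] [NormedAddCommGroup E] [InnerProductSpace ℝ E]
  [FiniteDimensional ℝ E] [MeasurableSpace E] [BorelSpace E] {P : Measure Ω}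
  [IsProbabilityMeasure P]

theorem integrable_norm_sq_of_memLp {A : Ω → E} (hA : MemLp A 2 P) :
    Integrable (fun ω => ‖A ω‖ ^ 2) P :=
  (memLp_two_iff_integrable_sq_norm hA.1).1 hA

theorem integrable_inner_of_memLp {A B : Ω → E} (hA : MemLp A 2 P) (hB : MemLp B 2 P) :
    Integrable (fun ω => inner ℝ (A ω) (B ω)) P := by
  refine Integrable.mono' ((integrable_norm_sq_of_memLp hA).add (integrable_norm_sq_of_memLp hB))
    (hA.1.inner hB.1) (Filter.Eventually.of_forall fun ω => ?_)
  have h1 := abs_real_inner_le_norm (A ω) (B ω)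
  have h2 := two_mul_le_add_sq ‖A ω‖ ‖B ω‖
  rw [Real.norm_eq_abs, Pi.add_apply]
  nlinarith [norm_nonneg (A ω), norm_nonneg (B ω)]

theorem integral_inner_eq_zero_of_indepFun {A B : Ω → E} (hA : Integrable A P) (hB : Integrable B P)
    (hAB : IndepFun A B P) (hB0 : ∫ ω, B ω ∂P = 0) : ∫ ω, inner ℝ (A ω) (B ω) ∂P = 0 := by
  have := hAB.integral_bilin hA hB (innerSL ℝ)
  rw [hB0, map_zero] at this
  exact this

theorem integral_norm_sub_sq_of_indepFun {A B : Ω → E} (hA : MemLp A 2 P) (hB : MemLp B 2 P)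
    (hAB : IndepFun A B P) (hB0 : ∫ ω, B ω ∂P = 0) :
    ∫ ω, ‖A ω - B ω‖ ^ 2 ∂P = ∫ ω, ‖A ω‖ ^ 2 ∂P + ∫ ω, ‖B ω‖ ^ 2 ∂P := by
  have h0 := integral_inner_eq_zero_of_indepFun (hA.integrable one_le_two)
    (hB.integrable one_le_two) hAB hB0
  simp only [norm_sub_sq_real]
  have hi := (integrable_inner_of_memLp hA hB).const_mul 2
  have hi' : Integrable (fun ω => ‖A ω‖ ^ 2 - 2 * inner ℝ (A ω) (B ω)) P :=
    (integrable_norm_sq_of_memLp hA).sub hi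
  rw [integral_add hi' (integrable_norm_sq_of_memLp hB),
    integral_sub (integrable_norm_sq_of_memLp hA) hi, integral_const_mul, h0, mul_zero, sub_zero]

/-- Pythagoras in `L²`: the cross terms vanish by pairwise independence and centring. -/
theorem integral_norm_sum_sq_of_indepFun {ι : Type*} [Fintype ι] {Y : ι → Ω → E} (c : ι → ℝ)
    (hY : ∀ i, MemLp (Y i) 2 P) (hind : Pairwise fun i j => IndepFun (Y i) (Y j) P)
    (h0 : ∀ i, ∫ ω, Y i ω ∂P = 0) :
    ∫ ω, ‖∑ i, c i • Y i ω‖ ^ 2 ∂P = ∑ i, c i ^ 2 * ∫ ω, ‖Y i ω‖ ^ 2 ∂P := by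
  have hexp : ∀ ω, ‖∑ i, c i • Y i ω‖ ^ 2 =
      ∑ i, ∑ j, c i * c j * inner ℝ (Y i ω) (Y j ω) := by
    intro ω
    rw [← real_inner_self_eq_norm_sq, sum_inner]
    simp only [inner_sum, real_inner_smul_left, real_inner_smul_right]
    exact Finset.sum_congr rfl fun i _ => Finset.sum_congr rfl fun j _ => by ring
  simp only [hexp]
  have hi : ∀ i j, Integrable (fun ω => c i * c j * inner ℝ (Y i ω) (Y j ω)) P := fun i j =>
    (integrable_inner_of_memLp (hY i) (hY j)).const_mul _
  rw [integral_finsetSum _ fun i _ => integrable_finsetSum _ fun j _ => hi i j]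
  refine Finset.sum_congr rfl fun i _ => ?_
  rw [integral_finsetSum _ fun j _ => hi i j, Finset.sum_eq_single i]
  · rw [integral_const_mul]
    simp only [real_inner_self_eq_norm_sq]
    ring
  · intro j _ hj
    rw [integral_const_mul, integral_inner_eq_zero_of_indepFun ((hY i).integrable one_le_two)
      ((hY j).integrable one_le_two) (hind hj.symm) (h0 j), mul_zero]
  · simp

theorem integral_norm_sq_stdGaussian (d : ℕ) :
    ∫ z, ‖z‖ ^ 2 ∂(stdGaussian (Param d)) = d := by
  have hmem : MemLp (fun z : Param d => z) 2 (stdGaussian (Param d)) :=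
    IsGaussian.memLp_two_id
  let b := EuclideanSpace.basisFun (Fin d) ℝ
  have hcoord : ∀ i, ∫ z, (inner ℝ (b i) z) ^ 2 ∂(stdGaussian (Param d)) = 1 := by
    intro i
    have h1 := variance_dual_stdGaussian (E := Param d) (innerSL ℝ (b i))
    rw [variance_of_integral_eq_zero (ContinuousLinearMap.continuous _).aemeasurable
      (integral_strongDual_stdGaussian _), innerSL_apply_norm, b.norm_eq_one, one_pow] at h1
    exact h1
  have hexp : ∀ z : Param d, ‖z‖ ^ 2 = ∑ i, (inner ℝ (b i) z) ^ 2 := fun z =>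
    (b.sum_sq_inner_right z).symm
  simp only [hexp]
  rw [integral_finsetSum]
  · simp only [hcoord, Finset.sum_const, Finset.card_univ, Fintype.card_fin, nsmul_eq_mul, mul_one]
  · intro i _
    exact (hmem.const_inner (b i)).integrable_sq

end SecondMoments

/-! ### One-round recursion for the mean squared error -/

section Recursion

variable {Ω 𝒳 : Type*} [MeasurableSpace Ω] [MeasurableSpace 𝒳] {d m : ℕ}
  {P : Measure Ω} [IsProbabilityMeasure P] {F : Measure 𝒳} [IsProbabilityMeasure F]
  {n : Fin m → ℕ} {ρ : 𝒳 → Param d → ℝ} {Θ : Set (Param d)} {θ₀ : Param d}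
  {X : (i : Fin m) → Fin (n i) → Ω → 𝒳} {Z : ℕ → Fin m → Ω → Param d} {θinit : Ω → Param d}
  {w : Fin m → ℝ} {τ₁ τ₂ C₁ C₂ W η μ B : ℝ} {K : ℕ}

theorem Sampling.memLp_noise (hS : Sampling P F n X Z θinit) (k : ℕ) (i : Fin m) :
    MemLp (Z k i) 2 P := by
  have h : MemLp (fun z : Param d => z) 2 (P.map (Z k i)) := by
    rw [hS.law_noise]; exact IsGaussian.memLp_two_id
  exact h.comp_of_map (hS.measurable_noise k i).aemeasurable

theorem Sampling.integral_noise (hS : Sampling P F n X Z θinit) (k : ℕ) (i : Fin m) :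
    ∫ ω, Z k i ω ∂P = 0 := by
  have := integral_map (μ := P) (φ := Z k i) (f := fun z => z)
    (hS.measurable_noise k i).aemeasurable aestronglyMeasurable_id
  rw [← this, hS.law_noise, integral_id_stdGaussian]

theorem Sampling.memLp_noiseSum (hS : Sampling P F n X Z θinit) (k : ℕ) :
    MemLp (noiseSum n Z w μ B K k) 2 P :=
  memLp_finsetSum _ fun i _ =>
    (hS.memLp_noise k i).const_smul (w i * noiseLevel B μ K (n i))

theorem Sampling.integral_noiseSum (hS : Sampling P F n X Z θinit) (k : ℕ) :
    ∫ ω, noiseSum n Z w μ B K k ω ∂P = 0 := by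
  unfold noiseSum
  have hi : ∀ i ∈ Finset.univ,
      Integrable (fun ω => (w i * noiseLevel B μ K (n i)) • Z k i ω) P := fun i _ =>
    ((hS.memLp_noise k i).integrable one_le_two).smul (w i * noiseLevel B μ K (n i))
  rw [integral_finsetSum _ hi]
  simp only [integral_smul, hS.integral_noise, smul_zero, Finset.sum_const_zero]

theorem Sampling.integral_norm_noiseSum_sq (hS : Sampling P F n X Z θinit) (k : ℕ) :
    ∫ ω, ‖noiseSum n Z w μ B K k ω‖ ^ 2 ∂P =
      4 * B ^ 2 * K * d / μ ^ 2 * ∑ i, w i ^ 2 / (n i : ℝ) ^ 2 := by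
  unfold noiseSum
  rw [integral_norm_sum_sq_of_indepFun _ (hS.memLp_noise k) (fun i j hij => ?_)
    (hS.integral_noise k), Finset.mul_sum]
  · refine Finset.sum_congr rfl fun i _ => ?_
    have := integral_map (μ := P) (φ := Z k i) (f := fun z => ‖z‖ ^ 2)
      (hS.measurable_noise k i).aemeasurable (by fun_prop)
    rw [← this, hS.law_noise, integral_norm_sq_stdGaussian, noiseLevel, mul_pow, div_pow, mul_pow,
      mul_pow, mul_pow, Real.sq_sqrt (Nat.cast_nonneg K)]
    ring
  · exact hS.indep_noise.indepFun (i := (k, i)) (j := (k, j)) (by simp [hij])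

theorem LossAssumptions.memLp_weightedGrad_target (hA : LossAssumptions F ρ Θ θ₀ τ₁ τ₂ C₁ C₂ W)
    (hS : Sampling P F n X Z θinit) (hC₁ : 0 < C₁) :
    MemLp (weightedGrad ρ n X w θ₀) 2 P := by
  have h : weightedGrad ρ n X w θ₀ =
      fun ω => ∑ p, obsWeight n w p • gradient (ρ (pooled X p ω)) θ₀ :=
    funext fun ω => weightedGrad_eq_sum θ₀ ω
  rw [h]
  refine memLp_finsetSum _ fun p _ => ?_
  have hg := hA.memLp_gradient hC₁ θ₀
  rw [← hS.isSample.law p] at hg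
  exact (hg.comp_of_map (hS.isSample.measurable p).aemeasurable).const_smul (obsWeight n w p)

theorem LossAssumptions.continuous_gradient (hA : LossAssumptions F ρ Θ θ₀ τ₁ τ₂ C₁ C₂ W) (x : 𝒳) :
    Continuous (gradient (ρ x)) :=
  continuous_iff_continuousAt.2 fun θ => (hA.hasFDerivAt_gradient x θ).continuousAt

/-- Comparison with the fixed point `θ₀` suffices: the increment is Lipschitz in `g`, and the
gradient at `θ₀` is square integrable. This remains valid when `g` depends on the data. -/
theorem LossAssumptions.memLp_weightedGrad (hA : LossAssumptions F ρ Θ θ₀ τ₁ τ₂ C₁ C₂ W)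
    (hS : Sampling P F n X Z θinit) (hC₁ : 0 < C₁) (hn : ∀ i, 1 ≤ n i)
    (hw : w ∈ stdSimplex ℝ (Fin m)) {g : Ω → Param d} (hgm : Measurable g) (hg : MemLp g 2 P) :
    MemLp (fun ω => weightedGrad ρ n X w (g ω) ω) 2 P := by
  have hdiff : MemLp (fun ω => weightedGrad ρ n X w (g ω) ω - weightedGrad ρ n X w θ₀ ω) 2 P := by
    refine MemLp.of_le_mul (c := τ₂) (hg.sub (memLp_const θ₀)) ?_
      (Filter.Eventually.of_forall fun ω => hA.norm_weightedGrad_sub_le hC₁ hn hw _ _ ω)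
    exact ((measurable_weightedGrad hgm hA.measurable_gradient hA.continuous_gradient
      hS.measurable_data).sub (measurable_weightedGrad measurable_const hA.measurable_gradient
        hA.continuous_gradient hS.measurable_data)).aestronglyMeasurable
  refine MemLp.ae_eq (Filter.Eventually.of_forall fun ω => ?_)
    (hdiff.add (hA.memLp_weightedGrad_target (w := w) hS hC₁))
  simp

theorem LossAssumptions.measurable_iterate (hA : LossAssumptions F ρ Θ θ₀ τ₁ τ₂ C₁ C₂ W)
    (hS : Sampling P F n X Z θinit) (k : ℕ) :
    Measurable (iterate ρ n X Z θinit w η μ B K k) :=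
  FedSGD.measurable_iterate hA.measurable_gradient hA.continuous_gradient hS.measurable_data
    hS.measurable_noise hS.measurable_init k

theorem LossAssumptions.memLp_iterate (hA : LossAssumptions F ρ Θ θ₀ τ₁ τ₂ C₁ C₂ W)
    (hS : Sampling P F n X Z θinit) (hC₁ : 0 < C₁) (hn : ∀ i, 1 ≤ n i)
    (hw : w ∈ stdSimplex ℝ (Fin m)) (hinit : MemLp θinit 2 P) (k : ℕ) :
    MemLp (iterate ρ n X Z θinit w η μ B K k) 2 P := by
  induction k with
  | zero => exact hinit
  | succ k ih =>
    refine MemLp.ae_eq (Filter.Eventually.of_forall fun ω => (iterate_succ k ω).symm)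
      (ih.sub (((hA.memLp_weightedGrad hS hC₁ hn hw (hA.measurable_iterate hS k) ih).add
        (hS.memLp_noiseSum k)).const_smul η))

theorem norm_sub_sq_le_weighted {E : Type*} [NormedAddCommGroup E] [InnerProductSpace ℝ E] (x y : E)
    {a : ℝ} (ha : 0 < a) : ‖x - y‖ ^ 2 ≤ (1 + a) * ‖x‖ ^ 2 + (1 + a⁻¹) * ‖y‖ ^ 2 := by
  have h1 : ‖x - y‖ ^ 2 ≤ (‖x‖ + ‖y‖) ^ 2 := by gcongr; exact norm_sub_le x y
  have h2 : 2 * (‖x‖ * ‖y‖) ≤ a * ‖x‖ ^ 2 + a⁻¹ * ‖y‖ ^ 2 := by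
    have h3 : 0 ≤ a⁻¹ * (a * ‖x‖ - ‖y‖) ^ 2 := by positivity
    have h4 : a⁻¹ * (a * ‖x‖ - ‖y‖) ^ 2 = a * ‖x‖ ^ 2 - 2 * (‖x‖ * ‖y‖) + a⁻¹ * ‖y‖ ^ 2 := by
      field_simp
      ring
    linarith
  linarith

/-- The mean squared error after one more round. -/
theorem LossAssumptions.integral_norm_iterate_succ_le
    (hA : LossAssumptions F ρ Θ θ₀ τ₁ τ₂ C₁ C₂ W)
    (hS : Sampling P F n X Z θinit) (hC₁ : 0 < C₁) (hn : ∀ i, 1 ≤ n i)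
    (hw : w ∈ stdSimplex ℝ (Fin m)) (hinit : MemLp θinit 2 P) {S : Ω → ℝ} {γ s a : ℝ} (ha : 0 < a)
    (hSint : Integrable S P) (hSle : ∫ ω, S ω ∂P ≤ s)
    (hstep : ∀ᵐ ω ∂P, ∀ θ,
      ‖(θ - θ₀) - η • (weightedGrad ρ n X w θ ω - weightedGrad ρ n X w θ₀ ω)‖ ^ 2 ≤
        γ ^ 2 * ‖θ - θ₀‖ ^ 2 + 4 * S ω) (k : ℕ) :
    ∫ ω, ‖iterate ρ n X Z θinit w η μ B K (k + 1) ω - θ₀‖ ^ 2 ∂P ≤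
      (1 + a) * γ ^ 2 * ∫ ω, ‖iterate ρ n X Z θinit w η μ B K k ω - θ₀‖ ^ 2 ∂P +
        ((1 + a) * (4 * s) + (1 + a⁻¹) * (η ^ 2 * ∫ ω, ‖weightedGrad ρ n X w θ₀ ω‖ ^ 2 ∂P) +
          η ^ 2 * (4 * B ^ 2 * K * d / μ ^ 2 * ∑ i, w i ^ 2 / (n i : ℝ) ^ 2)) := by
  set θk := iterate ρ n X Z θinit w η μ B K k with hθk
  have hθkm : Measurable θk := hA.measurable_iterate hS k
  have hθkL : MemLp θk 2 P := hA.memLp_iterate hS hC₁ hn hw hinit k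
  have hgk := hA.memLp_weightedGrad hS hC₁ hn hw hθkm hθkL
  have hg0 := hA.memLp_weightedGrad_target (w := w) hS hC₁
  have he : MemLp (fun ω => θk ω - θ₀) 2 P := hθkL.sub (memLp_const θ₀)
  have hu : MemLp (fun ω => θk ω - θ₀ - η • weightedGrad ρ n X w (θk ω) ω) 2 P :=
    he.sub (hgk.const_smul η)
  have hξ : MemLp (fun ω => η • noiseSum n Z w μ B K k ω) 2 P := (hS.memLp_noiseSum k).const_smul η
  have hindep : IndepFun (fun ω => θk ω - θ₀ - η • weightedGrad ρ n X w (θk ω) ω)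
      (fun ω => η • noiseSum n Z w μ B K k ω) P :=
    (hS.indepFun_gradient_step hA.measurable_gradient hA.continuous_gradient k θ₀).comp
      measurable_id (measurable_const_smul η)
  -- The fresh noise is centred and independent of the noiseless step, so its variance enters
  -- without a Young factor.
  have hsplit : ∫ ω, ‖iterate ρ n X Z θinit w η μ B K (k + 1) ω - θ₀‖ ^ 2 ∂P =
      ∫ ω, ‖θk ω - θ₀ - η • weightedGrad ρ n X w (θk ω) ω‖ ^ 2 ∂P +
        ∫ ω, ‖η • noiseSum n Z w μ B K k ω‖ ^ 2 ∂P := by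
    rw [← integral_norm_sub_sq_of_indepFun hu hξ hindep
      (by rw [integral_smul, hS.integral_noiseSum, smul_zero])]
    refine integral_congr_ae (Filter.Eventually.of_forall fun ω => ?_)
    simp only [iterate_succ, ← hθk]
    congr 2
    rw [smul_add]
    abel
  have hnoise : ∫ ω, ‖η • noiseSum n Z w μ B K k ω‖ ^ 2 ∂P =
      η ^ 2 * (4 * B ^ 2 * K * d / μ ^ 2 * ∑ i, w i ^ 2 / (n i : ℝ) ^ 2) := by
    rw [← hS.integral_norm_noiseSum_sq k, ← integral_const_mul]
    refine integral_congr_ae (Filter.Eventually.of_forall fun ω => ?_)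
    simp only [norm_smul, mul_pow, Real.norm_eq_abs, sq_abs]
  have hdet : ∫ ω, ‖θk ω - θ₀ - η • weightedGrad ρ n X w (θk ω) ω‖ ^ 2 ∂P ≤
      (1 + a) * (γ ^ 2 * ∫ ω, ‖θk ω - θ₀‖ ^ 2 ∂P + 4 * ∫ ω, S ω ∂P) +
        (1 + a⁻¹) * (η ^ 2 * ∫ ω, ‖weightedGrad ρ n X w θ₀ ω‖ ^ 2 ∂P) := by
    have hi1 := (integrable_norm_sq_of_memLp he).const_mul (γ ^ 2)
    have hi2 := hSint.const_mul 4
    have hi3 := (integrable_norm_sq_of_memLp hg0).const_mul (η ^ 2)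
    have hi4 : Integrable (fun ω => (1 + a) * (γ ^ 2 * ‖θk ω - θ₀‖ ^ 2 + 4 * S ω)) P :=
      (hi1.add hi2).const_mul _
    have hi5 := hi3.const_mul (1 + a⁻¹)
    rw [← integral_const_mul, ← integral_const_mul, ← integral_const_mul, ← integral_add hi1 hi2,
      ← integral_const_mul, ← integral_const_mul, ← integral_add hi4 hi5]
    refine integral_mono_ae (integrable_norm_sq_of_memLp hu) (hi4.add hi5) ?_
    filter_upwards [hstep] with ω hω
    -- The gradient at `θ₀` uses the same data as the iterate, so a cross term cannot be dropped;
    -- Young's inequality with the free parameter `a` replaces it.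
    have h1 := norm_sub_sq_le_weighted
      ((θk ω - θ₀) - η • (weightedGrad ρ n X w (θk ω) ω - weightedGrad ρ n X w θ₀ ω))
      (η • weightedGrad ρ n X w θ₀ ω) ha
    have h2 : (θk ω - θ₀) - η • (weightedGrad ρ n X w (θk ω) ω - weightedGrad ρ n X w θ₀ ω) -
        η • weightedGrad ρ n X w θ₀ ω = θk ω - θ₀ - η • weightedGrad ρ n X w (θk ω) ω := by
      rw [smul_sub]; abel
    rw [h2, norm_smul η, mul_pow, Real.norm_eq_abs, sq_abs] at h1
    refine h1.trans ?_
    have := hω (θk ω)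
    gcongr
  rw [hsplit, hnoise]
  have h3 : (1 + a) * (4 * ∫ ω, S ω ∂P) ≤ (1 + a) * (4 * s) := by gcongr
  linarith

end Recursion

/-! ### Variance of the weighted gradient at the target -/

section Trace

variable {Ω 𝒳 : Type*} [MeasurableSpace Ω] [MeasurableSpace 𝒳] {d m : ℕ}
  {P : Measure Ω} [IsProbabilityMeasure P] {F : Measure 𝒳} [IsProbabilityMeasure F]
  {n : Fin m → ℕ} {ρ : 𝒳 → Param d → ℝ} {Θ : Set (Param d)} {θ₀ : Param d}
  {X : (i : Fin m) → Fin (n i) → Ω → 𝒳} {Z : ℕ → Fin m → Ω → Param d} {θinit : Ω → Param d}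
  {w : Fin m → ℝ} {τ₁ τ₂ C₁ C₂ W : ℝ}

/-- The gradient at `θ₀` has mean zero, so the trace of its covariance is its full second moment. -/
theorem LossAssumptions.gradCovTrace_eq (hA : LossAssumptions F ρ Θ θ₀ τ₁ τ₂ C₁ C₂ W)
    (hC₁ : 0 < C₁) : gradCovTrace F ρ θ₀ = ∫ x, ‖gradient (ρ x) θ₀‖ ^ 2 ∂F := by
  have hL := hA.memLp_gradient hC₁ θ₀
  have hcoord : ∀ a, ∫ x, gradient (ρ x) θ₀ a ∂F = 0 := by
    intro a
    have h := (EuclideanSpace.proj (𝕜 := ℝ) a).integral_comp_comm (hL.integrable one_le_two)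
    rw [hA.integral_gradient_eq_zero hC₁, map_zero] at h
    exact h
  have hLa : ∀ a, MemLp (fun x => gradient (ρ x) θ₀ a) 2 F := fun a =>
    (EuclideanSpace.proj (𝕜 := ℝ) a).comp_memLp' hL
  simp only [gradCovTrace, Matrix.trace, Matrix.diag_apply, Matrix.of_apply, covariance, hcoord,
    sub_zero, EuclideanSpace.real_norm_sq_eq]
  rw [integral_finsetSum _ fun a _ => (hLa a).integrable_sq]
  simp only [sq]

theorem LossAssumptions.integral_norm_weightedGrad_sq
    (hA : LossAssumptions F ρ Θ θ₀ τ₁ τ₂ C₁ C₂ W) (hS : Sampling P F n X Z θinit) (hC₁ : 0 < C₁) :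
    ∫ ω, ‖weightedGrad ρ n X w θ₀ ω‖ ^ 2 ∂P =
      gradCovTrace F ρ θ₀ * ∑ i, w i ^ 2 / (n i : ℝ) := by
  have hY := hS.isSample
  have hg := hA.measurable_gradient θ₀
  have hL := hA.memLp_gradient hC₁ θ₀
  simp only [weightedGrad_eq_sum]
  rw [integral_norm_sum_sq_of_indepFun (Y := fun p ω => gradient (ρ (pooled X p ω)) θ₀)
    (obsWeight n w) (fun p => ?_) (fun p q hpq => ?_) (fun p => ?_), ← sum_obsWeight_sq,
    hA.gradCovTrace_eq hC₁, Finset.mul_sum]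
  · refine Finset.sum_congr rfl fun p _ => ?_
    have := integral_map (μ := P) (φ := pooled X p) (f := fun x => ‖gradient (ρ x) θ₀‖ ^ 2)
      (hY.measurable p).aemeasurable (hg.norm.pow_const 2).aestronglyMeasurable
    rw [← this, hY.law p, mul_comm]
  · rw [← hY.law p] at hL
    exact hL.comp_of_map (hY.measurable p).aemeasurable
  · exact (hY.indep.indepFun hpq).comp hg hg
  · rw [← integral_map (f := fun x => gradient (ρ x) θ₀) (hY.measurable p).aemeasurable
      hg.aestronglyMeasurable, hY.law p, hA.integral_gradient_eq_zero hC₁]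

end Trace

/-! ### Solving the recursion -/

section Convergence

theorem le_geometric_of_affine_recursion {u : ℕ → ℝ} {Q c : ℝ} (hQ0 : 0 ≤ Q) (hQ1 : Q < 1)
    (hc : 0 ≤ c) (h : ∀ k, u (k + 1) ≤ Q * u k + c) (k : ℕ) :
    u k ≤ Q ^ k * u 0 + c / (1 - Q) := by
  have h1 : 0 < 1 - Q := by linarith
  induction k with
  | zero =>
    have : 0 ≤ c / (1 - Q) := by positivity
    simpa using this
  | succ k ih =>
    calc u (k + 1) ≤ Q * u k + c := h k
      _ ≤ Q * (Q ^ k * u 0 + c / (1 - Q)) + c := by gcongr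
      _ = Q ^ (k + 1) * u 0 + c / (1 - Q) := by field_simp; ring

/-- Optimizing the weight `a` in the error recursion. -/
theorem error_le_of_weighted_recursion {u : ℕ → ℝ} {x q β ν : ℝ} (hx0 : 0 < x) (hx1 : x ≤ 9 / 10)
    (hq : 1 - 2 / 3 * x ≤ q) (hβ : 0 ≤ β) (hν : 0 ≤ ν) (hu : ∀ k, 0 ≤ u k)
    (h : ∀ a : ℝ, 0 < a → ∀ k, u (k + 1) ≤ (1 + a) * (1 - 99 / 100 * x) ^ 2 * u k +
      ((1 + a) * (ν / 1000) + (1 + a⁻¹) * β + ν)) (k : ℕ) :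
    u k ≤ q ^ (2 * k) * u 0 + 4 / x ^ 2 * (β + ν / 4) := by
  set g := (1 - 99 / 100 * x) ^ 2 with hg
  set Q := (1 - 2 / 3 * x) ^ 2 with hQ
  have hg0 : 0 < g := by
    have : 0 < 1 - 99 / 100 * x := by linarith
    positivity
  have hdiff : Q - g = x * ((97 / 300) * (2 - (497 / 300) * x)) := by rw [hQ, hg]; ring
  have hQg : 0 < Q - g := by
    rw [hdiff]
    have : 0 < 2 - (497 / 300) * x := by linarith
    positivity
  have hQ1 : 1 - Q = x * (4 / 3 * (1 - x / 3)) := by rw [hQ]; ring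
  have hQ1pos : 0 < 1 - Q := by
    rw [hQ1]
    have : 0 < 1 - x / 3 := by linarith
    positivity
  have hQ0 : 0 < Q := by linarith
  -- With this `a` one has `(1 + a) g = Q`: Young's inequality relaxes the contraction factor from
  -- `1 - 0.99x` to `1 - 2x/3`. The gap `Q - g` is of order `x`, so `β` is multiplied by a constant
  -- over `x`, and the geometric sum contributes the second `1/x`.
  have ha : 0 < (Q - g) / g := by positivity
  have h1a : 1 + (Q - g) / g = Q / g := by field_simp; ring
  have h1a' : 1 + ((Q - g) / g)⁻¹ = Q / (Q - g) := by field_simp; ring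
  have hrec := h _ ha
  rw [h1a, h1a', div_mul_cancel₀ _ hg0.ne'] at hrec
  -- The worst case is `x = 9/10`, where the ratio is about `13.5`; hence the factor `1 + 14/1000`
  -- for `ν` below.
  have h14 : Q / g ≤ 14 := by
    rw [div_le_iff₀ hg0, hQ, hg]
    nlinarith
  have hc0 : 0 ≤ Q / g * (ν / 1000) + Q / (Q - g) * β + ν := by positivity
  have hgeo := le_geometric_of_affine_recursion hQ0.le (by linarith) hc0 hrec k
  have hQq : Q ^ k ≤ q ^ (2 * k) := by
    rw [pow_mul]
    have h0 : 0 ≤ 1 - 2 / 3 * x := by linarith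
    have h1 : Q ≤ q ^ 2 := by rw [hQ]; gcongr
    gcongr
  have hνb : (Q / g * (ν / 1000) + ν) / (1 - Q) ≤ ν / x ^ 2 := by
    rw [div_le_div_iff₀ hQ1pos (by positivity), hQ1]
    have h2 : Q / g * (ν / 1000) + ν ≤ (1014 / 1000) * ν := by nlinarith
    have h3 : 1014 / 1000 * x ≤ 4 / 3 * (1 - x / 3) := by linarith
    calc (Q / g * (ν / 1000) + ν) * x ^ 2 ≤ (1014 / 1000) * ν * x ^ 2 := by gcongr
      _ = ν * (x * (1014 / 1000 * x)) := by ring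
      _ ≤ ν * (x * (4 / 3 * (1 - x / 3))) := by gcongr
  have hβb : Q / (Q - g) * β / (1 - Q) ≤ 4 / x ^ 2 * β := by
    have h2 : Q / (Q - g) / (1 - Q) ≤ 4 / x ^ 2 := by
      rw [div_div, div_le_div_iff₀ (by positivity) (by positivity), hdiff, hQ1]
      have h3 : Q ≤ 4 * (((97 / 300) * (2 - (497 / 300) * x)) * (4 / 3 * (1 - x / 3))) := by
        rw [hQ]; nlinarith
      calc Q * x ^ 2 ≤
          4 * (((97 / 300) * (2 - (497 / 300) * x)) * (4 / 3 * (1 - x / 3))) * x ^ 2 := by gcongr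
        _ = _ := by ring
    calc Q / (Q - g) * β / (1 - Q) = Q / (Q - g) / (1 - Q) * β := by ring
      _ ≤ _ := by gcongr
  have hQu := mul_le_mul_of_nonneg_right hQq (hu 0)
  have hsplit : (Q / g * (ν / 1000) + Q / (Q - g) * β + ν) / (1 - Q) =
      (Q / g * (ν / 1000) + ν) / (1 - Q) + Q / (Q - g) * β / (1 - Q) := by ring
  have hfin : 4 / x ^ 2 * (β + ν / 4) = 4 / x ^ 2 * β + ν / x ^ 2 := by ring
  rw [hsplit] at hgeo
  rw [hfin]
  linarith

/-- How small `(d ∨ log N) ∑ wᵢ² / nᵢ` has to be for the error bound to hold. -/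
def smallness (τ₁ τ₂ C₁ CB μbar : ℝ) : ℝ :=
  min ((τ₁ / (11200 * τ₂)) ^ 2) (CB ^ 2 / (72900 * C₁ ^ 2 * μbar ^ 2))

theorem smallness_pos {τ₁ τ₂ C₁ CB μbar : ℝ} (hτ₁ : 0 < τ₁) (hτ₂ : 0 < τ₂) (hC₁ : 0 < C₁)
    (hCB : 0 < CB) (hμbar : 0 < μbar) : 0 < smallness τ₁ τ₂ C₁ CB μbar :=
  lt_min (by positivity) (by positivity)

variable {Ω 𝒳 : Type*} [MeasurableSpace Ω] [MeasurableSpace 𝒳] {d m : ℕ}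
  {P : Measure Ω} [IsProbabilityMeasure P] {F : Measure 𝒳} [IsProbabilityMeasure F]
  {n : Fin m → ℕ} {ρ : 𝒳 → Param d → ℝ} {Θ : Set (Param d)} {θ₀ : Param d}
  {X : (i : Fin m) → Fin (n i) → Ω → 𝒳} {Z : ℕ → Fin m → Ω → Param d} {θinit : Ω → Param d}
  {w : Fin m → ℝ} {τ₁ τ₂ C₁ C₂ W CB μbar η μ : ℝ} {K : ℕ}

theorem one_le_totalSize_mul_sum (hn : ∀ i, 1 ≤ n i) (hw : w ∈ stdSimplex ℝ (Fin m)) :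
    1 ≤ (totalSize n : ℝ) * ∑ i, w i ^ 2 / (n i : ℝ) := by
  rw [← sum_obsWeight_sq, ← card_pooled]
  exact one_le_card_mul_sum_sq (sum_obsWeight hn hw)

/-- This keeps the privacy noise at order at least `N^{-2}` for every choice of weights, enough to
absorb the mean of the random radius. -/
theorem one_le_totalSize_sq_mul_sum (hn : ∀ i, 1 ≤ n i) (hw : w ∈ stdSimplex ℝ (Fin m)) :
    1 ≤ (totalSize n : ℝ) ^ 2 * ∑ i, w i ^ 2 / (n i : ℝ) ^ 2 := by
  have h1 : (∑ i, w i) ^ 2 ≤ (∑ i, (n i : ℝ) ^ 2) * ∑ i, w i ^ 2 / (n i : ℝ) ^ 2 := by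
    refine Finset.sum_sq_le_sum_mul_sum_of_sq_le_mul _ (fun i _ => by positivity)
      (fun i _ => by positivity) fun i _ => ?_
    have : (n i : ℝ) ≠ 0 := by have := hn i; positivity
    refine le_of_eq ?_
    field_simp
  have h2 : ∑ i, (n i : ℝ) ^ 2 ≤ (totalSize n : ℝ) ^ 2 := by
    rw [totalSize]
    push_cast
    exact Finset.sum_sq_le_sq_sum_of_nonneg fun i _ => Nat.cast_nonneg _
  rw [hw.2, one_pow] at h1
  exact h1.trans (by gcongr)

theorem LossAssumptions.integral_norm_iterate_le (hA : LossAssumptions F ρ Θ θ₀ τ₁ τ₂ C₁ C₂ W)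
    (hS : Sampling P F n X Z θinit) (hτ₁ : 0 < τ₁) (hτ₂ : 0 < τ₂) (hC₁ : 0 < C₁) (hCB : 0 < CB)
    (hμbar : 0 < μbar) (hd : 1 ≤ d) (hn : ∀ i, 1 ≤ n i) (hw : w ∈ stdSimplex ℝ (Fin m))
    (hinit : MemLp θinit 2 P) (hη₁ : 1 / (2 * τ₂) ≤ η) (hη₂ : η ≤ 9 / (10 * τ₂)) (hμ : 0 < μ)
    (hμle : μ ≤ μbar) (hK : 1 ≤ K)
    (hsmall : dimLog d (totalSize n) * ∑ i, w i ^ 2 / (n i : ℝ) ≤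
      smallness τ₁ τ₂ C₁ CB μbar) (k : ℕ) :
    ∫ ω, ‖iterate ρ n X Z θinit w η μ (CB * √(dimLog d (totalSize n))) K k ω - θ₀‖ ^ 2 ∂P ≤
      (1 - τ₁ / (3 * τ₂)) ^ (2 * k) * ∫ ω, ‖θinit ω - θ₀‖ ^ 2 ∂P +
        4 / (η * τ₁) ^ 2 * (η ^ 2 * ∫ ω, ‖weightedGrad ρ n X w θ₀ ω‖ ^ 2 ∂P +
          η ^ 2 * CB ^ 2 * K * d * dimLog d (totalSize n) / μ ^ 2 *
            ∑ i, w i ^ 2 / (n i : ℝ) ^ 2) := by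
  have hτ := hA.tau_le hd
  set D := dimLog d (totalSize n) with hD
  set v := ∑ i, w i ^ 2 / (n i : ℝ) with hv
  set s₂ := ∑ i, w i ^ 2 / (n i : ℝ) ^ 2 with hs₂
  set N : ℝ := ((totalSize n : ℕ) : ℝ) with hN
  have hd' : (1 : ℝ) ≤ d := by exact_mod_cast hd
  have hdD : (d : ℝ) ≤ D := le_max_left _ _
  have hD1 : 1 ≤ D := hd'.trans hdD
  have hη0 : 0 < η := lt_of_lt_of_le (by positivity) hη₁
  have hητ₂ : η * τ₂ ≤ 9 / 10 := by
    rw [le_div_iff₀ (by positivity)] at hη₂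
    linarith
  have hητ₁ : η * τ₁ ≤ 9 / 10 := (mul_le_mul_of_nonneg_left hτ hη0.le).trans hητ₂
  -- From `η ≥ 1/(2τ₂)`; it converts the rate `1 - (2/3) ητ₁` into `1 - τ₁/(3τ₂)`.
  have hηlow : τ₁ / τ₂ ≤ 2 * (η * τ₁) := by
    rw [div_le_iff₀ (by positivity)] at hη₁
    rw [div_le_iff₀ hτ₂]
    nlinarith
  have hNv : 1 ≤ N * v := one_le_totalSize_mul_sum hn hw
  have hNs : 1 ≤ N ^ 2 * s₂ := one_le_totalSize_sq_mul_sum hn hw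
  have hv0 : 0 ≤ v := Finset.sum_nonneg fun i _ => by positivity
  have hN0 : 0 < N := by
    have : 0 ≤ N := Nat.cast_nonneg _
    rcases this.eq_or_lt with h | h
    · rw [← h, zero_mul] at hNv; linarith
    · exact h
  -- Since `v ≥ 1/N`, smallness of `D v` alone forces `N` to be large, in particular `N ≥ d`.
  have hDN : D ≤ smallness τ₁ τ₂ C₁ CB μbar * N := by
    calc D ≤ D * (N * v) := le_mul_of_one_le_right (by linarith) hNv
      _ = D * v * N := by ring
      _ ≤ _ := by gcongr
  have hs1 : smallness τ₁ τ₂ C₁ CB μbar ≤ (τ₁ / (11200 * τ₂)) ^ 2 := min_le_left _ _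
  have hs2 : smallness τ₁ τ₂ C₁ CB μbar ≤ CB ^ 2 / (72900 * C₁ ^ 2 * μbar ^ 2) := min_le_right _ _
  have hdN : d ≤ totalSize n := by
    have h1 : τ₁ / (11200 * τ₂) ≤ 1 := (div_le_one (by positivity)).2 (by linarith)
    have h2 : (τ₁ / (11200 * τ₂)) ^ 2 ≤ 1 := pow_le_one₀ (by positivity) h1
    have h3 : D ≤ 1 * N := hDN.trans (by gcongr; exact hs1.trans h2)
    have h4 : (d : ℝ) ≤ totalSize n := by linarith
    exact_mod_cast h4
  -- The `90` makes `8b²/N²` at most a thousandth of the noise variance, as `8/8100 < 1/1000`. The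
  -- envelope's requirement on `b² N` then gives `72900 = 9 · 90²` in `smallness`.
  set b : ℝ := CB / (90 * τ₂ * μbar) with hb
  have hb0 : 0 < b := by positivity
  have hNb : 9 ≤ τ₂ ^ 2 / C₁ ^ 2 * b ^ 2 * N := by
    have h1 : 1 ≤ CB ^ 2 / (72900 * C₁ ^ 2 * μbar ^ 2) * N :=
      (hD1.trans hDN).trans (by gcongr)
    have h2 : τ₂ ^ 2 / C₁ ^ 2 * b ^ 2 * N = 9 * (CB ^ 2 / (72900 * C₁ ^ 2 * μbar ^ 2) * N) := by
      rw [hb]; field_simp; norm_num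
    linarith
  have hε : √(D * v) ≤ τ₁ / (11200 * τ₂) :=
    Real.sqrt_le_iff.2 ⟨by positivity, hsmall.trans hs1⟩
  -- The constant `11200 = 112 · 100` in `smallness` makes the empirical perturbation one percent of
  -- the contraction.
  have hγ : 1 - η * τ₁ + η * (112 * τ₂ * √(D * v)) ≤ 1 - 99 / 100 * (η * τ₁) := by
    have h1 : 112 * τ₂ * √(D * v) ≤ 112 * τ₂ * (τ₁ / (11200 * τ₂)) := by gcongr
    have h2 : 112 * τ₂ * (τ₁ / (11200 * τ₂)) = τ₁ / 100 := by field_simp; norm_num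
    have h3 := mul_le_mul_of_nonneg_left (h1.trans_eq h2) hη0.le
    linarith
  obtain ⟨S, hSint, -, hSle, hstep⟩ := hA.exists_gradient_step_bound hS hτ₂ hC₁ hn hw hd hdN hb0
    hNb hη0.le (by linarith) (by linarith) hγ
  set ν := η ^ 2 * (4 * (CB * √D) ^ 2 * K * d / μ ^ 2 * s₂) with hν
  have hB2 : (CB * √D) ^ 2 = CB ^ 2 * D := by rw [mul_pow, Real.sq_sqrt (by linarith)]
  have hs₂0 : 0 ≤ s₂ := Finset.sum_nonneg fun i _ => by positivity
  have hν0 : 0 ≤ ν := by positivity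
  -- This step needs `K ≥ 1`: with `K = 0` the noise level is zero and nothing can be absorbed.
  have hνlow : 8 * b ^ 2 / N ^ 2 ≤ ν / 1000 := by
    have hK' : (1 : ℝ) ≤ K := by exact_mod_cast hK
    have h1 : 1 / (2 * τ₂) ^ 2 ≤ η ^ 2 := by
      rw [← one_div_pow]; gcongr
    have h2 : 4 * CB ^ 2 / μbar ^ 2 ≤ 4 * (CB * √D) ^ 2 * K * d / μ ^ 2 := by
      rw [hB2]
      have h5 : 4 * CB ^ 2 ≤ 4 * (CB ^ 2 * D) * K * d := by
        calc 4 * CB ^ 2 = 4 * (CB ^ 2 * 1) * 1 * 1 := by ring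
          _ ≤ _ := by gcongr
      gcongr
    have h3 : 1 / N ^ 2 ≤ s₂ := by
      rw [div_le_iff₀ (by positivity)]; linarith
    calc 8 * b ^ 2 / N ^ 2 ≤ (1 / (2 * τ₂) ^ 2 * (4 * CB ^ 2 / μbar ^ 2 * (1 / N ^ 2))) / 1000 := by
          rw [hb]
          have h6 : 8 * (CB / (90 * τ₂ * μbar)) ^ 2 / N ^ 2 =
              (8 / 8100) * (CB ^ 2 / (τ₂ ^ 2 * μbar ^ 2 * N ^ 2)) := by
            field_simp; norm_num
          have h7 : (1 / (2 * τ₂) ^ 2 * (4 * CB ^ 2 / μbar ^ 2 * (1 / N ^ 2))) / 1000 =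
              (1 / 1000) * (CB ^ 2 / (τ₂ ^ 2 * μbar ^ 2 * N ^ 2)) := by
            field_simp; norm_num
          rw [h6, h7]
          exact mul_le_mul_of_nonneg_right (by norm_num) (by positivity)
      _ ≤ ν / 1000 := by rw [hν]; gcongr
  have hβ0 : 0 ≤ η ^ 2 * ∫ ω, ‖weightedGrad ρ n X w θ₀ ω‖ ^ 2 ∂P :=
    mul_nonneg (sq_nonneg _) (integral_nonneg fun ω => sq_nonneg _)
  have hqx : 1 - 2 / 3 * (η * τ₁) ≤ 1 - τ₁ / (3 * τ₂) := by
    have : τ₁ / (3 * τ₂) = τ₁ / τ₂ / 3 := by field_simp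
    rw [this]
    linarith
  have key := error_le_of_weighted_recursion
    (u := fun k => ∫ ω, ‖iterate ρ n X Z θinit w η μ (CB * √D) K k ω - θ₀‖ ^ 2 ∂P)
    (by positivity : 0 < η * τ₁) hητ₁ hqx hβ0 hν0 (fun k => integral_nonneg fun ω => sq_nonneg _)
    (fun a ha k => by
      have h1 := hA.integral_norm_iterate_succ_le (η := η) (μ := μ) (B := CB * √D) (K := K) hS hC₁
        hn hw hinit ha hSint hSle hstep k
      refine h1.trans ?_
      have h2 : 4 * (2 * b ^ 2 / N ^ 2) ≤ ν / 1000 := by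
        refine le_of_eq_of_le ?_ hνlow
        ring
      gcongr) k
  refine key.trans (le_of_eq ?_)
  congr 3
  rw [hν, hB2]
  ring

end Convergence

/-! ### Inverse-variance weights and effective sample size -/

section Weights

variable {m : ℕ} {n : Fin m → ℕ}

theorem minSize_le (i : Fin m) : minSize n ≤ n i := ciInf_le (OrderBot.bddBelow _) i

theorem le_totalSize (i : Fin m) : n i ≤ totalSize n :=
  Finset.single_le_sum (f := n) (fun _ _ => Nat.zero_le _) (Finset.mem_univ i)

theorem sum_sq_div_le_inv_minSize {w : Fin m → ℝ} (hn : 0 < minSize n)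
    (hw : w ∈ stdSimplex ℝ (Fin m)) : ∑ i, w i ^ 2 / (n i : ℝ) ≤ 1 / minSize n := by
  have hn' : (0 : ℝ) < minSize n := by exact_mod_cast hn
  calc ∑ i, w i ^ 2 / (n i : ℝ) ≤ ∑ i, w i / minSize n := by
        refine Finset.sum_le_sum fun i _ => ?_
        have h1 : (minSize n : ℝ) ≤ n i := by exact_mod_cast minSize_le i
        have h2 : w i ≤ 1 := hw.2 ▸ Finset.single_le_sum (fun j _ => hw.1 j) (Finset.mem_univ i)
        have h3 : w i ^ 2 ≤ w i := by nlinarith [hw.1 i]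
        have := hw.1 i
        gcongr
    _ = 1 / minSize n := by rw [← Finset.sum_div, hw.2]

variable {V : Fin m → ℝ}

theorem sum_inv_pos (hm : 1 ≤ m) (hV : ∀ i, 0 < V i) : 0 < ∑ i, (V i)⁻¹ :=
  Finset.sum_pos (fun i _ => inv_pos.2 (hV i)) ⟨⟨0, hm⟩, Finset.mem_univ _⟩

theorem invWeights_mem (hm : 1 ≤ m) (hV : ∀ i, 0 < V i) :
    invWeights V ∈ stdSimplex ℝ (Fin m) := by
  have h := sum_inv_pos hm hV
  refine ⟨fun i => div_nonneg (inv_nonneg.2 (hV i).le) h.le, ?_⟩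
  simp only [invWeights]
  rw [← Finset.sum_div, div_self h.ne']

theorem sum_invWeights_sq_mul (hm : 1 ≤ m) (hV : ∀ i, 0 < V i) :
    ∑ i, invWeights V i ^ 2 * V i = (∑ i, (V i)⁻¹)⁻¹ := by
  have h := sum_inv_pos hm hV
  have h1 : ∀ i, invWeights V i ^ 2 * V i = (V i)⁻¹ / (∑ i, (V i)⁻¹) ^ 2 := fun i => by
    have := (hV i).ne'
    rw [invWeights]
    field_simp
  simp only [h1]
  rw [← Finset.sum_div]
  field_simp

/-- Cauchy–Schwarz for `wᵢ = Vᵢ^{-1/2} · (wᵢ Vᵢ^{1/2})`. -/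
theorem inv_sum_inv_le (hm : 1 ≤ m) (hV : ∀ i, 0 < V i) {w : Fin m → ℝ}
    (hw : w ∈ stdSimplex ℝ (Fin m)) : (∑ i, (V i)⁻¹)⁻¹ ≤ ∑ i, w i ^ 2 * V i := by
  have h := sum_inv_pos hm hV
  have h1 : (∑ i, w i) ^ 2 ≤ (∑ i, (V i)⁻¹) * ∑ i, w i ^ 2 * V i := by
    refine Finset.sum_sq_le_sum_mul_sum_of_sq_le_mul _ (fun i _ => (inv_pos.2 (hV i)).le)
      (fun i _ => mul_nonneg (sq_nonneg _) (hV i).le) fun i _ => ?_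
    have := (hV i).ne'
    refine le_of_eq ?_
    field_simp
  rw [hw.2, one_pow] at h1
  rwa [inv_le_iff_one_le_mul₀' h]

theorem inv_sum_inv_mono (hm : 1 ≤ m) {V' : Fin m → ℝ} (hV : ∀ i, 0 < V i) {c : ℝ} (hc : 0 < c)
    (h : ∀ i, V i ≤ c * V' i) : (∑ i, (V i)⁻¹)⁻¹ ≤ c * (∑ i, (V' i)⁻¹)⁻¹ := by
  have hV' : ∀ i, 0 < V' i := fun i => by
    have := (hV i).trans_le (h i)
    exact pos_of_mul_pos_right this hc.le
  have h0 := sum_inv_pos hm hV'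
  have h1 : c⁻¹ * ∑ i, (V' i)⁻¹ ≤ ∑ i, (V i)⁻¹ := by
    rw [Finset.mul_sum]
    refine Finset.sum_le_sum fun i _ => ?_
    rw [← mul_inv]
    exact inv_anti₀ (hV i) (h i)
  calc (∑ i, (V i)⁻¹)⁻¹ ≤ (c⁻¹ * ∑ i, (V' i)⁻¹)⁻¹ := inv_anti₀ (by positivity) h1
    _ = _ := by rw [mul_inv, inv_inv]

/-- With inverse-variance weights the effective sample size is at least `√(N n_min)`. -/
theorem sum_invWeights_sq_div_sq_le (hm : 1 ≤ m) (hn : 0 < minSize n) {a c : ℝ} (ha : 0 ≤ a)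
    (hc : 0 < c) (hV : ∀ i, V i = a / n i + c / (n i : ℝ) ^ 2) :
    (∑ i, invWeights V i ^ 2 / (n i : ℝ)) ^ 2 ≤ 1 / (totalSize n * minSize n) := by
  have hn0 : (0 : ℝ) < minSize n := by exact_mod_cast hn
  have hnle : ∀ i, (minSize n : ℝ) ≤ n i := fun i => by exact_mod_cast minSize_le i
  have hni : ∀ i, (0 : ℝ) < n i := fun i => hn0.trans_le (hnle i)
  have hf : ∀ i, (V i)⁻¹ = (n i : ℝ) ^ 2 / (a * n i + c) := fun i => by
    have := hni i
    rw [hV, ← inv_div]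
    field_simp
  have hVpos : ∀ i, 0 < V i := fun i => by
    have := hni i
    rw [hV]; positivity
  set T := ∑ i, (V i)⁻¹ with hT
  have hTpos : 0 < T := sum_inv_pos hm hVpos
  have hne : (Finset.univ : Finset (Fin m)).Nonempty := ⟨⟨0, hm⟩, Finset.mem_univ _⟩
  obtain ⟨j, -, hj⟩ := Finset.exists_max_image Finset.univ n hne
  set M : ℝ := ((n j : ℕ) : ℝ) with hM
  have hMpos : 0 < M := hni j
  have hle : ∀ i, (n i : ℝ) ≤ M := fun i => by
    rw [hM]; exact_mod_cast hj i (Finset.mem_univ i)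
  set G := M / (a * M + c) with hG
  have hGpos : 0 < G := by positivity
  -- The function `t ↦ t/(a t + c)` is nondecreasing, so every client is compared with the largest
  -- one.
  have hv : ∑ i, invWeights V i ^ 2 / (n i : ℝ) ≤ G / T := by
    have h1 : ∀ i, invWeights V i ^ 2 / (n i : ℝ) ≤ (V i)⁻¹ * (G / T ^ 2) := by
      intro i
      have hi := hni i
      have h2 : (n i : ℝ) / (a * n i + c) ≤ G := by
        rw [hG, div_le_div_iff₀ (by positivity) (by positivity)]
        nlinarith [hle i]
      have h3 : invWeights V i ^ 2 / (n i : ℝ) =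
          (V i)⁻¹ * ((n i : ℝ) / (a * n i + c) / T ^ 2) := by
        rw [invWeights, ← hT, hf i]
        field_simp
      rw [h3]
      have := (inv_pos.2 (hVpos i)).le
      gcongr
    refine (Finset.sum_le_sum fun i _ => h1 i).trans (le_of_eq ?_)
    rw [← Finset.sum_mul, ← hT]
    field_simp
  -- Two lower bounds for `T`, from the largest client alone and from all clients together. In their
  -- product `M` cancels, leaving `T² ≥ G² N n_min`.
  have hT1 : M * G ≤ T := by
    calc M * G = (V j)⁻¹ := by rw [hf j, hG]; ring
      _ ≤ T := Finset.single_le_sum (f := fun i => (V i)⁻¹)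
        (fun i _ => (inv_pos.2 (hVpos i)).le) (Finset.mem_univ j)
  have hT2 : totalSize n * minSize n * (G / M) ≤ T := by
    rw [totalSize]
    push_cast
    rw [mul_assoc, Finset.sum_mul]
    refine Finset.sum_le_sum fun i _ => ?_
    have hi := hni i
    rw [hf i]
    calc (n i : ℝ) * (minSize n * (G / M)) ≤ n i * (n i * (1 / (a * n i + c))) := by
          have h4 : G / M ≤ 1 / (a * n i + c) := by
            have h5 : G / M = 1 / (a * M + c) := by rw [hG]; field_simp
            rw [h5]
            have := hle i
            gcongr
          have := hnle i
          gcongr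
      _ = _ := by ring
  have hv0 : 0 ≤ ∑ i, invWeights V i ^ 2 / (n i : ℝ) :=
    Finset.sum_nonneg fun i _ => by positivity
  have hNn : (0 : ℝ) < totalSize n * minSize n := by
    have : (n j : ℝ) ≤ totalSize n := by exact_mod_cast le_totalSize j
    have : (0 : ℝ) < totalSize n := hMpos.trans_le this
    positivity
  calc _ ≤ (G / T) ^ 2 := by gcongr
    _ = G ^ 2 / T ^ 2 := div_pow _ _ _
    _ ≤ G ^ 2 / (M * G * (totalSize n * minSize n * (G / M))) := by
        have : M * G * (totalSize n * minSize n * (G / M)) ≤ T ^ 2 := by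
          rw [sq]; gcongr
        gcongr
    _ = _ := by field_simp

theorem dimLog_sq_le {d N : ℕ} (hN : 1 ≤ N) : dimLog d N ^ 2 ≤ (d : ℝ) ^ 2 + 4 * N := by
  have hN' : (0 : ℝ) < N := by exact_mod_cast hN
  have hlog : Real.log (N : ℝ) ^ 2 ≤ 4 * (N : ℝ) := by
    have h0 : 0 ≤ Real.log N := Real.log_nonneg (by exact_mod_cast hN)
    have h1 : Real.log √(N : ℝ) ≤ √(N : ℝ) := (Real.log_le_sub_one_of_pos (by positivity)).trans
      (by linarith)
    rw [Real.log_sqrt hN'.le] at h1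
    have h2 : Real.log N ≤ 2 * √(N : ℝ) := by linarith
    calc Real.log (N : ℝ) ^ 2 ≤ (2 * √(N : ℝ)) ^ 2 := by gcongr
      _ = 4 * (N : ℝ) := by rw [mul_pow, Real.sq_sqrt hN'.le]; ring
  rcases max_choice (d : ℝ) (Real.log N) with h | h <;> rw [dimLog, h]
  · linarith
  · nlinarith [sq_nonneg (d : ℝ)]

end Weights

/-! ### The prescribed number of rounds -/

section IterationCount

/-- The logarithm in the denominator is `-log(1 - τ₁/(3τ₂))`, so `2K` rounds of this rate give at
most `(dN)^{-4}`. The bound `1 ≤ iterBound` means that rounding up at most doubles it. -/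
theorem iterBound_spec {τ₁ τ₂ : ℝ} (hτ₁ : 0 < τ₁) (hτ : τ₁ ≤ τ₂) {d N : ℕ} (hd : 1 ≤ d)
    (hN : 2 ≤ N) :
    1 ≤ iterBound τ₁ τ₂ d N ∧
      (1 - τ₁ / (3 * τ₂)) ^ (2 * ⌈iterBound τ₁ τ₂ d N⌉₊) ≤ 1 / ((d : ℝ) * N) ^ 4 := by
  have hτ₂ : 0 < τ₂ := hτ₁.trans_le hτ
  have h3 : 0 < 3 * τ₂ - τ₁ := by linarith
  set L := Real.log (3 * τ₂ / (3 * τ₂ - τ₁)) with hL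
  have hLpos : 0 < L := Real.log_pos (by rw [lt_div_iff₀ h3]; linarith)
  have hdN : (2 : ℝ) ≤ d * N := by
    have : 2 ≤ d * N := by nlinarith
    exact_mod_cast this
  have hlog : Real.log 2 ≤ Real.log ((d : ℝ) * N) := Real.log_le_log (by norm_num) hdN
  have hLle : L ≤ Real.log 2 := by
    refine Real.log_le_log (by positivity) ?_
    rw [div_le_iff₀ h3]; linarith
  have hlog2 : 0 < Real.log 2 := Real.log_pos one_lt_two
  have hκ : iterBound τ₁ τ₂ d N * L = 2 * Real.log ((d : ℝ) * N) := by
    rw [iterBound, ← hL]; field_simp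
  refine ⟨?_, ?_⟩
  · rw [iterBound, ← hL, one_le_div hLpos]; linarith
  · have hq : 1 - τ₁ / (3 * τ₂) = Real.exp (-L) := by
      rw [Real.exp_neg, hL, Real.exp_log (by positivity), inv_div]; field_simp
    have hpow : 1 / ((d : ℝ) * N) ^ 4 = Real.exp (-(4 * Real.log ((d : ℝ) * N))) := by
      rw [Real.exp_neg, show 4 * Real.log ((d : ℝ) * N) = ((4 : ℕ) : ℝ) * Real.log ((d : ℝ) * N) by
        norm_num, Real.exp_nat_mul, Real.exp_log (by linarith), one_div]
    rw [hq, hpow, ← Real.exp_nat_mul, Real.exp_le_exp]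
    push_cast
    have := mul_le_mul_of_nonneg_right (Nat.le_ceil (iterBound τ₁ τ₂ d N)) hLpos.le
    linarith

end IterationCount

/-! ### The two error bounds -/

section ErrorBound

variable {Ω 𝒳 : Type*} [MeasurableSpace Ω] [MeasurableSpace 𝒳] {d m : ℕ}
  {P : Measure Ω} [IsProbabilityMeasure P] {F : Measure 𝒳} [IsProbabilityMeasure F]
  {n : Fin m → ℕ} {ρ : 𝒳 → Param d → ℝ} {Θ : Set (Param d)} {θ₀ : Param d}
  {X : (i : Fin m) → Fin (n i) → Ω → 𝒳} {Z : ℕ → Fin m → Ω → Param d} {θinit : Ω → Param d}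
  {w : Fin m → ℝ} {τ₁ τ₂ C₁ C₂ W CB μbar η μ : ℝ} {K : ℕ}

theorem LossAssumptions.integrable_norm_output_sq (hA : LossAssumptions F ρ Θ θ₀ τ₁ τ₂ C₁ C₂ W)
    (hS : Sampling P F n X Z θinit) (hC₁ : 0 < C₁) (hn : ∀ i, 1 ≤ n i)
    (hw : w ∈ stdSimplex ℝ (Fin m)) (hinit : MemLp θinit 2 P) (B : ℝ) :
    Integrable (fun ω => ‖output ρ n X Z θinit w η μ B K ω - θ₀‖ ^ 2) P :=
  integrable_norm_sq_of_memLp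
    ((hA.memLp_iterate hS hC₁ hn hw hinit K).sub (memLp_const θ₀))

theorem LossAssumptions.integral_norm_output_le (hA : LossAssumptions F ρ Θ θ₀ τ₁ τ₂ C₁ C₂ W)
    (hS : Sampling P F n X Z θinit) (hτ₁ : 0 < τ₁) (hτ₂ : 0 < τ₂) (hC₁ : 0 < C₁) (hCB : 0 < CB)
    (hμbar : 0 < μbar) (hd : 1 ≤ d) (hm : 1 ≤ m) (hn : ∀ i, 1 ≤ n i)
    (hw : w ∈ stdSimplex ℝ (Fin m))
    (hinit : MemLp θinit 2 P) (hη₁ : 1 / (2 * τ₂) ≤ η) (hη₂ : η ≤ 9 / (10 * τ₂)) (hμ : 0 < μ)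
    (hμle : μ ≤ μbar)
    (hγ : gammaOne (1 / √(smallness τ₁ τ₂ C₁ CB μbar)) η τ₁ d n < 1) :
    ∫ ω, ‖output ρ n X Z θinit w η μ (CB * √(dimLog d (totalSize n))) K ω - θ₀‖ ^ 2 ∂P ≤
      3 * (1 - τ₁ / (3 * τ₂)) ^ (2 * K) * ∫ ω, ‖θinit ω - θ₀‖ ^ 2 ∂P +
      4 / (1 - gammaOne (1 / √(smallness τ₁ τ₂ C₁ CB μbar)) η τ₁ d n) ^ 2 *
        (η ^ 2 * ∫ ω, ‖∑ i, w i • localGrad ρ n X i θ₀ ω‖ ^ 2 ∂P +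
          η ^ 2 * CB ^ 2 * K * d * dimLog d (totalSize n) / μ ^ 2 *
            ∑ i, w i ^ 2 / (n i : ℝ) ^ 2) := by
  have hτ := hA.tau_le hd
  set e := smallness τ₁ τ₂ C₁ CB μbar with he
  have he0 : 0 < e := smallness_pos hτ₁ hτ₂ hC₁ hCB hμbar
  have hη0 : 0 < η := lt_of_lt_of_le (by positivity) hη₁
  have hd' : (1 : ℝ) ≤ d := by exact_mod_cast hd
  have hD1 : 1 ≤ dimLog d (totalSize n) := hd'.trans (le_max_left _ _)
  set γ := gammaOne (1 / √e) η τ₁ d n with hγdef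
  have hγeq : 1 - γ = η * τ₁ - 1 / √e * √(dimLog d (totalSize n) / minSize n) := by
    rw [hγdef, gammaOne]; ring
  have hγle : 1 - γ ≤ η * τ₁ := by
    rw [hγeq]
    have : 0 ≤ 1 / √e * √(dimLog d (totalSize n) / minSize n) := by positivity
    linarith
  have hγpos : 0 < 1 - γ := by linarith
  have hbr : 0 ≤ η ^ 2 * ∫ ω, ‖weightedGrad ρ n X w θ₀ ω‖ ^ 2 ∂P +
      η ^ 2 * CB ^ 2 * K * d * dimLog d (totalSize n) / μ ^ 2 *
        ∑ i, w i ^ 2 / (n i : ℝ) ^ 2 := by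
    have h1 : 0 ≤ ∫ ω, ‖weightedGrad ρ n X w θ₀ ω‖ ^ 2 ∂P :=
      integral_nonneg fun ω => sq_nonneg _
    have h2 : 0 ≤ ∑ i, w i ^ 2 / (n i : ℝ) ^ 2 := Finset.sum_nonneg fun i _ => by positivity
    positivity
  have hu0 : 0 ≤ ∫ ω, ‖θinit ω - θ₀‖ ^ 2 ∂P := integral_nonneg fun ω => sq_nonneg _
  change _ ≤ _ + 4 / (1 - γ) ^ 2 * (η ^ 2 * ∫ ω, ‖weightedGrad ρ n X w θ₀ ω‖ ^ 2 ∂P +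
    η ^ 2 * CB ^ 2 * K * d * dimLog d (totalSize n) / μ ^ 2 * ∑ i, w i ^ 2 / (n i : ℝ) ^ 2)
  -- Without any round the output is the initial point, and the factor `3` covers the claim.
  rcases Nat.eq_zero_or_pos K with rfl | hK
  · have h1 : ∀ ω, output ρ n X Z θinit w η μ (CB * √(dimLog d (totalSize n))) 0 ω = θinit ω :=
      fun ω => rfl
    simp only [h1, mul_zero, pow_zero, mul_one]
    simp only [Nat.cast_zero] at hbr
    have h2 := mul_nonneg (by positivity : 0 ≤ 4 / (1 - γ) ^ 2) hbr
    simp only [mul_zero] at h2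
    push_cast
    simp only [mul_zero]
    linarith
  · have hmin : 0 < minSize n := by
      have : Nonempty (Fin m) := ⟨⟨0, hm⟩⟩
      exact lt_of_lt_of_le one_pos (le_ciInf hn)
    have hmin' : (0 : ℝ) < minSize n := by exact_mod_cast hmin
    have hητ₁ : η * τ₁ ≤ 1 := by
      rw [le_div_iff₀ (by positivity)] at hη₂
      have := mul_le_mul_of_nonneg_left hτ hη0.le
      linarith
    -- The choice `C = 1/√e` makes `γ₁ < 1` encode smallness: it forces `√(D/n_min) ≤ √e · ητ₁ ≤
    -- √e`.
    have hsmall : dimLog d (totalSize n) * ∑ i, w i ^ 2 / (n i : ℝ) ≤ e := by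
      have h1 : √(dimLog d (totalSize n) / minSize n) ≤ √e := by
        have h2 : 1 / √e * √(dimLog d (totalSize n) / minSize n) ≤ 1 := by linarith
        rwa [one_div, inv_mul_le_iff₀ (Real.sqrt_pos.2 he0), mul_one] at h2
      have h3 := (Real.sqrt_le_sqrt_iff he0.le).1 h1
      refine le_trans ?_ h3
      rw [div_eq_mul_one_div]
      exact mul_le_mul_of_nonneg_left (sum_sq_div_le_inv_minSize hmin hw) (by linarith)
    refine (hA.integral_norm_iterate_le hS hτ₁ hτ₂ hC₁ hCB hμbar hd hn hw hinit hη₁ hη₂ hμ hμle hK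
      hsmall K).trans (add_le_add ?_ ?_)
    · have hq : 0 ≤ (1 - τ₁ / (3 * τ₂)) ^ (2 * K) * ∫ ω, ‖θinit ω - θ₀‖ ^ 2 ∂P := by
        rw [pow_mul]; positivity
      linarith
    · gcongr

theorem LossAssumptions.integral_norm_output_invWeights_le
    (hA : LossAssumptions F ρ Θ θ₀ τ₁ τ₂ C₁ C₂ W)
    (hS : Sampling P F n X Z θinit) (hτ₁ : 0 < τ₁) (hτ₂ : 0 < τ₂) (hC₁ : 0 < C₁) (hCB : 0 < CB)
    (hμbar : 0 < μbar) (hd : 1 ≤ d) (hm : 1 ≤ m) {R R₀ : ℝ} (hR : 0 < R) (hR₀ : 0 < R₀)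
    (hΘ : ∀ θ ∈ Θ, ‖θ‖ ≤ R * √(d : ℝ)) (hinit : ∀ᵐ ω ∂P, ‖θinit ω‖ ≤ R₀ * √(d : ℝ))
    (hη₁ : 1 / (2 * τ₂) ≤ η) (hη₂ : η ≤ 9 / (10 * τ₂)) (hμ : 0 < μ) (hμle : μ ≤ μbar)
    (hmin : (2 + 5 / smallness τ₁ τ₂ C₁ CB μbar ^ 2 + (R + R₀) * τ₁ * μbar / CB) * d ≤ minSize n)
    {V : Fin m → ℝ} (hV : V = clientVar (gradCovTrace F ρ θ₀) CB μ
      ⌈iterBound τ₁ τ₂ d (totalSize n)⌉₊ d n) :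
    (∀ i, 1 ≤ n i) ∧ (∀ i, 0 < V i) ∧ MemLp θinit 2 P ∧
    ∫ ω, ‖output ρ n X Z θinit (invWeights V) η μ (CB * √(dimLog d (totalSize n)))
        ⌈iterBound τ₁ τ₂ d (totalSize n)⌉₊ ω - θ₀‖ ^ 2 ∂P ≤
      17 / τ₁ ^ 2 * (∑ i, (clientVar (gradCovTrace F ρ θ₀) CB μ
        (iterBound τ₁ τ₂ d (totalSize n)) d n i)⁻¹)⁻¹ := by
  have hτ := hA.tau_le hd
  set e := smallness τ₁ τ₂ C₁ CB μbar with he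
  have he0 : 0 < e := smallness_pos hτ₁ hτ₂ hC₁ hCB hμbar
  have hη0 : 0 < η := lt_of_lt_of_le (by positivity) hη₁
  have hd' : (1 : ℝ) ≤ d := by exact_mod_cast hd
  have hr0 : 0 ≤ (R + R₀) * τ₁ * μbar / CB := by positivity
  have he5 : 0 < 5 / e ^ 2 := by positivity
  have hmin2 : 2 * (d : ℝ) ≤ minSize n := by nlinarith
  have hmin_e : 5 / e ^ 2 * d ≤ minSize n := by nlinarith
  have hmin_r : (R + R₀) * τ₁ * μbar / CB ≤ minSize n := by nlinarith
  have hmin0 : (0 : ℝ) < minSize n := by linarith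
  have hmin0' : 0 < minSize n := by exact_mod_cast hmin0
  have hn : ∀ i, 1 ≤ n i := fun i => hmin0'.trans_le (minSize_le i)
  have hminN : (minSize n : ℝ) ≤ totalSize n := by
    exact_mod_cast (minSize_le (⟨0, hm⟩ : Fin m)).trans (le_totalSize _)
  set N := totalSize n with hN
  have hN2 : 2 ≤ N := by
    have : (2 : ℝ) ≤ N := by linarith
    exact_mod_cast this
  have hN0 : (0 : ℝ) < N := by positivity
  obtain ⟨hκ1, hqK⟩ := iterBound_spec hτ₁ hτ hd hN2
  set κ := iterBound τ₁ τ₂ d N with hκ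
  set K := ⌈κ⌉₊ with hK
  have hK1 : 1 ≤ K := Nat.one_le_ceil_iff.2 (by linarith)
  have hK1' : (1 : ℝ) ≤ K := by exact_mod_cast hK1
  have hKκ : (K : ℝ) ≤ 2 * κ := by linarith [Nat.ceil_lt_add_one (by linarith : 0 ≤ κ)]
  set D := dimLog d N with hD
  have hD1 : 1 ≤ D := hd'.trans (le_max_left _ _)
  set tr := gradCovTrace F ρ θ₀ with htr
  have htr0 : 0 ≤ tr := by
    rw [htr, hA.gradCovTrace_eq hC₁]; exact integral_nonneg fun x => sq_nonneg _
  set c := CB ^ 2 * d * D * K / μ ^ 2 with hc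
  have hc0 : 0 < c := by positivity
  have hVi : ∀ i, V i = tr / n i + c / (n i : ℝ) ^ 2 := fun i => by
    rw [hV, clientVar, ← hN, ← hD, hc, div_div]
  have hVpos : ∀ i, 0 < V i := fun i => by
    have := hn i
    rw [hVi]; positivity
  have hLinit : MemLp θinit 2 P :=
    MemLp.of_bound hS.measurable_init.aestronglyMeasurable _ hinit
  refine ⟨hn, hVpos, hLinit, ?_⟩
  have hw := invWeights_mem hm hVpos
  -- Squared, the left side is at most `(d² + 4N)/(N n_min)`. With `d ≤ N` and `n_min ≥ 5d/e²`, the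
  -- two parts contribute at most `e²/5` and `4e²/5`.
  have hsmall : D * ∑ i, invWeights V i ^ 2 / (n i : ℝ) ≤ e := by
    refine le_of_sq_le_sq ?_ he0.le
    rw [mul_pow]
    have h1 := sum_invWeights_sq_div_sq_le hm hmin0' htr0 hc0 hVi
    have h2 : D ^ 2 ≤ (d : ℝ) ^ 2 + 4 * N := dimLog_sq_le (by omega)
    have h3 : 5 ≤ e ^ 2 * minSize n := by
      have : 5 / e ^ 2 ≤ minSize n := (le_mul_of_one_le_right he5.le hd').trans hmin_e
      rwa [div_le_iff₀' (by positivity)] at this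
    have h4 : (d : ℝ) ≤ e ^ 2 * minSize n / 5 := by
      rw [le_div_iff₀ (by norm_num)]
      rw [div_mul_eq_mul_div, div_le_iff₀' (by positivity)] at hmin_e
      linarith
    have h5 : (d : ℝ) ^ 2 ≤ N * (e ^ 2 * minSize n / 5) := by
      have hdN' : (d : ℝ) ≤ N := by linarith
      rw [sq]; exact mul_le_mul hdN' h4 (by positivity) (by positivity)
    have h6 : 4 * (N : ℝ) ≤ 4 * (N * (e ^ 2 * minSize n / 5)) := by
      have : (1 : ℝ) ≤ e ^ 2 * minSize n / 5 := by linarith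
      have := le_mul_of_one_le_right hN0.le this
      linarith
    calc _ ≤ ((d : ℝ) ^ 2 + 4 * N) * (1 / (N * minSize n)) := by gcongr
      _ ≤ (N * (e ^ 2 * minSize n)) * (1 / (N * minSize n)) := by gcongr; linarith
      _ = e ^ 2 := by field_simp
  have hcore := hA.integral_norm_iterate_le hS hτ₁ hτ₂ hC₁ hCB hμbar hd hn hw hLinit hη₁ hη₂ hμ hμle
    hK1 hsmall K
  rw [hA.integral_norm_weightedGrad_sq hS hC₁, ← htr, ← hN, ← hD] at hcore
  have hvar : 4 / (η * τ₁) ^ 2 * (η ^ 2 * (tr * ∑ i, invWeights V i ^ 2 / (n i : ℝ)) +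
      η ^ 2 * CB ^ 2 * K * d * D / μ ^ 2 * ∑ i, invWeights V i ^ 2 / (n i : ℝ) ^ 2) =
      4 / τ₁ ^ 2 * (∑ i, (V i)⁻¹)⁻¹ := by
    have h1 : ∑ i, invWeights V i ^ 2 * V i = tr * ∑ i, invWeights V i ^ 2 / (n i : ℝ) +
        c * ∑ i, invWeights V i ^ 2 / (n i : ℝ) ^ 2 := by
      rw [Finset.mul_sum, Finset.mul_sum, ← Finset.sum_add_distrib]
      refine Finset.sum_congr rfl fun i _ => ?_
      rw [hVi]; ring
    rw [← sum_invWeights_sq_mul hm hVpos, h1, hc]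
    field_simp
  set V' := clientVar tr CB μ κ d n with hV'
  have hVV' : (∑ i, (V i)⁻¹)⁻¹ ≤ 2 * (∑ i, (V' i)⁻¹)⁻¹ := by
    refine inv_sum_inv_mono hm hVpos two_pos fun i => ?_
    rw [hVi, hV', clientVar, ← hN, ← hD, hc, div_div, mul_add]
    refine add_le_add ?_ ?_
    · have : 0 ≤ tr / n i := by positivity
      linarith
    · rw [← mul_div_assoc]
      have h1 : CB ^ 2 * d * D * K ≤ 2 * (CB ^ 2 * d * D * κ) := by
        have := mul_le_mul_of_nonneg_left hKκ (by positivity : 0 ≤ CB ^ 2 * d * D)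
        linarith
      gcongr
  -- The noise floor of the final bound, from the privacy part of each variance and `∑ nᵢ² ≤ N²`.
  have hV'low : CB ^ 2 * d / μbar ^ 2 / (N : ℝ) ^ 2 ≤ (∑ i, (V' i)⁻¹)⁻¹ := by
    have hV'pos : ∀ i, 0 < V' i := fun i => by
      have := hn i
      rw [hV', clientVar, ← hN, ← hD]; positivity
    rw [← inv_inv (CB ^ 2 * d / μbar ^ 2 / (N : ℝ) ^ 2)]
    refine inv_anti₀ (sum_inv_pos hm hV'pos) ?_
    have h1 : ∀ i, (V' i)⁻¹ ≤ (CB ^ 2 * d / μbar ^ 2)⁻¹ * (n i : ℝ) ^ 2 := by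
      intro i
      have hni : (0 : ℝ) < n i := by exact_mod_cast hn i
      rw [← inv_inv ((n i : ℝ) ^ 2), ← mul_inv]
      refine inv_anti₀ (by positivity) ?_
      have h2 : CB ^ 2 * d / μbar ^ 2 * ((n i : ℝ) ^ 2)⁻¹ ≤
          CB ^ 2 * d * D * κ / (μ ^ 2 * (n i : ℝ) ^ 2) := by
        rw [← div_eq_mul_inv, div_div]
        have h3 : CB ^ 2 * d ≤ CB ^ 2 * d * D * κ := by
          calc CB ^ 2 * d = CB ^ 2 * d * 1 * 1 := by ring
            _ ≤ _ := by gcongr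
        gcongr
      have h4 : 0 ≤ tr / n i := by positivity
      rw [hV', clientVar, ← hN, ← hD]
      linarith
    calc ∑ i, (V' i)⁻¹ ≤ ∑ i, (CB ^ 2 * d / μbar ^ 2)⁻¹ * (n i : ℝ) ^ 2 :=
          Finset.sum_le_sum fun i _ => h1 i
      _ = (CB ^ 2 * d / μbar ^ 2)⁻¹ * ∑ i, (n i : ℝ) ^ 2 := by rw [Finset.mul_sum]
      _ ≤ (CB ^ 2 * d / μbar ^ 2)⁻¹ * (N : ℝ) ^ 2 := by
          gcongr
          rw [hN, totalSize]
          push_cast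
          exact Finset.sum_sq_le_sq_sum_of_nonneg fun i _ => Nat.cast_nonneg _
      _ = _ := by rw [inv_div (CB ^ 2 * d / μbar ^ 2) ((N : ℝ) ^ 2), inv_mul_eq_div]
  have hu0 : ∫ ω, ‖θinit ω - θ₀‖ ^ 2 ∂P ≤ (R + R₀) ^ 2 * d := by
    have h1 : ∀ᵐ ω ∂P, ‖θinit ω - θ₀‖ ^ 2 ≤ (R + R₀) ^ 2 * d := by
      filter_upwards [hinit] with ω hω
      have h2 := norm_sub_le (θinit ω) θ₀
      have h3 := hΘ θ₀ hA.mem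
      calc ‖θinit ω - θ₀‖ ^ 2 ≤ ((R + R₀) * √(d : ℝ)) ^ 2 := by gcongr; linarith
        _ = _ := by rw [mul_pow, Real.sq_sqrt (by linarith)]
    calc _ ≤ ∫ _, (R + R₀) ^ 2 * (d : ℝ) ∂P := integral_mono_ae
          (integrable_norm_sq_of_memLp (hLinit.sub (memLp_const θ₀))) (integrable_const _) h1
      _ = _ := by simp
  -- The initial error is at most `(R + R₀)² d / N⁴`, and `n_min ≥ (R + R₀) τ₁ μbar / CB` brings it
  -- below `1/τ₁²` times the noise floor. The `9` is slack.
  have hfirst : (1 - τ₁ / (3 * τ₂)) ^ (2 * K) * ∫ ω, ‖θinit ω - θ₀‖ ^ 2 ∂P ≤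
      9 / τ₁ ^ 2 * (∑ i, (V' i)⁻¹)⁻¹ := by
    have h1 : (R + R₀) * τ₁ * μbar ≤ CB * N := by
      rw [div_le_iff₀ hCB] at hmin_r
      have := mul_le_mul_of_nonneg_right hminN hCB.le
      linarith
    have h2 : ((R + R₀) * τ₁ * μbar) ^ 2 ≤ (CB * N) ^ 2 := by gcongr
    calc _ ≤ 1 / ((d : ℝ) * N) ^ 4 * ((R + R₀) ^ 2 * d) :=
          mul_le_mul hqK hu0 (integral_nonneg fun ω => sq_nonneg _) (by positivity)
      _ ≤ 1 / (1 * (N : ℝ)) ^ 4 * ((R + R₀) ^ 2 * d) := by gcongr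
      _ ≤ 1 / τ₁ ^ 2 * (CB ^ 2 * d / μbar ^ 2 / (N : ℝ) ^ 2) := by
          have h3 : 1 / (1 * (N : ℝ)) ^ 4 * ((R + R₀) ^ 2 * d) =
              ((R + R₀) * τ₁ * μbar) ^ 2 * (d / (τ₁ ^ 2 * μbar ^ 2 * (N : ℝ) ^ 4)) := by
            field_simp
          have h4 : 1 / τ₁ ^ 2 * (CB ^ 2 * d / μbar ^ 2 / (N : ℝ) ^ 2) =
              (CB * N) ^ 2 * (d / (τ₁ ^ 2 * μbar ^ 2 * (N : ℝ) ^ 4)) := by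
            field_simp
          rw [h3, h4]
          gcongr
      _ ≤ 9 / τ₁ ^ 2 * (∑ i, (V' i)⁻¹)⁻¹ := by
          gcongr
          norm_num
  rw [hvar] at hcore
  have h8 : 4 / τ₁ ^ 2 * (∑ i, (V i)⁻¹)⁻¹ ≤ 4 / τ₁ ^ 2 * (2 * (∑ i, (V' i)⁻¹)⁻¹) := by gcongr
  -- The constant is `17 = 9 + 4 · 2`, where the `2` comes from replacing `K` by the unrounded `κ`.
  calc _ ≤ 9 / τ₁ ^ 2 * (∑ i, (V' i)⁻¹)⁻¹ + 4 / τ₁ ^ 2 * (2 * (∑ i, (V' i)⁻¹)⁻¹) :=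
        hcore.trans (add_le_add hfirst h8)
    _ = _ := by ring

end ErrorBound

end FedSGD

end

/-! ### The theorem -/

theorem theorem3p1
    (τ₁ τ₂ C₁ C₂ W CB μbar : ℝ) (hτ₁ : 0 < τ₁) (hτ₂ : 0 < τ₂) (hC₁ : 0 < C₁) (hC₂ : 0 < C₂)
    (hW : 0 < W) (hCB : 0 < CB) (hμbar : 0 < μbar) :
    -- the bound for every number of iterations and all weights
    (∃ C : ℝ, 0 < C ∧
      ∀ (Ω 𝒳 : Type*) [MeasurableSpace Ω] [MeasurableSpace 𝒳]
        (P : Measure Ω) [IsProbabilityMeasure P] (F : Measure 𝒳) [IsProbabilityMeasure F]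
        (d m : ℕ) (n : Fin m → ℕ) (ρ : 𝒳 → FedSGD.Param d → ℝ)
        (Θ : Set (FedSGD.Param d)) (θ₀ : FedSGD.Param d)
        (X : (i : Fin m) → Fin (n i) → Ω → 𝒳) (Z : ℕ → Fin m → Ω → FedSGD.Param d)
        (θinit : Ω → FedSGD.Param d) (w : Fin m → ℝ) (η μ : ℝ) (K : ℕ),
        1 ≤ d → 1 ≤ m → (∀ i, 1 ≤ n i) →
        FedSGD.LossAssumptions F ρ Θ θ₀ τ₁ τ₂ C₁ C₂ W →
        FedSGD.Sampling P F n X Z θinit →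
        MemLp θinit 2 P →
        w ∈ stdSimplex ℝ (Fin m) →
        1 / (2 * τ₂) ≤ η → η ≤ 9 / (10 * τ₂) →
        0 < μ → μ ≤ μbar →
        FedSGD.gammaOne C η τ₁ d n < 1 →
        let D := FedSGD.dimLog d (FedSGD.totalSize n)
        let θK := FedSGD.output ρ n X Z θinit w η μ (CB * √D) K
        Integrable (fun ω => ‖θK ω - θ₀‖ ^ 2) P ∧
        ∫ ω, ‖θK ω - θ₀‖ ^ 2 ∂P ≤
          3 * (1 - τ₁ / (3 * τ₂)) ^ (2 * K) * ∫ ω, ‖θinit ω - θ₀‖ ^ 2 ∂P +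
          4 / (1 - FedSGD.gammaOne C η τ₁ d n) ^ 2 *
            (η ^ 2 * ∫ ω, ‖∑ i, w i • FedSGD.localGrad ρ n X i θ₀ ω‖ ^ 2 ∂P +
              η ^ 2 * CB ^ 2 * K * d * D / μ ^ 2 * ∑ i, w i ^ 2 / (n i : ℝ) ^ 2)) ∧
    -- logarithmically many iterations and optimal weights; `R` and `R₀` bound the size of the
    -- parameter set and of the initial point relative to `√d`
    (∀ R R₀ : ℝ, 0 < R → 0 < R₀ → ∃ C : ℝ, 0 < C ∧
      ∀ (Ω 𝒳 : Type*) [MeasurableSpace Ω] [MeasurableSpace 𝒳]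
        (P : Measure Ω) [IsProbabilityMeasure P] (F : Measure 𝒳) [IsProbabilityMeasure F]
        (d m : ℕ) (n : Fin m → ℕ) (ρ : 𝒳 → FedSGD.Param d → ℝ)
        (Θ : Set (FedSGD.Param d)) (θ₀ : FedSGD.Param d)
        (X : (i : Fin m) → Fin (n i) → Ω → 𝒳) (Z : ℕ → Fin m → Ω → FedSGD.Param d)
        (θinit : Ω → FedSGD.Param d) (η μ : ℝ),
        1 ≤ d → 1 ≤ m →
        FedSGD.LossAssumptions F ρ Θ θ₀ τ₁ τ₂ C₁ C₂ W →
        FedSGD.Sampling P F n X Z θinit →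
        (∀ θ ∈ Θ, ‖θ‖ ≤ R * √(d : ℝ)) →
        (∀ᵐ ω ∂P, ‖θinit ω‖ ≤ R₀ * √(d : ℝ)) →
        1 / (2 * τ₂) ≤ η → η ≤ 9 / (10 * τ₂) →
        0 < μ → μ ≤ μbar →
        C * d ≤ FedSGD.minSize n →
        let N := FedSGD.totalSize n
        let D := FedSGD.dimLog d N
        let κ := FedSGD.iterBound τ₁ τ₂ d N
        let K := ⌈κ⌉₊
        let trVar := FedSGD.gradCovTrace F ρ θ₀
        let V := FedSGD.clientVar trVar CB μ K d n
        let w := FedSGD.invWeights V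
        let θK := FedSGD.output ρ n X Z θinit w η μ (CB * √D) K
        w ∈ stdSimplex ℝ (Fin m) ∧
        (∀ w' ∈ stdSimplex ℝ (Fin m), ∑ i, w i ^ 2 * V i ≤ ∑ i, w' i ^ 2 * V i) ∧
        Integrable (fun ω => ‖θK ω - θ₀‖ ^ 2) P ∧
        ∫ ω, ‖θK ω - θ₀‖ ^ 2 ∂P ≤
          17 / τ₁ ^ 2 * (∑ i, (trVar / n i +
            2 * CB ^ 2 * d * D * Real.log ((d : ℝ) * N) /
              (μ ^ 2 * (n i : ℝ) ^ 2 * Real.log (3 * τ₂ / (3 * τ₂ - τ₁))))⁻¹)⁻¹) := by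
  refine ⟨⟨1 / √(FedSGD.smallness τ₁ τ₂ C₁ CB μbar),
    one_div_pos.2 (Real.sqrt_pos.2 (FedSGD.smallness_pos hτ₁ hτ₂ hC₁ hCB hμbar)), ?_⟩,
    -- The three summands ensure, in order, `N ≥ 2`, smallness of `D ∑ wᵢ²/nᵢ` and absorption of the
    -- initial error.
    fun R R₀ hR hR₀ => ⟨2 + 5 / FedSGD.smallness τ₁ τ₂ C₁ CB μbar ^ 2 + (R + R₀) * τ₁ * μbar / CB,
      ?_, ?_⟩⟩
  · intro Ω 𝒳 _ _ P _ F _ d m n ρ Θ θ₀ X Z θinit w η μ K hd hm hn hA hS hinit hw hη₁ hη₂ hμ hμle hγ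
    exact ⟨hA.integrable_norm_output_sq hS hC₁ hn hw hinit _,
      hA.integral_norm_output_le hS hτ₁ hτ₂ hC₁ hCB hμbar hd hm hn hw hinit hη₁ hη₂ hμ hμle hγ⟩
  · have := FedSGD.smallness_pos hτ₁ hτ₂ hC₁ hCB hμbar
    positivity
  · intro Ω 𝒳 _ _ P _ F _ d m n ρ Θ θ₀ X Z θinit η μ hd hm hA hS hΘ hinit hη₁ hη₂ hμ hμle hmin
      N D κ K trVar V w θK
    obtain ⟨hn, hVpos, hLinit, hbound⟩ := hA.integral_norm_output_invWeights_le hS hτ₁ hτ₂ hC₁ hCB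
      hμbar hd hm hR hR₀ hΘ hinit hη₁ hη₂ hμ hμle hmin (V := V) rfl
    have hw := FedSGD.invWeights_mem hm hVpos
    refine ⟨hw, fun w' hw' => ?_, hA.integrable_norm_output_sq hS hC₁ hn hw hLinit _, ?_⟩
    · rw [FedSGD.sum_invWeights_sq_mul hm hVpos]
      exact FedSGD.inv_sum_inv_le hm hVpos hw'
    · have hclient : ∀ i, FedSGD.clientVar trVar CB μ κ d n i = trVar / n i +
          2 * CB ^ 2 * d * D * Real.log ((d : ℝ) * N) /
            (μ ^ 2 * (n i : ℝ) ^ 2 * Real.log (3 * τ₂ / (3 * τ₂ - τ₁))) := by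
        intro i
        simp only [FedSGD.clientVar, κ, FedSGD.iterBound, D, N]
        rw [← mul_div_assoc, div_div, mul_comm (Real.log (3 * τ₂ / (3 * τ₂ - τ₁)))]
        congr 2
        ring
      simp only [← hclient]
      exact hbound
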